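/- **Setting.** Let $0<T<\infty$ and let $q,r$ be complex-valued functions that solve $$iq_t+\tfrac1{\sqrt3}q_{xx}+2irr_x=0,\qquad ir_t-\tfrac1{\sqrt3}r_{xx}+2iqq_x=0\qquad(0<x<\infty,\ 0<t<T),$$ are $C^2$ on $\bar\Omega=[0,\infty)\times[0,T]$, and decay as $x\to\infty$ in the sense that $|\partial_x^mq(x,t)|,|\partial_x^mr(x,t)|\le g(x)$ for $m=0,1,2$ with some $g\in L^1(0,\infty)$. Let $\omega=e^{2\pi i/3}$, $J=\mathrm{diag}(1,\omega^2,\omega)$, $\mathcal L=kJ=\mathrm{diag}(l_1,l_2,l_3)$, $\mathcal Z=-k^2J^2=\mathrm{diag}(z_1,z_2,z_3)$, $\theta_{ij}(x,t,k)=(l_i-l_j)x+(z_i-z_j)t$, and $$V_1=\begin{pmatrix}0&q&r\\ r&0&q\\ q&r&0\end{pmatrix},\qquad V_2=k\begin{pmatrix}0&\omega q&\omega^2r\\ \omega r&0&q\\ \omega^2q&r&0\end{pmatrix}+\frac i{\sqrt3}\begin{pmatrix}0&q_x&-r_x\\ -r_x&0&q_x\\ q_x&-r_x&0\end{pmatrix}-\begin{pmatrix}0&r^2&q^2\\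 q^2&0&r^2\\ r^2&q^2&0\end{pmatrix}.$$ Let $\gamma_1,\gamma_2,\gamma_3$ be the contours $(0,T)\to(0,t)\to(x,t)$, $(0,0)\to(0,t)\to(x,t)$ and $(\infty,t)\to(x,t)$ composed of straight segments. Consider the Lax pair $$\mu_x-[\mathcal L,\mu]=V_1\mu,\qquad \mu_t-[\mathcal Z,\mu]=V_2\mu\tag{1}$$ on $\bar\Omega$, and its solutions given, column by column, by $$\mu_{ij}(x,t,k)=\delta_{ij}+\int_{\gamma_{ij}}e^{(l_i-l_j)(x-x')+(z_i-z_j)(t-t')}\bigl((V_1dx'+V_2dt')\mu(x',t',k)\bigr)_{ij}.\tag{2}$$ * $\mu_1$ is the solution with all $\gamma_{ij}=\gamma_1$; $\mu_3$ is the bounded solution with all $\gamma_{ij}=\gamma_3$ (a column of $\mu_3$ is considered only for those $k$ for which the exponentials in it are bounded; for the third column this is $k\in\bar{\mathcal S}$, see below). $\mu_3^A$ is defined like $\mu_3$, with $\mathcal L,\mathcal Z,V_1,V_2$ replaced by $-\mathcal L,-\mathcal Z,-V_1^T,-V_2^T$. * $M(x,t,k)$ is the solution of (1) and (2), bounded on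 $\bar\Omega$, with $\gamma_{ij}=\gamma_3$ if $\mathrm{Re}\,l_i\ge\mathrm{Re}\,l_j$, $\gamma_{ij}=\gamma_1$ if $\mathrm{Re}\,l_i<\mathrm{Re}\,l_j$ and $\mathrm{Re}\,z_i\ge\mathrm{Re}\,z_j$, and $\gamma_{ij}=\gamma_2$ if $\mathrm{Re}\,l_i<\mathrm{Re}\,l_j$ and $\mathrm{Re}\,z_i<\mathrm{Re}\,z_j$. Each column is well-defined at those $k$ where the problem for that column has exactly one solution. Put $s(k)=\mu_3(0,0,k)$, $S(k)=\mu_1(0,0,k)$, $s^A(k)=\mu_3^A(0,0,k)$; let $m_{ij}(S)$ be the $(ij)$-th minor of $S$ (row $i$ and column $j$ deleted) and $m_{ij}(s)=(-1)^{i+j}(s^A)_{ij}$. Let $[X]_j$ be the $j$-th column of $X$, $\dot f=df/dk$, and $$\begin{aligned}W_1&=S_{11}m_{11}(s)-S_{21}m_{21}(s)+S_{31}m_{31}(s),& W_2&=m_{11}(s)m_{22}(S)-m_{21}(s)m_{12}(S),\\ W_3&=m_{22}(s)m_{11}(S)-m_{12}(s)m_{21}(S),& W_4&=-S_{12}m_{12}(s)+S_{22}m_{22}(s)-S_{32}m_{32}(s).\end{aligned}$$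 Let $\mathcal S=D_1\cup D_2\cup D_3\cup D_4$, where $$\begin{aligned}D_1&=\{\mathrm{Re}\,l_3<\mathrm{Re}\,l_2<\mathrm{Re}\,l_1,\ \mathrm{Re}\,z_1<\mathrm{Re}\,z_3<\mathrm{Re}\,z_2\},& D_2&=\{\mathrm{Re}\,l_3<\mathrm{Re}\,l_2<\mathrm{Re}\,l_1,\ \mathrm{Re}\,z_3<\mathrm{Re}\,z_1<\mathrm{Re}\,z_2\},\\ D_3&=\{\mathrm{Re}\,l_3<\mathrm{Re}\,l_1<\mathrm{Re}\,l_2,\ \mathrm{Re}\,z_3<\mathrm{Re}\,z_2<\mathrm{Re}\,z_1\},& D_4&=\{\mathrm{Re}\,l_3<\mathrm{Re}\,l_1<\mathrm{Re}\,l_2,\ \mathrm{Re}\,z_2<\mathrm{Re}\,z_3<\mathrm{Re}\,z_1\}.\end{aligned}$$ **Assumption.** There are integers $0\le n_1\le n_2\le n_3\le n_4\le n_5\le N$ and pairwise distinct points $k_1,\dots,k_N$ such that the zeros of $s_{33}$ in $D_1\cup D_2$ are $k_1,\dots,k_{n_1}$; the zeros of $W_1$ in $D_1$ are $k_{n_1+1},\dots,k_{n_2}$;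 the zeros of $W_2$ in $D_2$ are $k_{n_2+1},\dots,k_{n_3}$; the zeros of $s_{33}$ in $D_3\cup D_4$ are $k_{n_3+1},\dots,k_{n_4}$; the zeros of $W_3$ in $D_3$ are $k_{n_4+1},\dots,k_{n_5}$; the zeros of $W_4$ in $D_4$ are $k_{n_5+1},\dots,k_N$; and all these zeros are simple. Moreover $s_{33}$ has no zeros on $\partial D_1,\dots,\partial D_4$, and $W_n$ has none on $\partial D_n$, $n=1,\dots,4$. **Claim.** The column $[M]_2$ for $1\le j\le n_1$ and for $n_4<j\le N$, and the column $[M]_1$ for $n_1<j\le n_4$, is well-defined in a punctured neighbourhood of $k_j$; the columns of $M(x,t,k_j)$ on the right-hand sides below are well-defined. For each $(x,t)\in\bar\Omega$ that column of $M$, as a function of $k$, is analytic in a punctured neighbourhood of $k_j$ and has at $k_j$ at most a simple pole, with the following residue, provided that the denominator $s_{13}(k_j)$, respectively $m_{i1}(s(k_j))$ or $m_{i2}(s(k_j))$, that occurs in the formula is not zero: $$\begin{aligned} \operatorname*{Res}_{k_j}[M]_2&=\frac{m_{21}(s(k_j))}{s_{13}(k_j)\dot s_{33}(k_j)}e^{\theta_{32}(k_j)}[M(k_j)]_3,&&1\le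 j\le n_1,\\ \operatorname*{Res}_{k_j}[M]_1&=\frac1{\dot W_1(k_j)}\Bigl\{\frac{S_{11}(k_j)s_{23}(k_j)-S_{21}(k_j)s_{13}(k_j)}{m_{31}(s(k_j))}e^{\theta_{21}(k_j)}[M(k_j)]_2+\frac{S_{31}(k_j)}{s_{33}(k_j)}e^{\theta_{31}(k_j)}[M(k_j)]_3\Bigr\},&&n_1<j\le n_2,\\ \operatorname*{Res}_{k_j}[M]_1&=\frac{m_{22}(S(k_j))s_{33}(k_j)}{\dot W_2(k_j)m_{21}(s(k_j))}e^{\theta_{21}(k_j)}[M(k_j)]_2,&&n_2<j\le n_3,\\ \operatorname*{Res}_{k_j}[M]_1&=\frac{m_{22}(s(k_j))}{s_{13}(k_j)\dot s_{33}(k_j)}e^{\theta_{31}(k_j)}[M(k_j)]_3,&&n_3<j\le n_4,\\ \operatorname*{Res}_{k_j}[M]_2&=\frac{m_{21}(S(k_j))s_{33}(k_j)}{\dot W_3(k_j)m_{22}(s(k_j))}e^{\theta_{12}(k_j)}[M(k_j)]_1,&&n_4<j\le n_5,\\ \operatorname*{Res}_{k_j}[M]_2&=\frac1{\dot W_4(k_j)}\Bigl\{\frac{S_{12}(k_j)s_{23}(k_j)-S_{22}(k_j)s_{13}(k_j)}{m_{32}(s(k_j))}e^{\theta_{12}(k_j)}[M(k_j)]_1+\frac{S_{32}(k_j)}{s_{33}(k_j)}e^{\theta_{32}(k_j)}[M(k_j)]_3\Bigr\},&&n_5<j\le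 N, \end{aligned}$$ where the $(x,t)$-dependence of $M$ and $\theta_{ij}$ is suppressed. -/

import Mathlib

open Set Filter Topology MeasureTheory

noncomputable section

namespace HalfLine

/-! Matrix and column indices 1, 2, 3 are written 0, 1, 2 (elements of `Fin 3`). -/

/-- The closed half-line domain `0 ≤ x < ∞`, `0 ≤ t ≤ T`. -/
def closedDomain (T : ℝ) : Set (ℝ × ℝ) := Ici 0 ×ˢ Icc 0 T

/-- `q, r` solve the system
`i q_t + q_xx / √3 + 2 i r r_x = 0`, `i r_t - r_xx / √3 + 2 i q q_x = 0`
for `0 < x < ∞`, `0 < t < T`; they are `C²` up to the boundary, and together with their first two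
`x`-derivatives they decay as `x → ∞` in the sense of an integrable majorant uniform in `t`. -/
structure IsSolution (T : ℝ) (q r : ℝ → ℝ → ℂ) : Prop where
  smooth_q : ContDiffOn ℝ 2 (Function.uncurry q) (closedDomain T)
  smooth_r : ContDiffOn ℝ 2 (Function.uncurry r) (closedDomain T)
  eq_q : ∀ x t : ℝ, 0 < x → 0 < t → t < T →
    Complex.I * deriv (fun τ => q x τ) t
      + (1 / (√3 : ℝ) : ℂ) * iteratedDeriv 2 (fun y => q y t) x
      + 2 * Complex.I * r x t * deriv (fun y => r y t) x = 0
  eq_r : ∀ x t : ℝ, 0 < x → 0 < t → t < T →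
    Complex.I * deriv (fun τ => r x τ) t
      - (1 / (√3 : ℝ) : ℂ) * iteratedDeriv 2 (fun y => r y t) x
      + 2 * Complex.I * q x t * deriv (fun y => q y t) x = 0
  decay : ∃ g : ℝ → ℝ, IntegrableOn g (Ioi 0) ∧
    ∀ x t : ℝ, 0 < x → 0 < t → t < T → ∀ m ≤ 2,
      ‖iteratedDeriv m (fun y => q y t) x‖ ≤ g x ∧ ‖iteratedDeriv m (fun y => r y t) x‖ ≤ g x

/-! ### The Lax pair -/

/-- `ω = exp (2πi/3)`. -/
def omega : ℂ := Complex.exp (2 * (Real.pi : ℂ) * Complex.I / 3)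

/-- The diagonal entries of `J = diag (1, ω², ω)`. -/
def J : Fin 3 → ℂ := ![1, omega ^ 2, omega]

/-- The diagonal entries of `ℒ = k J`. -/
def l (k : ℂ) (i : Fin 3) : ℂ := k * J i

/-- The diagonal entries of `𝒵 = -k² J²`. -/
def z (k : ℂ) (i : Fin 3) : ℂ := -(k ^ 2 * J i ^ 2)

/-- The `x`-derivative on `[0, ∞)` (one-sided at `x = 0`). -/
def dx (f : ℝ → ℝ → ℂ) (x t : ℝ) : ℂ := derivWithin (fun y => f y t) (Ici 0) x

/-- The matrix `V₁(x,t)`. -/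
def V1 (q r : ℝ → ℝ → ℂ) (x t : ℝ) : Matrix (Fin 3) (Fin 3) ℂ :=
  !![0, q x t, r x t;
     r x t, 0, q x t;
     q x t, r x t, 0]

/-- The coefficient of `k` in `V₂(x,t,k)`. -/
def V21 (q r : ℝ → ℝ → ℂ) (x t : ℝ) : Matrix (Fin 3) (Fin 3) ℂ :=
  !![0, omega * q x t, omega ^ 2 * r x t;
     omega * r x t, 0, q x t;
     omega ^ 2 * q x t, r x t, 0]

/-- The part of `V₂(x,t,k)` that does not depend on `k`. -/
def V20 (q r : ℝ → ℝ → ℂ) (x t : ℝ) : Matrix (Fin 3) (Fin 3) ℂ :=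
  (Complex.I / (√3 : ℝ) : ℂ) •
    !![0, dx q x t, -dx r x t;
       -dx r x t, 0, dx q x t;
       dx q x t, -dx r x t, 0]
  - !![0, r x t ^ 2, q x t ^ 2;
       q x t ^ 2, 0, r x t ^ 2;
       r x t ^ 2, q x t ^ 2, 0]

/-- The matrix `V₂(x,t,k)`. -/
def V2 (q r : ℝ → ℝ → ℂ) (k : ℂ) (x t : ℝ) : Matrix (Fin 3) (Fin 3) ℂ :=
  k • V21 q r x t + V20 q r x t

/-! ### Eigenfunctions, column by column -/

/-- The three contours in the `(x,t)`-plane ending at `(x,t)`: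
`γ₁` is `(0,T) → (0,t) → (x,t)`, `γ₂` is `(0,0) → (0,t) → (x,t)`, `γ₃` is `(∞,t) → (x,t)`,
each composed of straight segments. -/
inductive Contour
  | γ₁
  | γ₂
  | γ₃

/-- The integral of
`exp ((a i - a j) (x - x') + (b i - b j) (t - t')) ((A dx' + B dt') w)_i` along a contour. -/
def contourIntegral (T : ℝ) (a b : Fin 3 → ℂ) (A B : ℝ → ℝ → Matrix (Fin 3) (Fin 3) ℂ)
    (c : Contour) (i j : Fin 3) (w : ℝ → ℝ → Fin 3 → ℂ) (x t : ℝ) : ℂ :=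
  match c with
  | .γ₁ =>
      (∫ τ in T..t, Complex.exp ((a i - a j) * x + (b i - b j) * (t - τ)) *
        (B 0 τ).mulVec (w 0 τ) i)
      + ∫ y in (0 : ℝ)..x, Complex.exp ((a i - a j) * (x - y)) * (A y t).mulVec (w y t) i
  | .γ₂ =>
      (∫ τ in (0 : ℝ)..t, Complex.exp ((a i - a j) * x + (b i - b j) * (t - τ)) *
        (B 0 τ).mulVec (w 0 τ) i)
      + ∫ y in (0 : ℝ)..x, Complex.exp ((a i - a j) * (x - y)) * (A y t).mulVec (w y t) i
  | .γ₃ =>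
      -∫ y in Ioi x, Complex.exp ((a i - a j) * (x - y)) * (A y t).mulVec (w y t) i

/-- `w` is the `j`-th column of a solution `μ` of the Lax pair
`μ_x - [diag a, μ] = A μ`, `μ_t - [diag b, μ] = B μ` on the closed half-line domain which satisfies
the integral equation `μ_ij = δ_ij + ∫_{c i} (e^{...} (A dx' + B dt') μ)_ij`, `i = 1, 2, 3`. -/
structure IsEigencolumn (T : ℝ) (a b : Fin 3 → ℂ) (A B : ℝ → ℝ → Matrix (Fin 3) (Fin 3) ℂ)
    (c : Fin 3 → Contour) (j : Fin 3) (w : ℝ → ℝ → Fin 3 → ℂ) : Prop where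
  continuousOn : ContinuousOn (Function.uncurry w) (closedDomain T)
  x_part : ∀ x t : ℝ, (x, t) ∈ closedDomain T → ∀ i,
    HasDerivWithinAt (fun y => w y t i)
      ((a i - a j) * w x t i + (A x t).mulVec (w x t) i) (Ici 0) x
  t_part : ∀ x t : ℝ, (x, t) ∈ closedDomain T → ∀ i,
    HasDerivWithinAt (fun τ => w x τ i)
      ((b i - b j) * w x t i + (B x t).mulVec (w x t) i) (Icc 0 T) t
  integrable : ∀ x t : ℝ, (x, t) ∈ closedDomain T → ∀ i, c i = Contour.γ₃ →
    IntegrableOn (fun y : ℝ =>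
      Complex.exp ((a i - a j) * (x - y)) * (A y t).mulVec (w y t) i) (Ioi x)
  integral_eq : ∀ x t : ℝ, (x, t) ∈ closedDomain T → ∀ i,
    w x t i = (if i = j then 1 else 0) + contourIntegral T a b A B (c i) i j w x t

/-- Bounded on the closed half-line domain. -/
def IsBoundedColumn (T : ℝ) (w : ℝ → ℝ → Fin 3 → ℂ) : Prop :=
  ∃ C : ℝ, ∀ x t : ℝ, (x, t) ∈ closedDomain T → ∀ i, ‖w x t i‖ ≤ C

/-- The contour `γ_ij` used in the `(i,j)`-entry of `M`; it is constant on each of the twelve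
sectors `D_n`, where it is `γ_ij^n`. -/
def contour (k : ℂ) (i j : Fin 3) : Contour :=
  if (l k i).re < (l k j).re then
    if (z k j).re ≤ (z k i).re then .γ₁ else .γ₂
  else .γ₃

/-- `w` is a `j`-th column of the eigenfunction `M(·,·,k)`. -/
def IsMColumn (T : ℝ) (q r : ℝ → ℝ → ℂ) (k : ℂ) (j : Fin 3) (w : ℝ → ℝ → Fin 3 → ℂ) : Prop :=
  IsEigencolumn T (l k) (z k) (V1 q r) (V2 q r k) (fun i => contour k i j) j w
    ∧ IsBoundedColumn T w

/-- The `j`-th column of `M(·,·,k)` is well-defined: its defining problem has exactly one solution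
on the closed half-line domain. -/
def MColumnWellDefined (T : ℝ) (q r : ℝ → ℝ → ℂ) (k : ℂ) (j : Fin 3) : Prop :=
  (∃ w, IsMColumn T q r k j w) ∧
    ∀ w w', IsMColumn T q r k j w → IsMColumn T q r k j w' →
      EqOn (Function.uncurry w) (Function.uncurry w') (closedDomain T)

/-- The sectionally analytic function `M(x,t,k)`, equal to `M_n(x,t,k)` for `k ∈ D_n`, with each
column defined wherever the problem for that column is solvable (arbitrary elsewhere). -/
def M (T : ℝ) (q r : ℝ → ℝ → ℂ) (x t : ℝ) (k : ℂ) : Matrix (Fin 3) (Fin 3) ℂ :=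
  Matrix.of fun i j => Classical.epsilon (IsMColumn T q r k j) x t i

/-- The `j`-th column `[X]_j` of a matrix. -/
def col (X : Matrix (Fin 3) (Fin 3) ℂ) (j : Fin 3) : Fin 3 → ℂ := fun i => X i j

/-- The eigenfunction `μ₁`, normalized at `(0,T)`. -/
def mu1 (T : ℝ) (q r : ℝ → ℝ → ℂ) (x t : ℝ) (k : ℂ) : Matrix (Fin 3) (Fin 3) ℂ :=
  Matrix.of fun i j => Classical.epsilon
    (IsEigencolumn T (l k) (z k) (V1 q r) (V2 q r k) (fun _ => .γ₁) j) x t i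

/-- The eigenfunction `μ₃`, normalized at `x = ∞`. Its columns exist for `k` in the closures of
`(ω𝒮, ω²𝒮, 𝒮)`, with `𝒮 = D₁ ∪ D₂ ∪ D₃ ∪ D₄`. -/
def mu3 (T : ℝ) (q r : ℝ → ℝ → ℂ) (x t : ℝ) (k : ℂ) : Matrix (Fin 3) (Fin 3) ℂ :=
  Matrix.of fun i j => Classical.epsilon (fun w : ℝ → ℝ → Fin 3 → ℂ =>
    IsEigencolumn T (l k) (z k) (V1 q r) (V2 q r k) (fun _ => .γ₃) j w
      ∧ IsBoundedColumn T w) x t i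

/-- The cofactor eigenfunction `μ₃^A`, the solution normalized at `x = ∞` of
`μ_x + [ℒ, μ] = -V₁ᵀ μ`, `μ_t + [𝒵, μ] = -V₂ᵀ μ`. Its columns exist for `k` in the closures of
`(-ω𝒮, -ω²𝒮, -𝒮)`. -/
def mu3A (T : ℝ) (q r : ℝ → ℝ → ℂ) (x t : ℝ) (k : ℂ) : Matrix (Fin 3) (Fin 3) ℂ :=
  Matrix.of fun i j => Classical.epsilon (fun w : ℝ → ℝ → Fin 3 → ℂ =>
    IsEigencolumn T (fun i => -l k i) (fun i => -z k i)
        (fun x t => -(V1 q r x t).transpose) (fun x t => -(V2 q r k x t).transpose)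
        (fun _ => .γ₃) j w
      ∧ IsBoundedColumn T w) x t i

/-! ### Spectral functions -/

/-- `s(k) = μ₃(0,0,k)`. -/
def s (T : ℝ) (q r : ℝ → ℝ → ℂ) (k : ℂ) : Matrix (Fin 3) (Fin 3) ℂ := mu3 T q r 0 0 k

/-- `S(k) = μ₁(0,0,k)`. -/
def S (T : ℝ) (q r : ℝ → ℝ → ℂ) (k : ℂ) : Matrix (Fin 3) (Fin 3) ℂ := mu1 T q r 0 0 k

/-- The cofactor matrix `s^A(k) = μ₃^A(0,0,k)`. -/
def sA (T : ℝ) (q r : ℝ → ℝ → ℂ) (k : ℂ) : Matrix (Fin 3) (Fin 3) ℂ := mu3A T q r 0 0 k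

/-- The minor `m_ij(S(k))`: delete row `i` and column `j`, take the determinant. -/
def mS (T : ℝ) (q r : ℝ → ℝ → ℂ) (k : ℂ) (i j : Fin 3) : ℂ :=
  ((S T q r k).submatrix i.succAbove j.succAbove).det

/-- The minor `m_ij(s(k))`, read off from the cofactor matrix `s^A(k)`, whose `(i,j)`-entry is
`(-1)^(i+j) m_ij(s(k))`. (In general the minors that occur below are defined at `k` although
some of the entries of `s(k)` of which they are composed are not.) -/
def ms (T : ℝ) (q r : ℝ → ℝ → ℂ) (k : ℂ) (i j : Fin 3) : ℂ :=
  (-1) ^ ((i : ℕ) + (j : ℕ)) * sA T q r k i j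

def W1 (T : ℝ) (q r : ℝ → ℝ → ℂ) (k : ℂ) : ℂ :=
  S T q r k 0 0 * ms T q r k 0 0 - S T q r k 1 0 * ms T q r k 1 0
    + S T q r k 2 0 * ms T q r k 2 0

def W2 (T : ℝ) (q r : ℝ → ℝ → ℂ) (k : ℂ) : ℂ :=
  ms T q r k 0 0 * mS T q r k 1 1 - ms T q r k 1 0 * mS T q r k 0 1

def W3 (T : ℝ) (q r : ℝ → ℝ → ℂ) (k : ℂ) : ℂ :=
  ms T q r k 1 1 * mS T q r k 0 0 - ms T q r k 0 1 * mS T q r k 1 0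

def W4 (T : ℝ) (q r : ℝ → ℝ → ℂ) (k : ℂ) : ℂ :=
  -(S T q r k 0 1 * ms T q r k 0 1) + S T q r k 1 1 * ms T q r k 1 1
    - S T q r k 2 1 * ms T q r k 2 1

/-- The entry `s₃₃(k)`. -/
def s33 (T : ℝ) (q r : ℝ → ℝ → ℂ) (k : ℂ) : ℂ := s T q r k 2 2

/-- `θ_ij(x,t,k) = (l_i - l_j) x + (z_i - z_j) t`. -/
def theta (i j : Fin 3) (x t : ℝ) (k : ℂ) : ℂ := (l k i - l k j) * x + (z k i - z k j) * t

/-! ### The sectors composing `𝒮` -/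

def D1 : Set ℂ := {k | (l k 2).re < (l k 1).re ∧ (l k 1).re < (l k 0).re ∧
  (z k 0).re < (z k 2).re ∧ (z k 2).re < (z k 1).re}

def D2 : Set ℂ := {k | (l k 2).re < (l k 1).re ∧ (l k 1).re < (l k 0).re ∧
  (z k 2).re < (z k 0).re ∧ (z k 0).re < (z k 1).re}

def D3 : Set ℂ := {k | (l k 2).re < (l k 0).re ∧ (l k 0).re < (l k 1).re ∧
  (z k 2).re < (z k 1).re ∧ (z k 1).re < (z k 0).re}

def D4 : Set ℂ := {k | (l k 2).re < (l k 0).re ∧ (l k 0).re < (l k 1).re ∧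
  (z k 1).re < (z k 2).re ∧ (z k 2).re < (z k 0).re}

/-- The zeros of `f` in `D` are exactly the `κ j` with `n < j ≤ m`, and they are simple. -/
def SimpleZeros (f : ℂ → ℂ) (D : Set ℂ) (κ : ℕ → ℂ) (n m : ℕ) : Prop :=
  {k | k ∈ D ∧ f k = 0} = κ '' Ioc n m ∧ ∀ j ∈ Ioc n m, deriv f (κ j) ≠ 0

/-- The assumption on the zeros `κ 1, …, κ N` of `s₃₃, W₁, …, W₄` in `𝒮`: they are simple, no two of
them coincide, and none of these functions vanishes on the boundary of a sector on which it is
considered. -/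
structure ZeroAssumption (T : ℝ) (q r : ℝ → ℝ → ℂ) (n₁ n₂ n₃ n₄ n₅ N : ℕ) (κ : ℕ → ℂ) :
    Prop where
  le₁₂ : n₁ ≤ n₂
  le₂₃ : n₂ ≤ n₃
  le₃₄ : n₃ ≤ n₄
  le₄₅ : n₄ ≤ n₅
  le₅ : n₅ ≤ N
  zeros_s33 : SimpleZeros (s33 T q r) (D1 ∪ D2) κ 0 n₁
  zeros_W1 : SimpleZeros (W1 T q r) D1 κ n₁ n₂
  zeros_W2 : SimpleZeros (W2 T q r) D2 κ n₂ n₃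
  zeros_s33' : SimpleZeros (s33 T q r) (D3 ∪ D4) κ n₃ n₄
  zeros_W3 : SimpleZeros (W3 T q r) D3 κ n₄ n₅
  zeros_W4 : SimpleZeros (W4 T q r) D4 κ n₅ N
  distinct : InjOn κ (Ioc 0 N)
  boundary_s33 : ∀ k ∈ frontier D1 ∪ frontier D2 ∪ frontier D3 ∪ frontier D4, s33 T q r k ≠ 0
  boundary_W1 : ∀ k ∈ frontier D1, W1 T q r k ≠ 0
  boundary_W2 : ∀ k ∈ frontier D2, W2 T q r k ≠ 0
  boundary_W3 : ∀ k ∈ frontier D3, W3 T q r k ≠ 0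
  boundary_W4 : ∀ k ∈ frontier D4, W4 T q r k ≠ 0

/-- `f` is analytic in a punctured neighbourhood of `p`, has at `p` at most a simple pole, and its
residue there is `R`. -/
def HasSimplePoleResidue (f : ℂ → Fin 3 → ℂ) (p : ℂ) (R : Fin 3 → ℂ) : Prop :=
  ∃ g : ℂ → Fin 3 → ℂ, AnalyticAt ℂ g p ∧ ∀ᶠ k in 𝓝[≠] p, f k = (k - p)⁻¹ • R + g k

end HalfLine

end

open Set Filter Topology MeasureTheory

noncomputable section

namespace HalfLine

section

/-! ### Linear differential equations depending holomorphically on a parameter -/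

section LinearODE

variable {E : Type*} [NormedAddCommGroup E] [NormedSpace ℂ E] [CompleteSpace E]

/-! For fixed `k`, zero curvature makes the Lax pair compatible. If `Φ(x,t,k)` is the fundamental
matrix that equals the identity at the origin, every solution normalized as a `j`-th column is
`exp(-(l_j x + z_j t)) Φ v`, with `v` its value at `(0,0)`. Since `Φ` is entire in `k`, a column of
`M` is controlled by the single vector `v(k)`.

The integral equations become boundary conditions (`isEigencolumn_iff`): an off-diagonal entry on γ₁
vanishes at `(0,T)`, one on γ₂ vanishes at `(0,0)`, and for bounded solutions γ₃ only asks that the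
diagonal entry tend to 1 as `x → ∞`. With indices counted from 0, the sectors satisfy `Re l_2 < Re
l_m < Re l_p`, where `(p,m)` is `(0,1)` in `D₁ ∪ D₂` and `(1,0)` in `D₃ ∪ D₄`, so one computation in
`p`, `m` serves both halves.

Let `σ` be the last column of `s`, `τ` the column `p` of `s^A`, `S_p` the column `p` of `S`, and
`e₂` the last basis vector. The boundary conditions determine the values at the origin: `σ` for the
last column; `±(e₂ × τ)/σ₂` for column `m` (`mid_iff`); and for column `p` either `S_p/(τ·S_p)`
(`first_iff_of_end`) or `N/(τ·N)`, where `N` is the combination of `S_p` and `S_2` with vanishing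
last entry (`first_iff_of_minor`). The denominators are `s₃₃`, then `W₁` or `W₄`, then `W₂` or `W₃`.
All ingredients are holomorphic, by `LaxFamily.exists_fundamental` and `LaxFamily.exists_jost`, so a
simple zero of a denominator `f` gives at most a simple pole, whose residue has value numerator over
`f'` at the origin (`residue_of_isColumnValue`).

What remains is linear algebra at the zero `κ`. Always `τ·σ = 0`, because the pairing of two bounded
solutions cannot grow exponentially. Where `σ₂ = 0`, both `σ` and `e₂ × τ` are orthogonal to `τ` and
`e₂`; where `τ·S_p = 0` or `τ·N = 0`, the numerator lies in the plane orthogonal to `τ`. Under the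
stated nonvanishing conditions the numerator is therefore a combination of the values of the other
columns, and passing from the normalization of one column to that of another produces the factors
`exp(θ_ij)`. -/

theorem continuous_deriv_of_differentiable {X : Type*} [TopologicalSpace X]
    [FirstCountableTopology X] {f : X → ℂ → E}
    (hf : Continuous (Function.uncurry f)) (hd : ∀ x, Differentiable ℂ (f x)) :
    Continuous fun p : X × ℂ => deriv (f p.1) p.2 := by
  -- Cauchy's formula on a circle of fixed radius expresses the derivative through values of `f`
  -- alone, so joint continuity passes to it.
  have h : ∀ p : X × ℂ, deriv (f p.1) p.2 = (2 * Real.pi * Complex.I : ℂ)⁻¹ •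
      ∮ z in C(p.2, 1), (1 / (z - p.2) ^ 2) • f p.1 z := by
    intro p
    rw [(hd p.1).differentiableOn.deriv_eq_smul_circleIntegral one_pos, smul_smul,
      inv_mul_cancel₀ Complex.two_pi_I_ne_zero, one_smul]
  have h' : (fun p : X × ℂ => deriv (f p.1) p.2) = fun p : X × ℂ =>
      (2 * Real.pi * Complex.I : ℂ)⁻¹ • ∫ θ in (0 : ℝ)..2 * Real.pi,
        (circleMap 0 1 θ * Complex.I) • (1 / (circleMap 0 1 θ) ^ 2) •
          f p.1 (p.2 + circleMap 0 1 θ) := by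
    funext p
    rw [h p, circleIntegral]
    congr 1
    refine intervalIntegral.integral_congr fun θ _ => ?_
    simp [circleMap]
  rw [h']
  refine Continuous.const_smul ?_ _
  refine intervalIntegral.continuous_parametric_intervalIntegral_of_continuous' ?_ _ _
  have h1 : Continuous fun p : (X × ℂ) × ℝ => circleMap 0 1 p.2 :=
    (continuous_circleMap 0 1).comp continuous_snd
  have h2 : Continuous fun p : (X × ℂ) × ℝ => f p.1.1 (p.1.2 + circleMap 0 1 p.2) :=
    hf.comp (f := fun p : (X × ℂ) × ℝ => (p.1.1, p.1.2 + circleMap 0 1 p.2)) (by fun_prop)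
  refine (h1.mul continuous_const).smul (Continuous.smul ?_ h2)
  refine continuous_const.div (h1.pow 2) fun p => ?_
  simp [circleMap]

theorem differentiable_intervalIntegral {f : ℝ → ℂ → E}
    (hf : Continuous (Function.uncurry f)) (hd : ∀ s, Differentiable ℂ (f s)) (a b : ℝ) :
    Differentiable ℂ fun k => ∫ s in a..b, f s k := by
  intro k
  have hc := continuous_deriv_of_differentiable hf hd
  obtain ⟨C, hC⟩ := ((isCompact_uIcc (a := a) (b := b)).prod
    (isCompact_closedBall k 1)).exists_bound_of_continuousOn hc.continuousOn
  have hsec : ∀ k, Continuous fun s => f s k := fun k => hf.comp (by fun_prop : Continuous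
    fun s : ℝ => (s, k))
  refine (intervalIntegral.hasDerivAt_integral_of_dominated_loc_of_deriv_le
    (F := fun k s => f s k) (F' := fun k s => deriv (f s) k) (bound := fun _ => C)
    (Metric.closedBall_mem_nhds k one_pos) (Eventually.of_forall fun k =>
      (hsec k).aestronglyMeasurable) ((hsec k).intervalIntegrable _ _)
    (hc.comp (by fun_prop : Continuous fun s : ℝ => (s, k))).aestronglyMeasurable
    (Eventually.of_forall fun s hs k' hk' => hC (s, k') ⟨uIoc_subset_uIcc hs, hk'⟩)
    intervalIntegrable_const
    (Eventually.of_forall fun s _ k' _ => (hd s k').hasDerivAt)).2.differentiableAt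

variable {𝔸 : Type*} [NormedRing 𝔸] [NormedAlgebra ℂ 𝔸]

/-- The terms of the Picard series of `Y' = A Y`, `Y(0) = 1`. -/
def picardTerm (A : ℝ → ℝ → ℂ → 𝔸) : ℕ → ℝ → ℝ → ℂ → 𝔸
  | 0 => fun _ _ _ => 1
  | n + 1 => fun x t k => ∫ s in (0 : ℝ)..x, A s t k * picardTerm A n s t k

variable {A : ℝ → ℝ → ℂ → 𝔸}

theorem continuous_picardTerm (hA : Continuous fun p : ℝ × ℝ × ℂ => A p.1 p.2.1 p.2.2) (n : ℕ) :
    Continuous fun p : ℝ × ℝ × ℂ => picardTerm A n p.1 p.2.1 p.2.2 := by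
  induction n with
  | zero => exact continuous_const
  | succ n ih =>
    have h : Continuous (Function.uncurry fun (p : ℝ × ℝ × ℂ) (s : ℝ) =>
        A s p.2.1 p.2.2 * picardTerm A n s p.2.1 p.2.2) :=
      (hA.comp (f := fun q : (ℝ × ℝ × ℂ) × ℝ => (q.2, q.1.2.1, q.1.2.2)) (by fun_prop)).mul
        (ih.comp (f := fun q : (ℝ × ℝ × ℂ) × ℝ => (q.2, q.1.2.1, q.1.2.2)) (by fun_prop))
    exact intervalIntegral.continuous_parametric_intervalIntegral_of_continuous h continuous_fst

theorem differentiable_picardTerm [CompleteSpace 𝔸]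
    (hA : Continuous fun p : ℝ × ℝ × ℂ => A p.1 p.2.1 p.2.2)
    (hd : ∀ x t, Differentiable ℂ (A x t)) (n : ℕ) (x t : ℝ) :
    Differentiable ℂ (picardTerm A n x t) := by
  induction n generalizing x with
  | zero => exact differentiable_const _
  | succ n ih =>
    refine differentiable_intervalIntegral (f := fun s k => A s t k * picardTerm A n s t k)
      ?_ (fun s => (hd s t).mul (ih s)) 0 x
    exact (hA.comp (f := fun q : ℝ × ℂ => (q.1, t, q.2)) (by fun_prop)).mul
      ((continuous_picardTerm hA n).comp (f := fun q : ℝ × ℂ => (q.1, t, q.2)) (by fun_prop))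

/-- The iterated integral runs over a simplex of volume `|x|^n / n!`; this factorial makes the
Picard series converge uniformly on bounded sets of `(x,t,k)`. -/
theorem norm_picardTerm_le {C R : ℝ} {t : ℝ} {k : ℂ} (hC : 0 ≤ C)
    (hbd : ∀ s, |s| ≤ R → ‖A s t k‖ ≤ C) (n : ℕ) (x : ℝ) (hx : |x| ≤ R) :
    ‖picardTerm A n x t k‖ ≤ ‖(1 : 𝔸)‖ * ((C * |x|) ^ n / n.factorial) := by
  induction n generalizing x with
  | zero => simp [picardTerm]
  | succ n ih =>
    have hmem : ∀ s ∈ uIoc 0 x, |s| ≤ |x| := by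
      intro s hs
      rcases le_total 0 x with h | h
      · rw [uIoc_of_le h] at hs
        rw [abs_of_pos hs.1, abs_of_nonneg h]; exact hs.2
      · rw [uIoc_of_ge h] at hs
        rw [abs_of_nonpos hs.2, abs_of_nonpos h]; linarith [hs.1]
    have key : ‖picardTerm A (n + 1) x t k‖ ≤
        |∫ s in (0 : ℝ)..x, ‖(1 : 𝔸)‖ * (C ^ (n + 1) / n.factorial) * |s| ^ n| := by
      refine intervalIntegral.norm_integral_le_abs_of_norm_le ?_
        (Continuous.intervalIntegrable (by fun_prop) _ _)
      refine (ae_restrict_iff' measurableSet_uIoc).2 (Eventually.of_forall fun s hs => ?_)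
      have hs' := (hmem s hs).trans hx
      calc ‖A s t k * picardTerm A n s t k‖ ≤ C * (‖(1 : 𝔸)‖ * ((C * |s|) ^ n / n.factorial)) :=
            (norm_mul_le _ _).trans (mul_le_mul (hbd s hs') (ih s hs') (norm_nonneg _) hC)
        _ = _ := by rw [mul_pow]; ring
    refine key.trans (le_of_eq ?_)
    have hint : |∫ s in (0 : ℝ)..x, |s| ^ n| = |x| ^ (n + 1) / (n + 1) := by
      rcases le_total 0 x with h | h
      · have : ∫ s in (0 : ℝ)..x, |s| ^ n = ∫ s in (0 : ℝ)..x, s ^ n :=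
          intervalIntegral.integral_congr fun s hs => by
            rw [uIcc_of_le h] at hs; simp only [abs_of_nonneg hs.1]
        rw [this, integral_pow, abs_of_nonneg h, abs_of_nonneg]
        · simp
        · simp; positivity
      · have : ∫ s in (0 : ℝ)..x, |s| ^ n = ∫ s in (0 : ℝ)..x, (-s) ^ n :=
          intervalIntegral.integral_congr fun s hs => by
            rw [uIcc_of_ge h] at hs; simp only [abs_of_nonpos hs.2]
        rw [this, intervalIntegral.integral_comp_neg (fun s => s ^ n), integral_pow,
          abs_of_nonpos h, abs_of_nonpos]
        · simp; ring
        · have : 0 ≤ (-x) ^ (n + 1) := pow_nonneg (by linarith) _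
          simp only [neg_zero, ne_eq, Nat.add_eq_zero_iff, one_ne_zero, and_false,
            not_false_eq_true, zero_pow, zero_sub]
          exact div_nonpos_of_nonpos_of_nonneg (by linarith) (by positivity)
    rw [intervalIntegral.integral_const_mul, abs_mul, hint, abs_of_nonneg (by positivity),
      Nat.factorial_succ, mul_pow]
    push_cast
    field_simp

/-- The sum of the Picard series. Its terms are entire in `k` and converge uniformly on bounded
sets, so the sum is jointly continuous and entire in `k`. -/
theorem exists_fundamental_solution [CompleteSpace 𝔸]
    (hA : Continuous fun p : ℝ × ℝ × ℂ => A p.1 p.2.1 p.2.2)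
    (hd : ∀ x t, Differentiable ℂ (A x t)) :
    ∃ Y : ℝ → ℝ → ℂ → 𝔸, Continuous (fun p : ℝ × ℝ × ℂ => Y p.1 p.2.1 p.2.2) ∧
      (∀ t k, Y 0 t k = 1) ∧
      (∀ x t k, HasDerivAt (fun x => Y x t k) (A x t k * Y x t k) x) ∧
      ∀ x t, Differentiable ℂ (Y x t) := by
  have hbound : ∀ R : ℝ, ∃ u : ℕ → ℝ, Summable u ∧ ∀ n x t k, |x| ≤ R → |t| ≤ R → ‖k‖ ≤ R →
      ‖picardTerm A n x t k‖ ≤ u n ∧ ‖A x t k‖ ≤ u 0 := by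
    intro R
    obtain ⟨C, hC⟩ := (isCompact_closedBall (0 : ℝ × ℝ × ℂ) R).exists_bound_of_continuousOn
      hA.continuousOn
    have hmem : ∀ x t k, |x| ≤ R → |t| ≤ R → ‖k‖ ≤ R → ‖A x t k‖ ≤ max C 0 := by
      intro x t k hx ht hk
      refine (hC (x, t, k) ?_).trans (le_max_left _ _)
      rw [mem_closedBall_zero_iff]
      simp only [Prod.norm_def, Real.norm_eq_abs, sup_le_iff]
      exact ⟨hx, ht, hk⟩
    -- The extra term at `n = 0` makes `u 0` also a bound for `A`, which dominates the integrands
    -- when the series is integrated term by term.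
    refine ⟨fun n => ‖(1 : 𝔸)‖ * ((max C 0 * R) ^ n / n.factorial) +
      if n = 0 then max C 0 else 0, ?_, ?_⟩
    · refine ((Real.summable_pow_div_factorial _).mul_left _).add ?_
      exact summable_of_ne_finset_zero (s := {0}) fun n hn => by simp_all
    · intro n x t k hx ht hk
      have h0 : (0 : ℝ) ≤ max C 0 := le_max_right _ _
      have hR : 0 ≤ R := (abs_nonneg x).trans hx
      constructor
      · refine (norm_picardTerm_le h0 (fun s hs => hmem s t k hs ht hk) n x hx).trans ?_
        have h1 : ‖(1 : 𝔸)‖ * ((max C 0 * |x|) ^ n / n.factorial) ≤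
            ‖(1 : 𝔸)‖ * ((max C 0 * R) ^ n / n.factorial) := by gcongr
        refine h1.trans (le_add_of_nonneg_right ?_)
        split_ifs
        exacts [h0, le_rfl]
      · refine (hmem x t k hx ht hk).trans ?_
        simp
  let Y : ℝ → ℝ → ℂ → 𝔸 := fun x t k => ∑' n, picardTerm A n x t k
  have hcont : Continuous (fun p : ℝ × ℝ × ℂ => Y p.1 p.2.1 p.2.2) := by
    rw [continuous_iff_continuousAt]
    intro p
    obtain ⟨u, hu, hle⟩ := hbound (‖p‖ + 1)
    have hco : ContinuousOn (fun p : ℝ × ℝ × ℂ => Y p.1 p.2.1 p.2.2)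
        (Metric.closedBall 0 (‖p‖ + 1)) := by
      refine continuousOn_tsum (fun n => (continuous_picardTerm hA n).continuousOn) hu ?_
      intro n q hq
      rw [mem_closedBall_zero_iff] at hq
      simp only [Prod.norm_def (x := q), Prod.norm_def (x := q.2), Real.norm_eq_abs,
        sup_le_iff] at hq
      exact (hle n _ _ _ hq.1 hq.2.1 hq.2.2).1
    refine hco.continuousAt (mem_of_superset (Metric.ball_mem_nhds p one_pos) ?_)
    intro q hq
    rw [mem_ball_iff_norm] at hq
    rw [mem_closedBall_zero_iff]
    have := norm_add_le (q - p) p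
    rw [sub_add_cancel] at this
    linarith
  have hsum : ∀ x t k, HasSum (fun n => picardTerm A n x t k) (Y x t k) := by
    intro x t k
    obtain ⟨u, hu, hle⟩ := hbound (|x| + |t| + ‖k‖)
    have h1 := abs_nonneg x
    have h2 := abs_nonneg t
    have h3 := norm_nonneg k
    exact (Summable.of_norm_bounded hu fun n => (hle n x t k (by linarith) (by linarith)
      (by linarith)).1).hasSum
  have hint : ∀ x t k, Y x t k = 1 + ∫ s in (0 : ℝ)..x, A s t k * Y s t k := by
    intro x t k
    obtain ⟨u, hu, hle⟩ := hbound (|x| + |t| + ‖k‖)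
    have h1 := abs_nonneg x
    have h2 := abs_nonneg t
    have h3 := norm_nonneg k
    have hs : HasSum (fun n => picardTerm A (n + 1) x t k)
        (∫ s in (0 : ℝ)..x, A s t k * Y s t k) := by
      refine intervalIntegral.hasSum_integral_of_dominated_convergence
        (fun n _ => u 0 * u n) (fun n => ?_) (fun n => ?_) ?_ ?_ ?_
      · refine Continuous.aestronglyMeasurable ?_
        exact (hA.comp (f := fun s : ℝ => (s, t, k)) (by fun_prop)).mul
          ((continuous_picardTerm hA n).comp (f := fun s : ℝ => (s, t, k)) (by fun_prop))
      · refine Eventually.of_forall fun s hs => ?_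
        have hsx : |s| ≤ |x| := by
          have := abs_sub_left_of_mem_uIcc (uIoc_subset_uIcc hs)
          simpa using this
        have := hle n s t k (by linarith) (by linarith) (by linarith)
        exact (norm_mul_le _ _).trans (mul_le_mul this.2 this.1 (norm_nonneg _)
          ((norm_nonneg _).trans this.2))
      · exact Eventually.of_forall fun _ _ => hu.mul_left _
      · exact intervalIntegrable_const
      · exact Eventually.of_forall fun s _ => (hsum s t k).mul_left _
    have := (hasSum_nat_add_iff' 1).2 (hsum x t k)
    have h4 := this.unique hs
    rw [← h4]
    simp [picardTerm]
  refine ⟨Y, hcont, fun t k => by simpa using hint 0 t k, fun x t k => ?_, fun x t => ?_⟩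
  · have hc : Continuous fun s => A s t k * Y s t k :=
      (hA.comp (f := fun s : ℝ => (s, t, k)) (by fun_prop)).mul
        (hcont.comp (f := fun s : ℝ => (s, t, k)) (by fun_prop))
    have h := (hc.integral_hasStrictDerivAt 0 x).hasDerivAt.const_add 1
    exact h.congr_of_eventuallyEq (Eventually.of_forall fun y => hint y t k)
  · intro k
    obtain ⟨u, hu, hle⟩ := hbound (|x| + |t| + (‖k‖ + 1))
    have h1 := abs_nonneg x
    have h2 := abs_nonneg t
    have h3 := norm_nonneg k
    refine (Complex.differentiableOn_tsum_of_summable_norm (U := Metric.ball 0 (‖k‖ + 1)) hu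
      (fun n => (differentiable_picardTerm hA hd n x t).differentiableOn) Metric.isOpen_ball
      (fun n k' hk' => ?_)).differentiableAt (Metric.isOpen_ball.mem_nhds (by simp))
    rw [mem_ball_zero_iff] at hk'
    exact (hle n x t k' (by linarith) (by linarith) (by linarith)).1

end LinearODE

end

section

/-! ### Zero curvature and simultaneous solutions -/

section ZeroCurvature

variable {𝔸 : Type*} [NormedRing 𝔸] [NormedAlgebra ℝ 𝔸] [CompleteSpace 𝔸]

/-- Integrating the equation from `x = 0` and inserting the current bound gains a factor `C (1 + T)`
and one integration in `x`; the resulting bounds `K (C (1 + T) x)^n / n!` tend to zero. -/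
theorem eq_zero_of_volterra {T C : ℝ} (hC : 0 ≤ C) {E A D : ℝ → ℝ → 𝔸}
    (hE : Continuous (Function.uncurry E)) (hA : Continuous (Function.uncurry A))
    (hD : Continuous (Function.uncurry D)) {X : ℝ}
    (hAC : ∀ x ∈ Icc 0 X, ∀ t ∈ Icc 0 T, ‖A x t‖ ≤ C)
    (hDC : ∀ x ∈ Icc 0 X, ∀ t ∈ Icc 0 T, ‖D x t‖ ≤ C)
    (h0 : ∀ t ∈ Icc 0 T, E 0 t = 0)
    (hder : ∀ x t, 0 < x → t ∈ Icc 0 T →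
      HasDerivAt (fun x => E x t) (A x t * E x t - ∫ τ in (0 : ℝ)..t, D x τ * E x τ) x) :
    ∀ x ∈ Icc 0 X, ∀ t ∈ Icc 0 T, E x t = 0 := by
  obtain ⟨K, hK⟩ := ((isCompact_Icc (a := 0) (b := X)).prod
    (isCompact_Icc (a := 0) (b := T))).exists_bound_of_continuousOn hE.continuousOn
  have hbound : ∀ n : ℕ, ∀ x ∈ Icc 0 X, ∀ t ∈ Icc 0 T,
      ‖E x t‖ ≤ K * ((C * (1 + T) * x) ^ n / n.factorial) := by
    intro n
    induction n with
    | zero => intro x hx t ht; simpa using hK (x, t) ⟨hx, ht⟩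
    | succ n ih =>
      intro x hx t ht
      have hc : Continuous fun y => A y t * E y t - ∫ τ in (0 : ℝ)..t, D y τ * E y τ := by
        refine Continuous.sub ?_ ?_
        · exact (hA.comp (f := fun y : ℝ => (y, t)) (by fun_prop)).mul
            (hE.comp (f := fun y : ℝ => (y, t)) (by fun_prop))
        · exact intervalIntegral.continuous_parametric_intervalIntegral_of_continuous'
            (f := fun y τ => D y τ * E y τ) (hD.mul hE) 0 t
      have hftc := intervalIntegral.integral_eq_sub_of_hasDerivAt_of_le hx.1
        (hE.comp (f := fun y : ℝ => (y, t)) (by fun_prop)).continuousOn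
        (fun y hy => hder y t hy.1 ht) (hc.intervalIntegrable _ _)
      have hEx : E x t = ∫ y in (0 : ℝ)..x,
          (A y t * E y t - ∫ τ in (0 : ℝ)..t, D y τ * E y τ) := by
        rw [hftc]; simp [Function.uncurry, h0 t ht]
      rw [hEx]
      have hle : ∀ y ∈ Ioc 0 x, ‖A y t * E y t - ∫ τ in (0 : ℝ)..t, D y τ * E y τ‖ ≤
          C * (1 + T) * (K * ((C * (1 + T) * y) ^ n / n.factorial)) := by
        intro y hy
        have hy' : y ∈ Icc 0 X := ⟨hy.1.le, hy.2.trans hx.2⟩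
        set b := K * ((C * (1 + T) * y) ^ n / n.factorial) with hb
        have hb0 : 0 ≤ b := (norm_nonneg _).trans (ih y hy' t ht)
        have h1 : ‖A y t * E y t‖ ≤ C * b :=
          (norm_mul_le _ _).trans (mul_le_mul (hAC y hy' t ht) (ih y hy' t ht) (norm_nonneg _) hC)
        have h2 : ‖∫ τ in (0 : ℝ)..t, D y τ * E y τ‖ ≤ C * b * |t - 0| := by
          refine intervalIntegral.norm_integral_le_of_norm_le_const fun τ hτ => ?_
          rw [uIoc_of_le ht.1] at hτ
          have hτ' : τ ∈ Icc 0 T := ⟨hτ.1.le, hτ.2.trans ht.2⟩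
          exact (norm_mul_le _ _).trans (mul_le_mul (hDC y hy' τ hτ') (ih y hy' τ hτ')
            (norm_nonneg _) hC)
        rw [sub_zero, abs_of_nonneg ht.1] at h2
        have h3 : C * b * t ≤ C * b * T := mul_le_mul_of_nonneg_left ht.2 (by positivity)
        calc _ ≤ _ := norm_sub_le _ _
          _ ≤ C * b + C * b * T := by linarith
          _ = _ := by ring
      refine (intervalIntegral.norm_integral_le_of_norm_le hx.1
        (Eventually.of_forall fun y hy => hle y hy)
        (Continuous.intervalIntegrable (by fun_prop) _ _)).trans (le_of_eq ?_)
      have : ∀ y : ℝ, C * (1 + T) * (K * ((C * (1 + T) * y) ^ n / n.factorial)) =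
          K * (C * (1 + T)) ^ (n + 1) / n.factorial * y ^ n := fun y => by
        rw [mul_pow _ y]; ring
      simp_rw [this]
      rw [intervalIntegral.integral_const_mul, integral_pow, Nat.factorial_succ,
        mul_pow _ x]
      push_cast
      simp only [ne_eq, Nat.add_eq_zero_iff, one_ne_zero, and_false, not_false_eq_true, zero_pow,
        sub_zero]
      field_simp
  intro x hx t ht
  have hlim : Tendsto (fun n : ℕ => K * ((C * (1 + T) * x) ^ n / n.factorial)) atTop (𝓝 0) := by
    simpa using (FloorSemiring.tendsto_pow_div_factorial_atTop (C * (1 + T) * x)).const_mul K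
  exact norm_le_zero_iff.1 (ge_of_tendsto' hlim fun n => hbound n x hx t ht)

/-- The classical argument shows that `Φ_t - BΦ` solves the linear `x`-equation, but this needs `Φ`
differentiable in `t`. The integrated defect `E = Φ - F` avoids that: zero curvature and an
integration by parts in `t` give `E_x = A E - ∫ A' E dτ` with `E = 0` on `x = 0`, so
`eq_zero_of_volterra` applies. -/
theorem t_equation_of_zero_curvature {T : ℝ} {A B A' B' Φ : ℝ → ℝ → 𝔸}
    (hA : Continuous (Function.uncurry A)) (hB : Continuous (Function.uncurry B))
    (hA' : Continuous (Function.uncurry A')) (hB' : Continuous (Function.uncurry B'))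
    (hΦ : Continuous (Function.uncurry Φ))
    (hdA : ∀ x t, 0 < x → 0 < t → t < T → HasDerivAt (fun τ => A x τ) (A' x t) t)
    (hdB : ∀ x t, 0 < x → 0 < t → t < T → HasDerivAt (fun y => B y t) (B' x t) x)
    (hzc : ∀ x t, 0 < x → 0 < t → t < T → B' x t = A' x t + (A x t * B x t - B x t * A x t))
    (hΦx : ∀ x t, HasDerivAt (fun y => Φ y t) (A x t * Φ x t) x)
    (hΦt : ∀ t ∈ Icc 0 T, Φ 0 t = Φ 0 0 + ∫ τ in (0 : ℝ)..t, B 0 τ * Φ 0 τ) :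
    ∀ x t, 0 ≤ x → t ∈ Icc 0 T → Φ x t = Φ x 0 + ∫ τ in (0 : ℝ)..t, B x τ * Φ x τ := by
  have sec : ∀ {G : ℝ → ℝ → 𝔸}, Continuous (Function.uncurry G) → ∀ x, Continuous (G x) :=
    fun hG x => hG.comp (f := fun y : ℝ => (x, y)) (by fun_prop)
  have sec' : ∀ {G : ℝ → ℝ → 𝔸}, Continuous (Function.uncurry G) →
      ∀ t, Continuous fun x => G x t :=
    fun hG t => hG.comp (f := fun y : ℝ => (y, t)) (by fun_prop)
  set F : ℝ → ℝ → 𝔸 := fun x t => Φ x 0 + ∫ τ in (0 : ℝ)..t, B x τ * Φ x τ with hFdef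
  have hBΦ : Continuous (Function.uncurry fun x τ => B x τ * Φ x τ) := hB.mul hΦ
  have hF : Continuous (Function.uncurry F) := by
    refine Continuous.add (hΦ.comp (f := fun p : ℝ × ℝ => (p.1, (0 : ℝ))) (by fun_prop)) ?_
    exact intervalIntegral.continuous_parametric_primitive_of_continuous hBΦ
  have hFx : ∀ x t, 0 < x → t ∈ Icc 0 T → HasDerivAt (fun x => F x t)
      (A x 0 * Φ x 0 + ∫ τ in (0 : ℝ)..t, (B' x τ * Φ x τ + B x τ * (A x τ * Φ x τ))) x := by
    intro x t hx ht
    have hG : Continuous (Function.uncurry fun x τ => B' x τ * Φ x τ + B x τ * (A x τ * Φ x τ)) :=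
      (hB'.mul hΦ).add (hB.mul (hA.mul hΦ))
    obtain ⟨C, hC⟩ := ((isCompact_Icc (a := x / 2) (b := x + 1)).prod
      (isCompact_uIcc (a := 0) (b := t))).exists_bound_of_continuousOn hG.continuousOn
    refine (hΦx x 0).add (intervalIntegral.hasDerivAt_integral_of_dominated_loc_of_deriv_le
      (F := fun x τ => B x τ * Φ x τ)
      (F' := fun x τ => B' x τ * Φ x τ + B x τ * (A x τ * Φ x τ)) (bound := fun _ => C)
      (Icc_mem_nhds (by linarith : x / 2 < x) (by linarith : x < x + 1))
      (Eventually.of_forall fun y => (sec hBΦ y).aestronglyMeasurable)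
      ((sec hBΦ x).intervalIntegrable _ _) (sec hG x).aestronglyMeasurable
      (Eventually.of_forall fun τ hτ y hy => hC (y, τ) ⟨hy, uIoc_subset_uIcc hτ⟩)
      intervalIntegrable_const ?_).2
    -- The derivative of `B` is available only for `τ < T`; the endpoint is a null set.
    filter_upwards [compl_mem_ae_iff.2 (measure_singleton T)] with τ hτT hτ y hy
    rw [uIoc_of_le ht.1] at hτ
    exact (hdB y τ (by linarith [hy.1]) hτ.1 (lt_of_le_of_ne (hτ.2.trans ht.2) hτT)).mul (hΦx y τ)
  have hzci : ∀ x t, 0 < x → t ∈ Icc 0 T →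
      ∫ τ in (0 : ℝ)..t, (B' x τ * Φ x τ + B x τ * (A x τ * Φ x τ)) =
        ∫ τ in (0 : ℝ)..t, (A' x τ * Φ x τ + A x τ * (B x τ * Φ x τ)) := by
    intro x t hx ht
    refine intervalIntegral.integral_congr_ae ?_
    filter_upwards [compl_mem_ae_iff.2 (measure_singleton T)] with τ hτT hτ
    rw [uIoc_of_le ht.1] at hτ
    rw [hzc x τ hx hτ.1 (lt_of_le_of_ne (hτ.2.trans ht.2) hτT)]
    noncomm_ring
  have hAF : ∀ x t, 0 < x → t ∈ Icc 0 T → A x t * F x t - A x 0 * Φ x 0 =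
      ∫ τ in (0 : ℝ)..t, (A' x τ * F x τ + A x τ * (B x τ * Φ x τ)) := by
    intro x t hx ht
    rw [intervalIntegral.integral_eq_sub_of_hasDerivAt_of_le ht.1
      (f := fun τ => A x τ * F x τ) ((sec hA x).mul (sec hF x)).continuousOn]
    · simp [hFdef]
    · intro τ hτ
      refine (hdA x τ hx hτ.1 (hτ.2.trans_le ht.2)).mul ?_
      exact ((sec hBΦ x).integral_hasStrictDerivAt 0 τ).hasDerivAt.const_add _
    · exact (((sec hA' x).mul (sec hF x)).add
        ((sec hA x).mul (sec hBΦ x))).intervalIntegrable _ _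
  have hE : Continuous (Function.uncurry fun x t => Φ x t - F x t) := hΦ.sub hF
  have hEx : ∀ x t, 0 < x → t ∈ Icc 0 T → HasDerivAt (fun x => Φ x t - F x t)
      (A x t * (Φ x t - F x t) - ∫ τ in (0 : ℝ)..t, A' x τ * (Φ x τ - F x τ)) x := by
    intro x t hx ht
    refine ((hΦx x t).sub (hFx x t hx ht)).congr_deriv ?_
    have i1 : IntervalIntegrable (fun τ => A' x τ * Φ x τ) volume 0 t :=
      ((sec hA' x).mul (sec hΦ x)).intervalIntegrable _ _
    have i2 : IntervalIntegrable (fun τ => A' x τ * F x τ) volume 0 t :=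
      ((sec hA' x).mul (sec hF x)).intervalIntegrable _ _
    have i3 : IntervalIntegrable (fun τ => A x τ * (B x τ * Φ x τ)) volume 0 t :=
      ((sec hA x).mul (sec hBΦ x)).intervalIntegrable _ _
    have h1 := hAF x t hx ht
    rw [intervalIntegral.integral_add i2 i3] at h1
    rw [hzci x t hx ht, intervalIntegral.integral_add i1 i3]
    simp_rw [mul_sub]
    rw [intervalIntegral.integral_sub i1 i2]
    rw [sub_eq_iff_eq_add.1 h1]
    abel
  intro x t hx ht
  obtain ⟨C₁, hC₁⟩ := ((isCompact_Icc (a := 0) (b := x)).prod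
    (isCompact_Icc (a := 0) (b := T))).exists_bound_of_continuousOn hA.continuousOn
  obtain ⟨C₂, hC₂⟩ := ((isCompact_Icc (a := 0) (b := x)).prod
    (isCompact_Icc (a := 0) (b := T))).exists_bound_of_continuousOn hA'.continuousOn
  refine sub_eq_zero.1 (eq_zero_of_volterra (C := max (max C₁ C₂) 0) (le_max_right _ _)
    (E := fun x t => Φ x t - F x t) (A := A) (D := A') hE hA hA'
    (fun y hy τ hτ => (hC₁ (y, τ) ⟨hy, hτ⟩).trans (by simp))
    (fun y hy τ hτ => (hC₂ (y, τ) ⟨hy, hτ⟩).trans (by simp))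
    (fun τ hτ => ?_) hEx x ⟨hx, le_rfl⟩ t ht)
  rw [sub_eq_zero, hΦt τ hτ]

end ZeroCurvature

end

section

/-! ### Families of Lax pairs and their fundamental solutions -/

/-- Extension of a function on the closed half-line domain to the plane, constant along the
projections onto the domain. -/
def extend {E : Type*} (T : ℝ) (f : ℝ → ℝ → E) (x t : ℝ) : E := f (max x 0) (max 0 (min t T))

theorem mem_closedDomain {T x t : ℝ} : (x, t) ∈ closedDomain T ↔ 0 ≤ x ∧ 0 ≤ t ∧ t ≤ T := Iff.rfl

theorem extend_mem {T : ℝ} (hT : 0 ≤ T) (x t : ℝ) :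
    (max x 0, max 0 (min t T)) ∈ closedDomain T :=
  mem_closedDomain.2 ⟨le_max_right _ _, le_max_left _ _, max_le hT (min_le_right _ _)⟩

theorem extend_of_mem {E : Type*} {T x t : ℝ} (f : ℝ → ℝ → E) (h : (x, t) ∈ closedDomain T) :
    extend T f x t = f x t := by
  obtain ⟨h1, h2, h3⟩ := mem_closedDomain.1 h
  rw [extend, max_eq_left h1, min_eq_left h3, max_eq_right h2]

theorem continuous_extend {E : Type*} [TopologicalSpace E] {T : ℝ} (hT : 0 ≤ T) {f : ℝ → ℝ → E}
    (hf : ContinuousOn (Function.uncurry f) (closedDomain T)) :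
    Continuous (Function.uncurry (extend T f)) :=
  hf.comp_continuous (f := fun p : ℝ × ℝ => (max p.1 0, max 0 (min p.2 T))) (by fun_prop)
    fun p => extend_mem hT p.1 p.2

/-- A family, depending holomorphically on `k`, of Lax pairs `ψ_x = (diag a + A) ψ`,
`ψ_t = (diag b + B) ψ` on the closed half-line domain, which is traceless, satisfies the zero
curvature equation and decays as `x → ∞`. -/
structure LaxFamily (T : ℝ) (a b : ℂ → Fin 3 → ℂ) (A : ℝ → ℝ → Matrix (Fin 3) (Fin 3) ℂ)
    (B : ℂ → ℝ → ℝ → Matrix (Fin 3) (Fin 3) ℂ) : Prop where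
  differentiable_a : ∀ i, Differentiable ℂ fun k => a k i
  differentiable_b : ∀ i, Differentiable ℂ fun k => b k i
  sum_a : ∀ k, ∑ i, a k i = 0
  sum_b : ∀ k, ∑ i, b k i = 0
  trace_A : ∀ x t, (A x t).trace = 0
  trace_B : ∀ k x t, (B k x t).trace = 0
  continuousOn_A : ∀ i j, ContinuousOn (fun p : ℝ × ℝ => A p.1 p.2 i j) (closedDomain T)
  continuousOn_B : ∀ i j, ContinuousOn (fun p : ℂ × ℝ × ℝ => B p.1 p.2.1 p.2.2 i j)
    (univ ×ˢ closedDomain T)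
  differentiable_B : ∀ x t i j, Differentiable ℂ fun k => B k x t i j
  zero_curvature : ∀ k, ∃ A' B' : ℝ → ℝ → Matrix (Fin 3) (Fin 3) ℂ,
    (∀ i j, ContinuousOn (fun p : ℝ × ℝ => A' p.1 p.2 i j) (closedDomain T)) ∧
    (∀ i j, ContinuousOn (fun p : ℝ × ℝ => B' p.1 p.2 i j) (closedDomain T)) ∧
    ∀ x t, 0 < x → 0 < t → t < T →
      (∀ i j, HasDerivAt (fun τ => A x τ i j) (A' x t i j) t) ∧
      (∀ i j, HasDerivAt (fun y => B k y t i j) (B' x t i j) x) ∧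
      B' x t = A' x t +
        ((Matrix.diagonal (a k) + A x t) * (Matrix.diagonal (b k) + B k x t) -
          (Matrix.diagonal (b k) + B k x t) * (Matrix.diagonal (a k) + A x t))
  decay_A : ∃ G : ℝ → ℝ, IntegrableOn G (Ioi 0) ∧
    ∀ x t, 0 < x → t ∈ Icc 0 T → ∀ i j, ‖A x t i j‖ ≤ G x
  decay_B : ∀ k, ∀ ε > 0, ∃ X, ∀ x t, X ≤ x → t ∈ Icc 0 T → ∀ i j, ‖B k x t i j‖ ≤ ε

/-- `w` solves `w_x = (diag a - c + A) w`, `w_t = (diag b - d + B) w` on the closed half-line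
domain. -/
structure IsLaxSolution (T : ℝ) (a b : Fin 3 → ℂ) (A B : ℝ → ℝ → Matrix (Fin 3) (Fin 3) ℂ)
    (c d : ℂ) (w : ℝ → ℝ → Fin 3 → ℂ) : Prop where
  continuousOn : ContinuousOn (Function.uncurry w) (closedDomain T)
  x_part : ∀ x t : ℝ, (x, t) ∈ closedDomain T → ∀ i,
    HasDerivWithinAt (fun y => w y t i)
      ((a i - c) * w x t i + (A x t).mulVec (w x t) i) (Ici 0) x
  t_part : ∀ x t : ℝ, (x, t) ∈ closedDomain T → ∀ i,
    HasDerivWithinAt (fun τ => w x τ i)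
      ((b i - d) * w x t i + (B x t).mulVec (w x t) i) (Icc 0 T) t

section

attribute [local instance] Matrix.linftyOpNormedRing Matrix.linftyOpNormedAlgebra

theorem hasDerivAt_matrix {M : ℝ → Matrix (Fin 3) (Fin 3) ℂ} {M' : Matrix (Fin 3) (Fin 3) ℂ}
    {x : ℝ} : HasDerivAt M M' x ↔ ∀ i j, HasDerivAt (fun y => M y i j) (M' i j) x :=
  (hasDerivAt_pi (φ := M)).trans (forall_congr' fun _ => hasDerivAt_pi)

theorem differentiable_matrix {M : ℂ → Matrix (Fin 3) (Fin 3) ℂ} :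
    Differentiable ℂ M ↔ ∀ i j, Differentiable ℂ fun y => M y i j :=
  (differentiable_pi (Φ := M)).trans (forall_congr' fun _ => differentiable_pi)

theorem hasDerivAt_mulVec_of_hasDerivAt {Y : ℝ → Matrix (Fin 3) (Fin 3) ℂ} {a : Fin 3 → ℂ}
    {A : Matrix (Fin 3) (Fin 3) ℂ} {x : ℝ} (h : HasDerivAt Y ((Matrix.diagonal a + A) * Y x) x)
    (v : Fin 3 → ℂ) (i : Fin 3) : HasDerivAt (fun y => (Y y).mulVec v i)
      ((a i - 0) * (Y x).mulVec v i + A.mulVec ((Y x).mulVec v) i) x := by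
  have h1 : HasDerivAt (fun y => ∑ j, Y y i j * v j)
      (∑ j, ((Matrix.diagonal a + A) * Y x) i j * v j) x :=
    HasDerivAt.fun_sum fun j _ => (hasDerivAt_matrix.1 h i j).mul_const _
  refine h1.congr_deriv ?_
  change (((Matrix.diagonal a + A) * Y x).mulVec v) i = _
  rw [← Matrix.mulVec_mulVec, Matrix.add_mulVec, Pi.add_apply, Matrix.mulVec_diagonal, sub_zero]

/-- `Φ` transports the identity along `x = 0` by the `t`-equation and then along horizontal lines by
the `x`-equation. Zero curvature makes the `t`-equation hold at every `x`. The coefficients are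
extended to the plane so that the global existence theorem applies. -/
theorem LaxFamily.exists_fundamental {T : ℝ} (hT : 0 < T) {a b : ℂ → Fin 3 → ℂ}
    {A : ℝ → ℝ → Matrix (Fin 3) (Fin 3) ℂ} {B : ℂ → ℝ → ℝ → Matrix (Fin 3) (Fin 3) ℂ}
    (h : LaxFamily T a b A B) :
    ∃ Φ : ℂ → ℝ → ℝ → Matrix (Fin 3) (Fin 3) ℂ,
      (∀ k v, IsLaxSolution T (a k) (b k) A (B k) 0 0 fun x t => (Φ k x t).mulVec v) ∧
      (∀ k, Φ k 0 0 = 1) ∧ ∀ x t i j, Differentiable ℂ fun k => Φ k x t i j := by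
  have hca : ∀ i, Continuous fun k => a k i := fun i => (h.differentiable_a i).continuous
  have hcb : ∀ i, Continuous fun k => b k i := fun i => (h.differentiable_b i).continuous
  have hdiag : ∀ {f : ℂ → Fin 3 → ℂ}, (∀ i, Differentiable ℂ fun k => f k i) →
      Differentiable ℂ fun k => Matrix.diagonal (f k) := by
    intro f hf
    refine differentiable_matrix.2 fun i j => ?_
    by_cases hij : i = j
    · subst hij; simpa using hf i
    · simp [hij]
  have hext : ∀ {C : ℝ → ℝ → Matrix (Fin 3) (Fin 3) ℂ},
      (∀ i j, ContinuousOn (fun p : ℝ × ℝ => C p.1 p.2 i j) (closedDomain T)) →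
      Continuous (Function.uncurry (extend T C)) := fun hC =>
    continuous_extend hT.le (continuousOn_pi.2 fun i => continuousOn_pi.2 fun j => hC i j)
  have hBext : Continuous fun p : ℂ × ℝ × ℝ => extend T (B p.1) p.2.1 p.2.2 := by
    refine ContinuousOn.comp_continuous (s := univ ×ˢ closedDomain T)
      (g := fun p : ℂ × ℝ × ℝ => B p.1 p.2.1 p.2.2)
      (f := fun p : ℂ × ℝ × ℝ => (p.1, max p.2.1 0, max 0 (min p.2.2 T)))
      (continuousOn_pi.2 fun i => continuousOn_pi.2 fun j => h.continuousOn_B i j)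
      (by fun_prop) fun p => ⟨trivial, extend_mem hT.le _ _⟩
  obtain ⟨X, hXc, hX0, hXd, hXk⟩ := exists_fundamental_solution
    (A := fun x t k => Matrix.diagonal (a k) + extend T A x t)
    (((hdiag h.differentiable_a).continuous.comp (by fun_prop : Continuous
      fun p : ℝ × ℝ × ℂ => p.2.2)).add ((hext h.continuousOn_A).comp (by fun_prop : Continuous
      fun p : ℝ × ℝ × ℂ => (p.1, p.2.1))))
    (fun x t => (hdiag h.differentiable_a).add_const _)
  -- On the line `x = 0` only `t` and `k` matter, so the second argument of `Y` is a dummy, always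
  -- taken to be `0`.
  obtain ⟨Y, hYc, hY0, hYd, hYk⟩ := exists_fundamental_solution
    (A := fun t _ k => Matrix.diagonal (b k) + extend T (B k) 0 t)
    (((hdiag h.differentiable_b).continuous.comp (by fun_prop : Continuous
      fun p : ℝ × ℝ × ℂ => p.2.2)).add (hBext.comp (by fun_prop : Continuous
      fun p : ℝ × ℝ × ℂ => (p.2.2, (0 : ℝ), p.1))))
    (fun t _ => (hdiag h.differentiable_b).add
      (differentiable_matrix.2 fun i j => h.differentiable_B _ _ i j))
  let Φ : ℂ → ℝ → ℝ → Matrix (Fin 3) (Fin 3) ℂ := fun k x t => X x t k * Y t 0 k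
  have hΦc : ∀ k, Continuous (Function.uncurry (Φ k)) := fun k =>
    (hXc.comp (by fun_prop : Continuous fun p : ℝ × ℝ => (p.1, p.2, k))).mul
      (hYc.comp (by fun_prop : Continuous fun p : ℝ × ℝ => (p.2, (0 : ℝ), k)))
  have hΦx : ∀ k x t, HasDerivAt (fun y => Φ k y t)
      ((Matrix.diagonal (a k) + extend T A x t) * Φ k x t) x := by
    intro k x t
    refine ((hXd x t k).mul_const (Y t 0 k)).congr_deriv ?_
    rw [mul_assoc]
  have hBc : ∀ k, Continuous (Function.uncurry fun x t =>
      Matrix.diagonal (b k) + extend T (B k) x t) := fun k =>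
    continuous_const.add (hBext.comp (by fun_prop : Continuous fun p : ℝ × ℝ => (k, p.1, p.2)))
  have hΦ0 : ∀ k, Φ k 0 = fun t => Y t 0 k := fun k => by
    funext t; simp [Φ, hX0]
  have hint : ∀ k x t, 0 ≤ x → t ∈ Icc 0 T → Φ k x t = Φ k x 0 +
      ∫ τ in (0 : ℝ)..t, (Matrix.diagonal (b k) + extend T (B k) x τ) * Φ k x τ := by
    intro k
    obtain ⟨A', B', hA', hB', hz⟩ := h.zero_curvature k
    refine t_equation_of_zero_curvature (A := fun x t => Matrix.diagonal (a k) + extend T A x t)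
      (B := fun x t => Matrix.diagonal (b k) + extend T (B k) x t) (A' := extend T A')
      (B' := extend T B') (Φ := Φ k) (continuous_const.add (hext h.continuousOn_A)) (hBc k)
      (hext hA') (hext hB') (hΦc k) ?_ ?_ ?_ (hΦx k) ?_
    · intro x t hx ht htT
      have hm : (x, t) ∈ closedDomain T := ⟨hx.le, ht.le, htT.le⟩
      rw [extend_of_mem _ hm]
      refine HasDerivAt.const_add _ ((hasDerivAt_matrix.2 (hz x t hx ht htT).1).congr_of_eventuallyEq
        ?_)
      filter_upwards [Ioo_mem_nhds ht htT] with τ hτ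
      exact extend_of_mem A (mem_closedDomain.2 ⟨hx.le, hτ.1.le, hτ.2.le⟩)
    · intro x t hx ht htT
      have hm : (x, t) ∈ closedDomain T := ⟨hx.le, ht.le, htT.le⟩
      rw [extend_of_mem _ hm]
      refine HasDerivAt.const_add _ ((hasDerivAt_matrix.2
        (hz x t hx ht htT).2.1).congr_of_eventuallyEq ?_)
      filter_upwards [Ioi_mem_nhds hx] with y hy
      exact extend_of_mem (B k) (mem_closedDomain.2 ⟨le_of_lt hy, ht.le, htT.le⟩)
    · intro x t hx ht htT
      have hm : (x, t) ∈ closedDomain T := ⟨hx.le, ht.le, htT.le⟩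
      simp only [extend_of_mem _ hm]
      exact (hz x t hx ht htT).2.2
    · intro t ht
      rw [hΦ0]
      rw [intervalIntegral.integral_eq_sub_of_hasDerivAt (f := fun t => Y t 0 k)
        (fun τ _ => hYd τ 0 k)]
      · abel
      · refine Continuous.intervalIntegrable ?_ _ _
        exact ((hBc k).comp (by fun_prop : Continuous fun τ : ℝ => ((0 : ℝ), τ))).mul
          (hYc.comp (by fun_prop : Continuous fun τ : ℝ => (τ, (0 : ℝ), k)))
  refine ⟨Φ, fun k v => ⟨?_, ?_, ?_⟩, fun k => ?_, fun x t => ?_⟩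
  · exact (Continuous.matrix_mulVec (hΦc k) continuous_const).continuousOn
  · intro x t hm i
    have := hasDerivAt_mulVec_of_hasDerivAt (hΦx k x t) v i
    rw [extend_of_mem _ hm] at this
    exact this.hasDerivWithinAt
  · intro x t hm i
    have hc : Continuous fun τ => (Matrix.diagonal (b k) + extend T (B k) x τ) * Φ k x τ :=
      ((hBc k).comp (by fun_prop : Continuous fun τ : ℝ => (x, τ))).mul
        ((hΦc k).comp (by fun_prop : Continuous fun τ : ℝ => (x, τ)))
    have hd := (hc.integral_hasStrictDerivAt 0 t).hasDerivAt.const_add (Φ k x 0)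
    have hd' := hasDerivAt_mulVec_of_hasDerivAt (Y := fun t => Φ k x 0 +
      ∫ τ in (0 : ℝ)..t, (Matrix.diagonal (b k) + extend T (B k) x τ) * Φ k x τ)
      (a := b k) (A := extend T (B k) x t) (x := t)
      (hd.congr_deriv (by rw [← hint k x t hm.1 hm.2])) v i
    rw [extend_of_mem _ hm, ← hint k x t hm.1 hm.2] at hd'
    refine hd'.hasDerivWithinAt.congr_of_mem (fun τ hτ => ?_) hm.2
    rw [hint k x τ hm.1 hτ]
  · simp [Φ, hX0, hY0]
  · exact differentiable_matrix.1 ((hXk x t).mul (hYk t 0))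

end

end

section

/-! ### Adjoint solutions, pairings and uniqueness -/

variable {T : ℝ} {a b : ℂ → Fin 3 → ℂ} {A : ℝ → ℝ → Matrix (Fin 3) (Fin 3) ℂ}
  {B : ℂ → ℝ → ℝ → Matrix (Fin 3) (Fin 3) ℂ}

/-- The inverse transpose of a fundamental matrix solves the system with negated, transposed
coefficients. Hence every result on Lax families also applies to the cofactor eigenfunction. -/
theorem LaxFamily.adjoint (h : LaxFamily T a b A B) :
    LaxFamily T (fun k i => -a k i) (fun k i => -b k i) (fun x t => -(A x t).transpose)
      (fun k x t => -(B k x t).transpose) where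
  differentiable_a i := (h.differentiable_a i).neg
  differentiable_b i := (h.differentiable_b i).neg
  sum_a k := by rw [Finset.sum_neg_distrib, h.sum_a, neg_zero]
  sum_b k := by rw [Finset.sum_neg_distrib, h.sum_b, neg_zero]
  trace_A x t := by rw [Matrix.trace_neg, Matrix.trace_transpose, h.trace_A, neg_zero]
  trace_B k x t := by rw [Matrix.trace_neg, Matrix.trace_transpose, h.trace_B, neg_zero]
  continuousOn_A i j := (h.continuousOn_A j i).neg
  continuousOn_B i j := (h.continuousOn_B j i).neg
  differentiable_B x t i j := (h.differentiable_B x t j i).neg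
  zero_curvature k := by
    obtain ⟨A', B', hA', hB', hz⟩ := h.zero_curvature k
    refine ⟨fun x t => -(A' x t).transpose, fun x t => -(B' x t).transpose,
      fun i j => (hA' j i).neg, fun i j => (hB' j i).neg, fun x t hx ht htT =>
      ⟨fun i j => ((hz x t hx ht htT).1 j i).neg, fun i j => ((hz x t hx ht htT).2.1 j i).neg, ?_⟩⟩
    have hd : ∀ f : Fin 3 → ℂ, Matrix.diagonal (fun i => -f i) =
        -(Matrix.diagonal f).transpose := fun f => by
      rw [Matrix.diagonal_transpose, Matrix.diagonal_neg]
    beta_reduce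
    rw [(hz x t hx ht htT).2.2]
    simp only [hd, ← neg_add, ← Matrix.transpose_add, neg_mul_neg, ← Matrix.transpose_mul]
    rw [Matrix.transpose_add, Matrix.transpose_sub]
    abel
  decay_A := by
    obtain ⟨G, hG, hle⟩ := h.decay_A
    exact ⟨G, hG, fun x t hx ht i j => by simpa using hle x t hx ht j i⟩
  decay_B k ε hε := by
    obtain ⟨X, hX⟩ := h.decay_B k ε hε
    exact ⟨X, fun x t hx ht i j => by simpa using hX x t hx ht j i⟩

theorem hasDerivWithinAt_pairing {s : Set ℝ} {x : ℝ} {y w : ℝ → Fin 3 → ℂ} {a : Fin 3 → ℂ}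
    {A : Matrix (Fin 3) (Fin 3) ℂ} {c c' : ℂ}
    (hw : ∀ i, HasDerivWithinAt (fun u => w u i) ((a i - c) * w x i + A.mulVec (w x) i) s x)
    (hy : ∀ i, HasDerivWithinAt (fun u => y u i)
      ((-a i - c') * y x i + (-A.transpose).mulVec (y x) i) s x) :
    HasDerivWithinAt (fun u => y u ⬝ᵥ w u) (-(c + c') * (y x ⬝ᵥ w x)) s x := by
  have := HasDerivWithinAt.fun_sum (u := Finset.univ) fun i _ => (hy i).mul (hw i)
  refine this.congr_deriv ?_
  simp only [dotProduct, Matrix.mulVec, Fin.sum_univ_three, Matrix.neg_apply,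
    Matrix.transpose_apply]
  ring

/-- This is the identity `(My) × z + y × (Mz) = (tr M - Mᵀ)(y × z)` for `M = -(diag a + A)ᵀ`, which
is traceless: two adjoint solutions produce a solution of the original system. -/
theorem hasDerivWithinAt_cross {s : Set ℝ} {x : ℝ} {y z : ℝ → Fin 3 → ℂ} {a : Fin 3 → ℂ}
    {A : Matrix (Fin 3) (Fin 3) ℂ} {c c' : ℂ} (ha : ∑ i, a i = 0) (hA : A.trace = 0)
    (hy : ∀ i, HasDerivWithinAt (fun u => y u i)
      ((-a i - c) * y x i + (-A.transpose).mulVec (y x) i) s x)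
    (hz : ∀ i, HasDerivWithinAt (fun u => z u i)
      ((-a i - c') * z x i + (-A.transpose).mulVec (z x) i) s x) (i : Fin 3) :
    HasDerivWithinAt (fun u => crossProduct (y u) (z u) i)
      ((a i - (c + c')) * crossProduct (y x) (z x) i + A.mulVec (crossProduct (y x) (z x)) i)
      s x := by
  rw [Fin.sum_univ_three] at ha
  rw [Matrix.trace_fin_three] at hA
  have key : ∀ i j : Fin 3, HasDerivWithinAt (fun u => y u i * z u j - y u j * z u i) _ s x :=
    fun i j => ((hy i).mul (hz j)).sub ((hy j).mul (hz i))
  fin_cases i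
  · refine (key 1 2).congr_deriv ?_
    simp only [cross_apply, Matrix.mulVec, dotProduct, Fin.sum_univ_three, Matrix.neg_apply,
      Matrix.transpose_apply, Fin.zero_eta, Matrix.cons_val]
    linear_combination (-(y x 1 * z x 2 - y x 2 * z x 1)) * (ha + hA)
  · refine (key 2 0).congr_deriv ?_
    simp only [cross_apply, Matrix.mulVec, dotProduct, Fin.sum_univ_three, Matrix.neg_apply,
      Matrix.transpose_apply, Fin.mk_one, Matrix.cons_val]
    linear_combination (-(y x 2 * z x 0 - y x 0 * z x 2)) * (ha + hA)
  · refine (key 0 1).congr_deriv ?_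
    simp only [cross_apply, Matrix.mulVec, dotProduct, Fin.sum_univ_three, Matrix.neg_apply,
      Matrix.transpose_apply, Fin.reduceFinMk, Matrix.cons_val]
    linear_combination (-(y x 0 * z x 1 - y x 1 * z x 0)) * (ha + hA)

theorem eq_exp_mul_of_hasDerivWithinAt {p : ℝ → ℂ} {σ : ℂ} {L : ℝ} (hL : 0 ≤ L)
    (hp : ∀ s ∈ Icc 0 L, HasDerivWithinAt p (-σ * p s) (Icc 0 L) s) :
    p L = Complex.exp (-(σ * L)) * p 0 := by
  have hexp : ∀ s : ℝ, HasDerivAt (fun s : ℝ => Complex.exp (σ * s))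
      (Complex.exp (σ * s) * σ) s := fun s => by
    have := ((Complex.ofRealCLM.hasDerivAt (x := s)).const_mul σ).cexp
    simpa using this
  have hd : ∀ s ∈ Icc 0 L, HasDerivWithinAt (fun s : ℝ => Complex.exp (σ * s) * p s) 0
      (Icc 0 L) s := fun s hs => by
    refine ((hexp s).hasDerivWithinAt.mul (hp s hs)).congr_deriv ?_
    ring
  have := constant_of_has_deriv_right_zero (fun s hs => (hd s hs).continuousWithinAt)
    (fun s hs => (hd s ⟨hs.1, hs.2.le⟩).mono_of_mem_nhdsWithin
      (Icc_mem_nhdsGE_of_mem hs)) L ⟨hL, le_rfl⟩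
  simp only [Complex.ofReal_zero, mul_zero, Complex.exp_zero, one_mul] at this
  rw [← this, ← mul_assoc, ← Complex.exp_add]
  simp

section FixedPair

variable {a b : Fin 3 → ℂ} {B : ℝ → ℝ → Matrix (Fin 3) (Fin 3) ℂ} {c d c' d' : ℂ}
  {w y z : ℝ → ℝ → Fin 3 → ℂ}

/-- The coefficient matrices cancel in the derivatives of `y·w`, which leaves scalar equations with
constant coefficients; they are integrated along `x = 0` and then horizontally. -/
theorem IsLaxSolution.pairing (hw : IsLaxSolution T a b A B c d w)
    (hy : IsLaxSolution T (fun i => -a i) (fun i => -b i) (fun x t => -(A x t).transpose)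
      (fun x t => -(B x t).transpose) c' d' y) {x t : ℝ} (hxt : (x, t) ∈ closedDomain T) :
    y x t ⬝ᵥ w x t = Complex.exp (-((c + c') * x + (d + d') * t)) * (y 0 0 ⬝ᵥ w 0 0) := by
  obtain ⟨hx, ht, htT⟩ := mem_closedDomain.1 hxt
  have h1 := eq_exp_mul_of_hasDerivWithinAt (p := fun x => y x t ⬝ᵥ w x t) (σ := c + c') hx
    fun s hs => (hasDerivWithinAt_pairing (fun i => hw.x_part s t ⟨hs.1, ht, htT⟩ i)
      (fun i => hy.x_part s t ⟨hs.1, ht, htT⟩ i)).mono Icc_subset_Ici_self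
  have h2 := eq_exp_mul_of_hasDerivWithinAt (p := fun t => y 0 t ⬝ᵥ w 0 t) (σ := d + d') ht
    fun s hs => (hasDerivWithinAt_pairing
      (fun i => hw.t_part 0 s (mem_closedDomain.2 ⟨le_rfl, hs.1, hs.2.trans htT⟩) i)
      (fun i => hy.t_part 0 s (mem_closedDomain.2 ⟨le_rfl, hs.1, hs.2.trans htT⟩) i)).mono
        (Icc_subset_Icc_right htT)
  rw [h1, h2, ← mul_assoc, ← Complex.exp_add]
  congr 2
  ring

theorem IsLaxSolution.cross (ha : ∑ i, a i = 0) (hb : ∑ i, b i = 0)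
    (hA : ∀ x t, (A x t).trace = 0) (hB : ∀ x t, (B x t).trace = 0)
    (hy : IsLaxSolution T (fun i => -a i) (fun i => -b i) (fun x t => -(A x t).transpose)
      (fun x t => -(B x t).transpose) c d y)
    (hz : IsLaxSolution T (fun i => -a i) (fun i => -b i) (fun x t => -(A x t).transpose)
      (fun x t => -(B x t).transpose) c' d' z) :
    IsLaxSolution T a b A B (c + c') (d + d') fun x t => crossProduct (y x t) (z x t) where
  continuousOn := by
    have h1 : ∀ i, ContinuousOn (fun p : ℝ × ℝ => y p.1 p.2 i) (closedDomain T) :=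
      continuousOn_pi.1 hy.continuousOn
    have h2 : ∀ i, ContinuousOn (fun p : ℝ × ℝ => z p.1 p.2 i) (closedDomain T) :=
      continuousOn_pi.1 hz.continuousOn
    refine continuousOn_pi.2 fun i => ?_
    fin_cases i
    · exact ((h1 1).mul (h2 2)).sub ((h1 2).mul (h2 1))
    · exact ((h1 2).mul (h2 0)).sub ((h1 0).mul (h2 2))
    · exact ((h1 0).mul (h2 1)).sub ((h1 1).mul (h2 0))
  x_part x t hxt i := hasDerivWithinAt_cross ha (hA x t) (hy.x_part x t hxt) (hz.x_part x t hxt) i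
  t_part x t hxt i := hasDerivWithinAt_cross hb (hB x t) (hy.t_part x t hxt) (hz.t_part x t hxt) i

theorem IsLaxSolution.rescale (hw : IsLaxSolution T a b A B c d w) (r : ℂ) (c' d' : ℂ) :
    IsLaxSolution T a b A B c' d'
      fun x t => (r * Complex.exp ((c - c') * x + (d - d') * t)) • w x t where
  continuousOn := by
    refine ContinuousOn.smul (f := fun p : ℝ × ℝ =>
      r * Complex.exp ((c - c') * p.1 + (d - d') * p.2)) ?_ hw.continuousOn
    fun_prop
  x_part x t hxt i := by
    have he : HasDerivAt (fun x : ℝ => r * Complex.exp ((c - c') * x + (d - d') * t))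
        (r * (Complex.exp ((c - c') * x + (d - d') * t) * (c - c'))) x := by
      have := (((Complex.ofRealCLM.hasDerivAt (x := x)).const_mul (c - c')).add_const
        ((d - d') * t)).cexp.const_mul r
      simpa using this
    refine (he.hasDerivWithinAt.mul (hw.x_part x t hxt i)).congr_deriv ?_
    rw [Matrix.mulVec_smul]
    simp only [Pi.smul_apply, smul_eq_mul]
    ring
  t_part x t hxt i := by
    have he : HasDerivAt (fun t : ℝ => r * Complex.exp ((c - c') * x + (d - d') * t))
        (r * (Complex.exp ((c - c') * x + (d - d') * t) * (d - d'))) t := by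
      have := (((Complex.ofRealCLM.hasDerivAt (x := t)).const_mul (d - d')).const_add
        ((c - c') * x)).cexp.const_mul r
      simpa using this
    refine (he.hasDerivWithinAt.mul (hw.t_part x t hxt i)).congr_deriv ?_
    rw [Matrix.mulVec_smul]
    simp only [Pi.smul_apply, smul_eq_mul]
    ring

theorem IsEigencolumn.isLaxSolution {j : Fin 3} {γ : Fin 3 → Contour}
    (h : IsEigencolumn T a b A B γ j w) : IsLaxSolution T a b A B (a j) (b j) w :=
  ⟨h.continuousOn, h.x_part, h.t_part⟩

end FixedPair

/-- `Φ` is the fundamental matrix of a family of Lax pairs with `Φ(0,0,k) = 1`, and it is entire in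
`k`. -/
structure IsFundamental (T : ℝ) (a b : ℂ → Fin 3 → ℂ) (A : ℝ → ℝ → Matrix (Fin 3) (Fin 3) ℂ)
    (B : ℂ → ℝ → ℝ → Matrix (Fin 3) (Fin 3) ℂ) (Φ : ℂ → ℝ → ℝ → Matrix (Fin 3) (Fin 3) ℂ) :
    Prop where
  isLaxSolution : ∀ k v, IsLaxSolution T (a k) (b k) A (B k) 0 0 fun x t => (Φ k x t).mulVec v
  apply_zero : ∀ k, Φ k 0 0 = 1
  differentiable : ∀ x t i j, Differentiable ℂ fun k => Φ k x t i j

/-- `Φ` and `Ψ` are the fundamental matrices of a family of Lax pairs and of its adjoint. -/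
structure IsFundamentalPair (T : ℝ) (a b : ℂ → Fin 3 → ℂ)
    (A : ℝ → ℝ → Matrix (Fin 3) (Fin 3) ℂ) (B : ℂ → ℝ → ℝ → Matrix (Fin 3) (Fin 3) ℂ)
    (Φ Ψ : ℂ → ℝ → ℝ → Matrix (Fin 3) (Fin 3) ℂ) : Prop where
  primal : IsFundamental T a b A B Φ
  dual : IsFundamental T (fun k i => -a k i) (fun k i => -b k i) (fun x t => -(A x t).transpose)
    (fun k x t => -(B k x t).transpose) Ψ

theorem LaxFamily.exists_fundamentalPair (hT : 0 < T) (h : LaxFamily T a b A B) :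
    ∃ Φ Ψ, IsFundamentalPair T a b A B Φ Ψ := by
  obtain ⟨Φ, h1, h2, h3⟩ := h.exists_fundamental hT
  obtain ⟨Ψ, h4, h5, h6⟩ := h.adjoint.exists_fundamental hT
  exact ⟨Φ, Ψ, ⟨h1, h2, h3⟩, ⟨h4, h5, h6⟩⟩

theorem IsFundamentalPair.symm {Φ Ψ : ℂ → ℝ → ℝ → Matrix (Fin 3) (Fin 3) ℂ}
    (h : IsFundamentalPair T a b A B Φ Ψ) :
    IsFundamentalPair T (fun k i => -a k i) (fun k i => -b k i) (fun x t => -(A x t).transpose)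
      (fun k x t => -(B k x t).transpose) Ψ Φ where
  primal := h.dual
  dual := by simpa using h.primal

section FundamentalPair

variable {Φ Ψ : ℂ → ℝ → ℝ → Matrix (Fin 3) (Fin 3) ℂ} {k : ℂ} {c d : ℂ}
  {w : ℝ → ℝ → Fin 3 → ℂ} {x t : ℝ}

/-- Pairing `w` with the columns of `Ψ` removes the dependence on `(x,t)` up to an exponential. It
follows that `Ψᵀ = Φ⁻¹`, and that a solution of the Lax pair is determined by its value at the
origin. -/
theorem IsFundamentalPair.transpose_mulVec (h : IsFundamentalPair T a b A B Φ Ψ)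
    (hw : IsLaxSolution T (a k) (b k) A (B k) c d w) (hxt : (x, t) ∈ closedDomain T) :
    (Ψ k x t).transpose.mulVec (w x t) = Complex.exp (-(c * x + d * t)) • w 0 0 := by
  funext i
  have := hw.pairing (h.dual.isLaxSolution k (Pi.single i 1)) hxt
  simp only [h.dual.apply_zero, Matrix.one_mulVec, single_one_dotProduct, add_zero] at this
  rw [Pi.smul_apply, smul_eq_mul, ← this]
  simp [Matrix.mulVec, dotProduct, Pi.single_apply]

theorem IsFundamentalPair.transpose_mul (h : IsFundamentalPair T a b A B Φ Ψ)
    (hxt : (x, t) ∈ closedDomain T) : (Ψ k x t).transpose * Φ k x t = 1 := by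
  refine Matrix.ext_of_mulVec_single fun i => ?_
  have := h.transpose_mulVec (h.primal.isLaxSolution k (Pi.single i 1)) hxt
  rw [← Matrix.mulVec_mulVec, this]
  simp [h.primal.apply_zero]

theorem IsFundamentalPair.mul_transpose (h : IsFundamentalPair T a b A B Φ Ψ)
    (hxt : (x, t) ∈ closedDomain T) : Φ k x t * (Ψ k x t).transpose = 1 :=
  mul_eq_one_comm.1 (h.transpose_mul hxt)

theorem IsFundamentalPair.eq_mulVec (h : IsFundamentalPair T a b A B Φ Ψ)
    (hw : IsLaxSolution T (a k) (b k) A (B k) c d w) (hxt : (x, t) ∈ closedDomain T) :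
    w x t = Complex.exp (-(c * x + d * t)) • (Φ k x t).mulVec (w 0 0) := by
  rw [← Matrix.mulVec_smul, ← h.transpose_mulVec hw hxt, Matrix.mulVec_mulVec,
    h.mul_transpose hxt, Matrix.one_mulVec]

theorem IsFundamentalPair.apply_zero_eq (h : IsFundamentalPair T a b A B Φ Ψ)
    (hw : IsLaxSolution T (a k) (b k) A (B k) c d w) (hxt : (x, t) ∈ closedDomain T) :
    w 0 0 = Complex.exp (c * x + d * t) • (Ψ k x t).transpose.mulVec (w x t) := by
  rw [h.transpose_mulVec hw hxt, smul_smul, ← Complex.exp_add]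
  simp

theorem IsFundamentalPair.isLaxSolution (h : IsFundamentalPair T a b A B Φ Ψ) (c d : ℂ)
    (v : Fin 3 → ℂ) : IsLaxSolution T (a k) (b k) A (B k) c d
      fun x t => Complex.exp (-(c * x + d * t)) • (Φ k x t).mulVec v := by
  have := (h.primal.isLaxSolution k v).rescale 1 c d
  convert this using 5
  ring_nf

end FundamentalPair

end

section

/-! ### Integral equations -/

/-- Variation of constants. The endpoints may come in either order, because γ₁ integrates from `T`
down to `t`. -/
theorem eq_exp_mul_add_integral {f g : ℝ → ℂ} {σ : ℂ} {L : ℝ}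
    (hf : ∀ s ∈ Icc 0 L, HasDerivWithinAt f (σ * f s + g s) (Icc 0 L) s)
    (hg : ContinuousOn g (Icc 0 L)) {s₀ s₁ : ℝ} (h₀ : s₀ ∈ Icc 0 L) (h₁ : s₁ ∈ Icc 0 L) :
    f s₁ = Complex.exp (σ * (s₁ - s₀)) * f s₀ +
      ∫ s in s₀..s₁, Complex.exp (σ * (s₁ - s)) * g s := by
  have hsub : uIcc s₀ s₁ ⊆ Icc 0 L := uIcc_subset_Icc h₀ h₁
  have hexp : ∀ s : ℝ, HasDerivAt (fun s : ℝ => Complex.exp (σ * (s₁ - s)))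
      (Complex.exp (σ * (s₁ - s)) * -σ) s := fun s => by
    have := (((Complex.ofRealCLM.hasDerivAt (x := s)).const_sub (s₁ : ℂ)).const_mul σ).cexp
    simpa using this
  have hd : ∀ s ∈ Icc 0 L, HasDerivWithinAt (fun s : ℝ => Complex.exp (σ * (s₁ - s)) * f s)
      (Complex.exp (σ * (s₁ - s)) * g s) (Icc 0 L) s := fun s hs => by
    refine ((hexp s).hasDerivWithinAt.mul (hf s hs)).congr_deriv ?_
    ring
  have hc : ContinuousOn (fun s : ℝ => Complex.exp (σ * (s₁ - s)) * g s) (Icc 0 L) :=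
    ContinuousOn.mul (by fun_prop) hg
  rw [intervalIntegral.integral_eq_sub_of_hasDeriv_right
    (f := fun s : ℝ => Complex.exp (σ * (s₁ - s)) * f s)
    (fun s hs => (hd s (hsub hs)).continuousWithinAt.mono hsub) (fun s hs => ?_)
    ((hc.mono hsub).intervalIntegrable)]
  · simp
  · have hs' : s ∈ Icc 0 L := hsub (Ioo_subset_Icc_self hs)
    refine (hd s hs').mono_of_mem_nhdsWithin (mem_nhdsWithin_of_mem_nhds (Icc_mem_nhds ?_ ?_))
    · exact (le_min h₀.1 h₁.1).trans_lt hs.1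
    · exact hs.2.trans_le (max_le h₀.2 h₁.2)

theorem closedDomain_mk {T x t : ℝ} (hx : 0 ≤ x) (ht : t ∈ Icc 0 T) : (x, t) ∈ closedDomain T :=
  ⟨hx, ht⟩

section FixedPair

variable {T : ℝ} {a b : Fin 3 → ℂ} {A B : ℝ → ℝ → Matrix (Fin 3) (Fin 3) ℂ} {c d : ℂ}
  {w : ℝ → ℝ → Fin 3 → ℂ}

theorem continuousOn_mulVec (hA : ∀ i j, ContinuousOn (fun p : ℝ × ℝ => A p.1 p.2 i j)
    (closedDomain T)) (hw : ContinuousOn (Function.uncurry w) (closedDomain T)) (i : Fin 3) :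
    ContinuousOn (fun p : ℝ × ℝ => (A p.1 p.2).mulVec (w p.1 p.2) i) (closedDomain T) := by
  simp only [Matrix.mulVec, dotProduct]
  exact continuousOn_finsetSum _ fun j _ => (hA i j).mul (continuousOn_pi.1 hw j)

theorem continuousOn_section_x {f : ℝ × ℝ → ℂ} (hf : ContinuousOn f (closedDomain T)) {t : ℝ}
    (ht : t ∈ Icc 0 T) : ContinuousOn (fun x => f (x, t)) (Ici 0) :=
  hf.comp (by fun_prop) fun _ hx => ⟨hx, ht⟩

theorem continuousOn_section_t {f : ℝ × ℝ → ℂ} (hf : ContinuousOn f (closedDomain T)) {x : ℝ}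
    (hx : 0 ≤ x) : ContinuousOn (fun t => f (x, t)) (Icc 0 T) :=
  hf.comp (by fun_prop) fun _ ht => ⟨hx, ht⟩

theorem IsLaxSolution.eq_x_integral (hw : IsLaxSolution T a b A B c d w)
    (hA : ∀ i j, ContinuousOn (fun p : ℝ × ℝ => A p.1 p.2 i j) (closedDomain T)) {x₀ x₁ t : ℝ}
    (hx₀ : 0 ≤ x₀) (hx₁ : 0 ≤ x₁) (ht : t ∈ Icc 0 T) (i : Fin 3) :
    w x₁ t i = Complex.exp ((a i - c) * (x₁ - x₀)) * w x₀ t i +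
      ∫ y in x₀..x₁, Complex.exp ((a i - c) * (x₁ - y)) * (A y t).mulVec (w y t) i :=
  eq_exp_mul_add_integral (f := fun x => w x t i) (L := max x₀ x₁)
    (g := fun y => (A y t).mulVec (w y t) i)
    (fun s hs => (hw.x_part s t ⟨hs.1, ht⟩ i).mono Icc_subset_Ici_self)
    ((continuousOn_section_x (continuousOn_mulVec hA hw.continuousOn i) ht).mono
      Icc_subset_Ici_self) ⟨hx₀, le_max_left _ _⟩ ⟨hx₁, le_max_right _ _⟩

theorem IsLaxSolution.eq_t_integral (hw : IsLaxSolution T a b A B c d w)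
    (hB : ∀ i j, ContinuousOn (fun p : ℝ × ℝ => B p.1 p.2 i j) (closedDomain T)) {x t₀ t₁ : ℝ}
    (hx : 0 ≤ x) (ht₀ : t₀ ∈ Icc 0 T) (ht₁ : t₁ ∈ Icc 0 T) (i : Fin 3) :
    w x t₁ i = Complex.exp ((b i - d) * (t₁ - t₀)) * w x t₀ i +
      ∫ τ in t₀..t₁, Complex.exp ((b i - d) * (t₁ - τ)) * (B x τ).mulVec (w x τ) i :=
  eq_exp_mul_add_integral (f := fun t => w x t i) (L := T)
    (g := fun τ => (B x τ).mulVec (w x τ) i)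
    (fun s hs => hw.t_part x s ⟨hx, hs⟩ i)
    (continuousOn_section_t (continuousOn_mulVec hB hw.continuousOn i) hx) ht₀ ht₁

theorem IsLaxSolution.eq_contour_integral (hw : IsLaxSolution T a b A B c d w)
    (hA : ∀ i j, ContinuousOn (fun p : ℝ × ℝ => A p.1 p.2 i j) (closedDomain T))
    (hB : ∀ i j, ContinuousOn (fun p : ℝ × ℝ => B p.1 p.2 i j) (closedDomain T)) {x t₀ t : ℝ}
    (hx : 0 ≤ x) (ht₀ : t₀ ∈ Icc 0 T) (ht : t ∈ Icc 0 T) (i : Fin 3) :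
    w x t i = Complex.exp ((a i - c) * x + (b i - d) * (t - t₀)) * w 0 t₀ i +
      ((∫ τ in t₀..t, Complex.exp ((a i - c) * x + (b i - d) * (t - τ)) *
        (B 0 τ).mulVec (w 0 τ) i)
      + ∫ y in (0 : ℝ)..x, Complex.exp ((a i - c) * (x - y)) * (A y t).mulVec (w y t) i) := by
  rw [hw.eq_x_integral hA le_rfl hx ht i, hw.eq_t_integral hB le_rfl ht₀ ht i]
  simp_rw [Complex.exp_add, mul_assoc]
  rw [intervalIntegral.integral_const_mul]
  simp only [Complex.ofReal_zero, sub_zero]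
  ring

/-- Entries of a coefficient matrix that are dominated on the closed half-line domain by an
integrable function of `x`. -/
def IsDominated (T : ℝ) (A : ℝ → ℝ → Matrix (Fin 3) (Fin 3) ℂ) (G : ℝ → ℝ) : Prop :=
  IntegrableOn G (Ioi 0) ∧ ∀ x t, 0 < x → t ∈ Icc 0 T → ∀ i j, ‖A x t i j‖ ≤ G x

theorem norm_mulVec_le {M : Matrix (Fin 3) (Fin 3) ℂ} {v : Fin 3 → ℂ} {g C : ℝ}
    (hM : ∀ i j, ‖M i j‖ ≤ g) (hv : ∀ i, ‖v i‖ ≤ C) (i : Fin 3) :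
    ‖M.mulVec v i‖ ≤ 3 * g * C := by
  have h0 : 0 ≤ g := (norm_nonneg _).trans (hM 0 0)
  calc ‖∑ j, M i j * v j‖ ≤ ∑ j, ‖M i j * v j‖ := norm_sum_le _ _
    _ ≤ ∑ _j : Fin 3, g * C := Finset.sum_le_sum fun j _ => by
        rw [norm_mul]; exact mul_le_mul (hM i j) (hv j) (norm_nonneg _) h0
    _ = 3 * g * C := by simp; ring

theorem norm_exp_mul_sub_le {σ : ℂ} (hσ : 0 ≤ σ.re) {x y : ℝ} (hxy : x ≤ y) :
    ‖Complex.exp (σ * (x - y))‖ ≤ 1 := by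
  rw [Complex.norm_exp, Real.exp_le_one_iff, ← Complex.ofReal_sub, Complex.re_mul_ofReal]
  exact mul_nonpos_of_nonneg_of_nonpos hσ (by linarith)

theorem IsLaxSolution.integrableOn_contour {G : ℝ → ℝ} (hw : IsLaxSolution T a b A B c d w)
    (hA : ∀ i j, ContinuousOn (fun p : ℝ × ℝ => A p.1 p.2 i j) (closedDomain T))
    (hG : IsDominated T A G) (hb : IsBoundedColumn T w) {x t : ℝ} (hx : 0 ≤ x)
    (ht : t ∈ Icc 0 T) {i : Fin 3} {σ : ℂ} (hσ : 0 ≤ σ.re) :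
    IntegrableOn (fun y : ℝ => Complex.exp (σ * (x - y)) * (A y t).mulVec (w y t) i)
      (Ioi x) := by
  obtain ⟨C, hC⟩ := hb
  have hsub : Ioi x ⊆ Ioi 0 := Ioi_subset_Ioi hx
  refine Integrable.mono' (g := fun y => 3 * G y * C)
    (((hG.1.mono_set hsub).const_mul 3).mul_const C) ?_ ?_
  · refine ContinuousOn.aestronglyMeasurable (ContinuousOn.mul (by fun_prop) ?_) measurableSet_Ioi
    exact (continuousOn_section_x (continuousOn_mulVec hA hw.continuousOn i) ht).mono
      (hsub.trans Ioi_subset_Ici_self)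
  · refine (ae_restrict_iff' measurableSet_Ioi).2 (Eventually.of_forall fun y hy => ?_)
    rw [norm_mul]
    have h1 := norm_exp_mul_sub_le hσ (le_of_lt hy)
    have h2 := norm_mulVec_le (hG.2 y t (hsub hy) ht) (hC y t (closedDomain_mk (le_of_lt (hsub hy)) ht)) i
    calc _ ≤ 1 * _ := mul_le_mul_of_nonneg_right h1 (norm_nonneg _)
      _ ≤ _ := by rw [one_mul]; exact h2

/-- The integrand is the `y`-derivative of `exp((a_i - c)(x - y)) w_i`, so the only unknown in the
γ₃ integral is the boundary term `m` at infinity. -/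
theorem IsLaxSolution.integral_Ioi {G : ℝ → ℝ} (hw : IsLaxSolution T a b A B c d w)
    (hA : ∀ i j, ContinuousOn (fun p : ℝ × ℝ => A p.1 p.2 i j) (closedDomain T))
    (hG : IsDominated T A G) (hb : IsBoundedColumn T w) {x t : ℝ} (hx : 0 ≤ x)
    (ht : t ∈ Icc 0 T) {i : Fin 3} (hσ : c.re ≤ (a i).re) {m : ℂ}
    (hlim : Tendsto (fun y : ℝ => Complex.exp ((a i - c) * (x - y)) * w y t i) atTop (𝓝 m)) :
    ∫ y in Ioi x, Complex.exp ((a i - c) * (x - y)) * (A y t).mulVec (w y t) i =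
      m - w x t i := by
  have hd : ∀ y ∈ Ici x, HasDerivWithinAt (fun y : ℝ => Complex.exp ((a i - c) * (x - y)) * w y t i)
      (Complex.exp ((a i - c) * (x - y)) * (A y t).mulVec (w y t) i) (Ici 0) y := fun y hy => by
    have hexp : HasDerivAt (fun s : ℝ => Complex.exp ((a i - c) * (x - s)))
        (Complex.exp ((a i - c) * (x - y)) * -(a i - c)) y := by
      have := (((Complex.ofRealCLM.hasDerivAt (x := y)).const_sub (x : ℂ)).const_mul
        (a i - c)).cexp
      simpa using this
    refine (hexp.hasDerivWithinAt.mul (hw.x_part y t ⟨hx.trans hy, ht⟩ i)).congr_deriv ?_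
    ring
  have := integral_Ioi_of_hasDerivAt_of_tendsto
    ((hd x self_mem_Ici).continuousWithinAt.mono (Ici_subset_Ici.2 hx))
    (fun y hy => (hd y (mem_Ici_of_Ioi hy)).hasDerivAt (Ici_mem_nhds (hx.trans_lt hy)))
    (hw.integrableOn_contour hA hG hb hx ht (by simpa using hσ)) hlim
  simpa using this

theorem tendsto_exp_mul_zero {σ : ℂ} (hσ : 0 < σ.re) {f : ℝ → ℂ} {C x : ℝ}
    (hf : ∀ᶠ y in atTop, ‖f y‖ ≤ C) :
    Tendsto (fun y : ℝ => Complex.exp (σ * (x - y)) * f y) atTop (𝓝 0) := by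
  have h1 : Tendsto (fun y : ℝ => Real.exp (σ.re * (x - y)) * C) atTop (𝓝 0) := by
    have : Tendsto (fun y : ℝ => σ.re * (x - y)) atTop atBot :=
      Tendsto.const_mul_atBot hσ (tendsto_const_nhds.add_atBot tendsto_neg_atTop_atBot)
    simpa using (Real.tendsto_exp_atBot.comp this).mul_const C
  refine squeeze_zero_norm' ?_ h1
  filter_upwards [hf] with y hy
  rw [norm_mul, Complex.norm_exp, ← Complex.ofReal_sub, Complex.re_mul_ofReal]
  exact mul_le_mul_of_nonneg_left hy (Real.exp_pos _).le

/-- Variation of constants turns an equation along γ₁ or γ₂ into the value of the entry at the start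
of the contour. Along γ₃ an off-diagonal entry carries no condition: the strict gap of real parts
kills the boundary term of a bounded solution at infinity. The diagonal entry has no exponential, so
there the limit must be 1. -/
theorem isEigencolumn_iff {G : ℝ → ℝ} {γ : Fin 3 → Contour} {j : Fin 3} (hT : 0 ≤ T)
    (hA : ∀ i j, ContinuousOn (fun p : ℝ × ℝ => A p.1 p.2 i j) (closedDomain T))
    (hB : ∀ i j, ContinuousOn (fun p : ℝ × ℝ => B p.1 p.2 i j) (closedDomain T))
    (hG : IsDominated T A G)
    (hγ : ∀ i, γ i = .γ₃ → IsBoundedColumn T w ∧ (i ≠ j → (a j).re < (a i).re)) :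
    IsEigencolumn T a b A B γ j w ↔ IsLaxSolution T a b A B (a j) (b j) w ∧
      (∀ i, γ i = .γ₁ → w 0 T i = if i = j then 1 else 0) ∧
      (∀ i, γ i = .γ₂ → w 0 0 i = if i = j then 1 else 0) ∧
      (γ j = .γ₃ → ∀ t ∈ Icc 0 T, Tendsto (fun x => w x t j) atTop (𝓝 1)) := by
  constructor
  · intro h
    refine ⟨h.isLaxSolution, fun i hi => ?_, fun i hi => ?_, fun hj t ht => ?_⟩
    · have := h.integral_eq 0 T (closedDomain_mk le_rfl ⟨hT, le_rfl⟩) i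
      simpa [hi, contourIntegral] using this
    · have := h.integral_eq 0 0 (closedDomain_mk le_rfl ⟨le_rfl, hT⟩) i
      simpa [hi, contourIntegral] using this
    · have hb := (hγ j hj).1
      have hi := h.isLaxSolution.integrableOn_contour hA hG hb le_rfl ht (i := j)
        (σ := a j - a j) (by simp)
      have hl := tendsto_limUnder_of_hasDerivAt_of_integrableOn_Ioi
        (f := fun x => w x t j) (f' := fun y => (A y t).mulVec (w y t) j)
        (fun y hy => by
          have := (h.x_part y t (closedDomain_mk (le_of_lt hy) ht) j).hasDerivAt (Ici_mem_nhds hy)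
          simpa using this) (by simpa using hi)
      have h1 := h.isLaxSolution.integral_Ioi hA hG hb le_rfl ht (i := j) le_rfl
        (m := limUnder atTop fun x => w x t j) (by simpa using hl)
      have h2 := h.integral_eq 0 t (closedDomain_mk le_rfl ht) j
      simp only [hj, contourIntegral, if_true] at h2
      rw [h1] at h2
      have h3 : limUnder atTop (fun x => w x t j) = 1 := by linear_combination h2
      rwa [h3] at hl
  · rintro ⟨hw, h1, h2, h3⟩
    refine ⟨hw.continuousOn, hw.x_part, hw.t_part, fun x t hxt i hi => ?_, fun x t hxt i => ?_⟩
    · refine hw.integrableOn_contour hA hG (hγ i hi).1 hxt.1 hxt.2 ?_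
      by_cases hij : i = j
      · simp [hij]
      · have := (hγ i hi).2 hij
        simpa using this.le
    · rcases hi : γ i with _ | _ | _
      · have := hw.eq_contour_integral hA hB hxt.1 ⟨hT, le_rfl⟩ hxt.2 i
        rw [this, h1 i hi]
        by_cases hij : i = j
        · subst hij; simp [contourIntegral]
        · simp [hij, contourIntegral]
      · have := hw.eq_contour_integral hA hB hxt.1 ⟨le_rfl, hT⟩ hxt.2 i
        rw [this, h2 i hi]
        by_cases hij : i = j
        · subst hij; simp [contourIntegral]
        · simp [hij, contourIntegral]
      · by_cases hij : i = j
        · subst hij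
          have := hw.integral_Ioi hA hG (hγ i hi).1 hxt.1 hxt.2 (i := i) le_rfl (m := 1)
            (by simpa using h3 hi t hxt.2)
          rw [contourIntegral, this]
          simp
        · have hlt := (hγ i hi).2 hij
          obtain ⟨C, hC⟩ := (hγ i hi).1
          have := hw.integral_Ioi hA hG (hγ i hi).1 hxt.1 hxt.2 (i := i) hlt.le (m := 0)
            (tendsto_exp_mul_zero (by simpa using hlt) (C := C)
              ((eventually_ge_atTop 0).mono fun y hy => hC y t ⟨hy, hxt.2⟩ i))
          rw [contourIntegral, this]
          simp [hij]

end FixedPair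

end

section

/-! ### Gronwall estimates and solutions normalized at infinity -/

theorem le_mul_exp_of_continuous {u n : ℝ → ℝ} {c L : ℝ} (hu : Continuous u) (hn : Continuous n)
    (hn0 : ∀ x ∈ Icc 0 L, 0 ≤ n x)
    (h : ∀ x ∈ Icc 0 L, u x ≤ c + ∫ y in (0 : ℝ)..x, n y * u y) :
    ∀ x ∈ Icc 0 L, u x ≤ c * Real.exp (∫ y in (0 : ℝ)..x, n y) := by
  intro x hx
  have hN : ∀ x, HasDerivAt (fun x => ∫ y in (0 : ℝ)..x, n y) (n x) x :=
    fun x => (hn.integral_hasStrictDerivAt 0 x).hasDerivAt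
  have hU : ∀ x, HasDerivAt (fun x => c + ∫ y in (0 : ℝ)..x, n y * u y) (n x * u x) x :=
    fun x => ((hn.mul hu).integral_hasStrictDerivAt 0 x).hasDerivAt.const_add c
  have hd : ∀ x, HasDerivAt (fun x => Real.exp (-∫ y in (0 : ℝ)..x, n y) *
      (c + ∫ y in (0 : ℝ)..x, n y * u y)) (Real.exp (-∫ y in (0 : ℝ)..x, n y) * -n x *
      (c + ∫ y in (0 : ℝ)..x, n y * u y) + Real.exp (-∫ y in (0 : ℝ)..x, n y) * (n x * u x)) x :=
    fun x => (hN x).neg.exp.mul (hU x)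
  have hanti : AntitoneOn (fun x => Real.exp (-∫ y in (0 : ℝ)..x, n y) *
      (c + ∫ y in (0 : ℝ)..x, n y * u y)) (Icc 0 L) := by
    refine antitoneOn_of_deriv_nonpos (convex_Icc 0 L)
      (fun x _ => (hd x).continuousAt.continuousWithinAt)
      (fun x _ => (hd x).differentiableAt.differentiableWithinAt) fun x hx => ?_
    rw [interior_Icc] at hx
    have hx' := Ioo_subset_Icc_self hx
    rw [(hd x).deriv]
    have h1 := mul_le_mul_of_nonneg_left (h x hx') (hn0 x hx')
    have h2 := mul_le_mul_of_nonneg_left h1 (Real.exp_pos (-∫ y in (0 : ℝ)..x, n y)).le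
    linarith
  have h0 := hanti ⟨le_rfl, hx.1.trans hx.2⟩ hx hx.1
  simp only [intervalIntegral.integral_same, neg_zero, Real.exp_zero, add_zero, one_mul] at h0
  refine (h x hx).trans ?_
  rw [Real.exp_neg, inv_mul_le_iff₀ (Real.exp_pos _)] at h0
  linarith

theorem le_mul_exp_of_continuousOn {u n : ℝ → ℝ} {c L : ℝ} (hu : ContinuousOn u (Icc 0 L))
    (hn : ContinuousOn n (Icc 0 L)) (hn0 : ∀ x ∈ Icc 0 L, 0 ≤ n x)
    (h : ∀ x ∈ Icc 0 L, u x ≤ c + ∫ y in (0 : ℝ)..x, n y * u y) :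
    ∀ x ∈ Icc 0 L, u x ≤ c * Real.exp (∫ y in (0 : ℝ)..x, n y) := by
  intro x hx
  have hL : 0 ≤ L := hx.1.trans hx.2
  have hp : ∀ y, max 0 (min y L) ∈ Icc 0 L :=
    fun y => ⟨le_max_left _ _, max_le hL (min_le_right _ _)⟩
  have hpe : ∀ y ∈ Icc 0 L, max 0 (min y L) = y := fun y hy => by
    rw [min_eq_left hy.2, max_eq_right hy.1]
  have hext : ∀ {f : ℝ → ℝ}, ContinuousOn f (Icc 0 L) →
      Continuous fun y => f (max 0 (min y L)) := fun hf =>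
    hf.comp_continuous (by fun_prop) hp
  have key := le_mul_exp_of_continuous (c := c) (L := L) (hext hu) (hext hn)
    (fun y hy => hn0 _ (hp y)) (fun y hy => ?_) x hx
  · rw [hpe x hx] at key
    refine key.trans (le_of_eq ?_)
    congr 2
    refine intervalIntegral.integral_congr fun y hy => ?_
    rw [uIcc_of_le hx.1] at hy
    simp only [hpe y ⟨hy.1, hy.2.trans hx.2⟩]
  · rw [hpe y hy]
    refine (h y hy).trans (le_of_eq ?_)
    congr 1
    refine intervalIntegral.integral_congr fun s hs => ?_
    rw [uIcc_of_le hy.1] at hs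
    simp only [hpe s ⟨hs.1, hs.2.trans hy.2⟩]

/-- The sum of the absolute values of the entries. -/
def entrySum (M : Matrix (Fin 3) (Fin 3) ℂ) : ℝ := ∑ i, ∑ j, ‖M i j‖

theorem entrySum_nonneg (M : Matrix (Fin 3) (Fin 3) ℂ) : 0 ≤ entrySum M :=
  Finset.sum_nonneg fun _ _ => Finset.sum_nonneg fun _ _ => norm_nonneg _

theorem norm_mulVec_le_entrySum (M : Matrix (Fin 3) (Fin 3) ℂ) (v : Fin 3 → ℂ) (i : Fin 3) :
    ‖M.mulVec v i‖ ≤ entrySum M * ‖v‖ := by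
  calc ‖∑ j, M i j * v j‖ ≤ ∑ j, ‖M i j * v j‖ := norm_sum_le _ _
    _ ≤ ∑ j, ‖M i j‖ * ‖v‖ := Finset.sum_le_sum fun j _ => by
        rw [norm_mul]; exact mul_le_mul_of_nonneg_left (norm_le_pi_norm v j) (norm_nonneg _)
    _ = (∑ j, ‖M i j‖) * ‖v‖ := by rw [Finset.sum_mul]
    _ ≤ _ := mul_le_mul_of_nonneg_right
        (Finset.single_le_sum (f := fun i => ∑ j, ‖M i j‖)
          (fun _ _ => Finset.sum_nonneg fun _ _ => norm_nonneg _) (Finset.mem_univ i))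
        (norm_nonneg _)

theorem entrySum_le {M : Matrix (Fin 3) (Fin 3) ℂ} {g : ℝ} (h : ∀ i j, ‖M i j‖ ≤ g) :
    entrySum M ≤ 9 * g := by
  calc entrySum M ≤ ∑ _i : Fin 3, ∑ _j : Fin 3, g :=
        Finset.sum_le_sum fun i _ => Finset.sum_le_sum fun j _ => h i j
    _ = 9 * g := by simp; ring

theorem tendsto_integral_Ioi_zero {G : ℝ → ℝ} (hG : IntegrableOn G (Ioi 0)) :
    Tendsto (fun x => ∫ y in Ioi x, G y) atTop (𝓝 0) := by
  have h1 := intervalIntegral_tendsto_integral_Ioi 0 hG tendsto_id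
  have h2 : Tendsto (fun x => (∫ y in Ioi 0, G y) - ∫ y in (0 : ℝ)..x, G y) atTop (𝓝 0) := by
    simpa using h1.const_sub (∫ y in Ioi 0, G y)
  refine h2.congr' ?_
  filter_upwards [eventually_ge_atTop 0] with x hx
  have := intervalIntegral.integral_interval_add_Ioi (a := 0) (b := x) (f := G) (μ := volume) hG
    (hG.mono_set (Ioi_subset_Ioi hx))
  linarith

section FixedPair

variable {T : ℝ} {a b : Fin 3 → ℂ} {A B : ℝ → ℝ → Matrix (Fin 3) (Fin 3) ℂ} {c d : ℂ}
  {w w' : ℝ → ℝ → Fin 3 → ℂ} {G : ℝ → ℝ}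

theorem IsLaxSolution.sub (hw : IsLaxSolution T a b A B c d w)
    (hw' : IsLaxSolution T a b A B c d w') :
    IsLaxSolution T a b A B c d fun x t => w x t - w' x t where
  continuousOn := hw.continuousOn.sub hw'.continuousOn
  x_part x t hxt i := by
    refine ((hw.x_part x t hxt i).sub (hw'.x_part x t hxt i)).congr_deriv ?_
    rw [Matrix.mulVec_sub, Pi.sub_apply, Pi.sub_apply]
    ring
  t_part x t hxt i := by
    refine ((hw.t_part x t hxt i).sub (hw'.t_part x t hxt i)).congr_deriv ?_
    rw [Matrix.mulVec_sub, Pi.sub_apply, Pi.sub_apply]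
    ring

theorem continuousOn_entrySum
    (hA : ∀ i j, ContinuousOn (fun p : ℝ × ℝ => A p.1 p.2 i j) (closedDomain T)) {t : ℝ}
    (ht : t ∈ Icc 0 T) : ContinuousOn (fun y => entrySum (A y t)) (Ici 0) :=
  continuousOn_finsetSum _ fun i _ => continuousOn_finsetSum _ fun j _ =>
    (continuousOn_section_x (hA i j) ht).norm

theorem IsLaxSolution.continuousOn_norm (hw : IsLaxSolution T a b A B c d w) {t : ℝ}
    (ht : t ∈ Icc 0 T) : ContinuousOn (fun y => ‖w y t‖) (Ici 0) :=
  (hw.continuousOn.comp (f := fun y : ℝ => (y, t)) (by fun_prop)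
    fun _ hx => ⟨hx, ht⟩ : ContinuousOn (fun y => w y t) (Ici 0)).norm

theorem IsDominated.nonneg (hG : IsDominated T A G) (hT : 0 ≤ T) {y : ℝ} (hy : 0 < y) : 0 ≤ G y :=
  (norm_nonneg _).trans (hG.2 y 0 hy ⟨le_rfl, hT⟩ 0 0)

theorem IsDominated.integral_entrySum_le (hT : 0 ≤ T)
    (hA : ∀ i j, ContinuousOn (fun p : ℝ × ℝ => A p.1 p.2 i j) (closedDomain T))
    (hG : IsDominated T A G) {x₀ x₁ t : ℝ} (h₀ : 0 ≤ x₀) (h₁ : x₀ ≤ x₁) (ht : t ∈ Icc 0 T) :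
    ∫ y in x₀..x₁, entrySum (A y t) ≤ 9 * ∫ y in Ioi x₀, G y := by
  have hi : IntegrableOn (fun y => 9 * G y) (Ioi x₀) :=
    (hG.1.mono_set (Ioi_subset_Ioi h₀)).const_mul 9
  rw [intervalIntegral.integral_of_le h₁, ← integral_const_mul]
  calc ∫ y in Ioc x₀ x₁, entrySum (A y t) ≤ ∫ y in Ioc x₀ x₁, 9 * G y := by
        refine setIntegral_mono_on ?_ (hi.mono_set Ioc_subset_Ioi_self) measurableSet_Ioc
          fun y hy => entrySum_le (hG.2 y t (h₀.trans_lt hy.1) ht)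
        exact (((continuousOn_entrySum hA ht).mono
          (Icc_subset_Ici_self.trans (Ici_subset_Ici.2 h₀))).integrableOn_Icc (b := x₁)).mono_set
            Ioc_subset_Icc_self
    _ ≤ ∫ y in Ioi x₀, 9 * G y := by
        refine setIntegral_mono_set hi ?_ Ioc_subset_Ioi_self.eventuallyLE
        refine (ae_restrict_iff' measurableSet_Ioi).2 (Eventually.of_forall fun y hy => ?_)
        exact mul_nonneg (by norm_num) (hG.nonneg hT (h₀.trans_lt hy))

theorem IsDominated.integral_Ioi_le (hT : 0 ≤ T) (hG : IsDominated T A G) {x : ℝ} (hx : 0 ≤ x) :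
    ∫ y in Ioi x, G y ≤ ∫ y in Ioi 0, G y := by
  refine setIntegral_mono_set hG.1 ?_ (Ioi_subset_Ioi hx).eventuallyLE
  exact (ae_restrict_iff' measurableSet_Ioi).2 (Eventually.of_forall fun y hy => hG.nonneg hT hy)

/-- The exponentials `exp((a_i - c) r)`, `r ≥ 0`, have modulus at most 1, so Gronwall's inequality
from `x = 0` onwards bounds every solution by its initial value. The constant 9 counts the entries
of the matrix, as in `entrySum_le`. -/
theorem IsLaxSolution.norm_le_of_re_le (hT : 0 ≤ T) (hw : IsLaxSolution T a b A B c d w)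
    (hA : ∀ i j, ContinuousOn (fun p : ℝ × ℝ => A p.1 p.2 i j) (closedDomain T))
    (hG : IsDominated T A G) (hre : ∀ i, (a i).re ≤ c.re) {x t : ℝ} (hx : 0 ≤ x)
    (ht : t ∈ Icc 0 T) : ‖w x t‖ ≤ ‖w 0 t‖ * Real.exp (9 * ∫ y in Ioi 0, G y) := by
  have h := le_mul_exp_of_continuousOn (u := fun y => ‖w y t‖) (n := fun y => entrySum (A y t))
    (c := ‖w 0 t‖) (L := x) ((hw.continuousOn_norm ht).mono Icc_subset_Ici_self)
    ((continuousOn_entrySum hA ht).mono Icc_subset_Ici_self) (fun _ _ => entrySum_nonneg _)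
    (fun s hs => ?_) x ⟨hx, le_rfl⟩
  · refine h.trans (mul_le_mul_of_nonneg_left (Real.exp_le_exp.2 ?_) (norm_nonneg _))
    exact hG.integral_entrySum_le hT hA le_rfl hx ht
  · have hint : IntervalIntegrable (fun y => entrySum (A y t) * ‖w y t‖) volume 0 s := by
      refine ContinuousOn.intervalIntegrable ?_
      rw [uIcc_of_le hs.1]
      exact ((continuousOn_entrySum hA ht).mul (hw.continuousOn_norm ht)).mono Icc_subset_Ici_self
    have hnn : 0 ≤ ∫ y in (0 : ℝ)..s, entrySum (A y t) * ‖w y t‖ :=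
      intervalIntegral.integral_nonneg hs.1 fun y _ =>
        mul_nonneg (entrySum_nonneg _) (norm_nonneg _)
    refine (pi_norm_le_iff_of_nonneg (add_nonneg (norm_nonneg _) hnn)).2 fun i => ?_
    have he : ∀ r : ℝ, 0 ≤ r → ‖Complex.exp ((a i - c) * r)‖ ≤ 1 := fun r hr => by
      rw [Complex.norm_exp, Real.exp_le_one_iff, Complex.re_mul_ofReal, Complex.sub_re]
      exact mul_nonpos_of_nonpos_of_nonneg (by linarith [hre i]) hr
    rw [hw.eq_x_integral hA le_rfl hs.1 ht i]
    refine (norm_add_le _ _).trans (add_le_add ?_ ?_)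
    · rw [norm_mul]
      have := he s hs.1
      calc _ ≤ 1 * ‖w 0 t‖ := mul_le_mul (by simpa using this) (norm_le_pi_norm _ i)
            (norm_nonneg _) zero_le_one
        _ = _ := one_mul _
    · refine intervalIntegral.norm_integral_le_of_norm_le hs.1
        (Eventually.of_forall fun y hy => ?_) hint
      rw [norm_mul]
      have := he (s - y) (by linarith [hy.2])
      rw [Complex.ofReal_sub] at this
      calc _ ≤ 1 * (entrySum (A y t) * ‖w y t‖) := mul_le_mul this
            (norm_mulVec_le_entrySum _ _ i) (norm_nonneg _) zero_le_one
        _ = _ := one_mul _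

theorem IsLaxSolution.isBoundedColumn_of_re_le (hT : 0 ≤ T) (hw : IsLaxSolution T a b A B c d w)
    (hA : ∀ i j, ContinuousOn (fun p : ℝ × ℝ => A p.1 p.2 i j) (closedDomain T))
    (hG : IsDominated T A G) (hre : ∀ i, (a i).re ≤ c.re) : IsBoundedColumn T w := by
  have hc : ContinuousOn (fun t => w 0 t) (Icc 0 T) :=
    hw.continuousOn.comp (f := fun t : ℝ => ((0 : ℝ), t)) (by fun_prop)
      fun _ ht => closedDomain_mk le_rfl ht
  obtain ⟨C, hC⟩ := isCompact_Icc.exists_bound_of_continuousOn hc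
  refine ⟨C * Real.exp (9 * ∫ y in Ioi 0, G y), fun x t hxt i => ?_⟩
  refine (norm_le_pi_norm _ i).trans ((hw.norm_le_of_re_le hT hA hG hre hxt.1 hxt.2).trans ?_)
  exact mul_le_mul_of_nonneg_right (hC t hxt.2) (Real.exp_pos _).le

theorem IsLaxSolution.norm_sub_exp_le_integral (hw : IsLaxSolution T a b A B c d w)
    (hA : ∀ i j, ContinuousOn (fun p : ℝ × ℝ => A p.1 p.2 i j) (closedDomain T))
    (hre : ∀ i, c.re ≤ (a i).re) {x X t : ℝ} (hx : 0 ≤ x) (hX : x ≤ X) (ht : t ∈ Icc 0 T)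
    (i : Fin 3) : ‖w x t i - Complex.exp ((a i - c) * (x - X)) * w X t i‖ ≤
      ∫ y in x..X, entrySum (A y t) * ‖w y t‖ := by
  rw [hw.eq_x_integral hA (hx.trans hX) hx ht i, add_sub_cancel_left,
    intervalIntegral.integral_symm, norm_neg]
  refine intervalIntegral.norm_integral_le_of_norm_le hX
    (Eventually.of_forall fun y hy => ?_) ?_
  · rw [norm_mul]
    have := norm_exp_mul_sub_le (σ := a i - c) (by simpa using hre i) hy.1.le
    calc _ ≤ 1 * (entrySum (A y t) * ‖w y t‖) := mul_le_mul this
          (norm_mulVec_le_entrySum _ _ i) (norm_nonneg _) zero_le_one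
      _ = _ := one_mul _
  · refine ContinuousOn.intervalIntegrable ?_
    rw [uIcc_of_le hX]
    exact ((continuousOn_entrySum hA ht).mul (hw.continuousOn_norm ht)).mono
      (Icc_subset_Ici_self.trans (Ici_subset_Ici.2 hx))

/-- With the opposite ordering the exponentials are harmless when integrating backwards, so Gronwall
is applied in the variable `s = X - x`. -/
theorem IsLaxSolution.norm_le_of_le_re (hT : 0 ≤ T) (hw : IsLaxSolution T a b A B c d w)
    (hA : ∀ i j, ContinuousOn (fun p : ℝ × ℝ => A p.1 p.2 i j) (closedDomain T))
    (hG : IsDominated T A G) (hre : ∀ i, c.re ≤ (a i).re) {x X t : ℝ} (hx : 0 ≤ x) (hX : x ≤ X)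
    (ht : t ∈ Icc 0 T) : ‖w x t‖ ≤ ‖w X t‖ * Real.exp (9 * ∫ y in Ioi 0, G y) := by
  have hmap : MapsTo (fun s => X - s) (Icc 0 (X - x)) (Ici 0) := fun s hs => by
    have := hs.2
    simp only [mem_Ici]; linarith
  have h := le_mul_exp_of_continuousOn (u := fun s => ‖w (X - s) t‖)
    (n := fun s => entrySum (A (X - s) t)) (c := ‖w X t‖) (L := X - x)
    ((hw.continuousOn_norm ht).comp (f := fun s => X - s) (by fun_prop) hmap)
    ((continuousOn_entrySum hA ht).comp (f := fun s => X - s) (by fun_prop) hmap)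
    (fun _ _ => entrySum_nonneg _) (fun s hs => ?_) (X - x) ⟨by linarith, le_rfl⟩
  · simp only [sub_sub_cancel] at h
    refine h.trans (mul_le_mul_of_nonneg_left (Real.exp_le_exp.2 ?_) (norm_nonneg _))
    rw [intervalIntegral.integral_comp_sub_left (fun y => entrySum (A y t)), sub_sub_cancel,
      sub_zero]
    refine (hG.integral_entrySum_le hT hA hx hX ht).trans ?_
    exact mul_le_mul_of_nonneg_left (hG.integral_Ioi_le hT hx) (by norm_num)
  · have hs' : 0 ≤ X - s := hmap hs
    rw [intervalIntegral.integral_comp_sub_left (fun y => entrySum (A y t) * ‖w y t‖), sub_zero]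
    have hnn : 0 ≤ ∫ y in (X - s)..X, entrySum (A y t) * ‖w y t‖ :=
      intervalIntegral.integral_nonneg (by linarith [hs.1]) fun y _ =>
        mul_nonneg (entrySum_nonneg _) (norm_nonneg _)
    refine (pi_norm_le_iff_of_nonneg (add_nonneg (norm_nonneg _) hnn)).2 fun i => ?_
    have h1 := hw.norm_sub_exp_le_integral hA hre hs' (by linarith [hs.1] : X - s ≤ X) ht i
    have h2 : ‖Complex.exp ((a i - c) * ((X - s : ℝ) - X)) * w X t i‖ ≤ ‖w X t‖ := by
      rw [norm_mul]
      calc _ ≤ 1 * ‖w X t‖ := mul_le_mul (norm_exp_mul_sub_le (by simpa using hre i)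
            (by linarith [hs.1])) (norm_le_pi_norm _ i) (norm_nonneg _) zero_le_one
        _ = _ := one_mul _
    have h3 := norm_add_le (w (X - s) t i - Complex.exp ((a i - c) * ((X - s : ℝ) - X)) * w X t i)
      (Complex.exp ((a i - c) * ((X - s : ℝ) - X)) * w X t i)
    rw [sub_add_cancel] at h3
    linarith

/-- Without the matrix `A` the solution would be constantly `e_j`, since its only nonzero entry
carries no exponential. The deviation is thus controlled by the tail of the majorant, uniformly in
the terminal point `X`. -/
theorem IsLaxSolution.norm_sub_single_le (hT : 0 ≤ T) {j : Fin 3}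
    (hw : IsLaxSolution T a b A B (a j) d w)
    (hA : ∀ i j, ContinuousOn (fun p : ℝ × ℝ => A p.1 p.2 i j) (closedDomain T))
    (hG : IsDominated T A G) (hre : ∀ i, (a j).re ≤ (a i).re) {x X t : ℝ} (hx : 0 ≤ x)
    (hX : x ≤ X) (ht : t ∈ Icc 0 T) (hwX : w X t = Pi.single j 1) :
    ‖w x t - Pi.single j 1‖ ≤
      9 * Real.exp (9 * ∫ y in Ioi 0, G y) * ∫ y in Ioi x, G y := by
  have hG0 : 0 ≤ ∫ y in Ioi x, G y :=
    setIntegral_nonneg measurableSet_Ioi fun y hy => hG.nonneg hT (hx.trans_lt hy)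
  refine (pi_norm_le_iff_of_nonneg (by positivity)).2 fun i => ?_
  have h1 := hw.norm_sub_exp_le_integral hA hre hx hX ht i
  have h2 : Complex.exp ((a i - a j) * (x - X)) * w X t i = Pi.single (M := fun _ => ℂ) j 1 i := by
    rw [hwX]
    by_cases hij : i = j
    · subst hij; simp
    · simp [hij]
  rw [h2] at h1
  refine h1.trans ?_
  have h3 : ∀ y ∈ Icc x X, entrySum (A y t) * ‖w y t‖ ≤
      entrySum (A y t) * Real.exp (9 * ∫ y in Ioi 0, G y) := fun y hy => by
    refine mul_le_mul_of_nonneg_left ?_ (entrySum_nonneg _)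
    have := hw.norm_le_of_le_re hT hA hG hre (hx.trans hy.1) hy.2 ht
    have hs : ‖(Pi.single j 1 : Fin 3 → ℂ)‖ ≤ 1 := by
      refine (pi_norm_le_iff_of_nonneg zero_le_one).2 fun i => ?_
      by_cases hij : i = j
      · subst hij; simp
      · simp [hij]
    rw [hwX] at this
    exact this.trans (mul_le_of_le_one_left (Real.exp_pos _).le hs)
  have hc1 : ContinuousOn (fun y => entrySum (A y t)) (uIcc x X) := by
    rw [uIcc_of_le hX]
    exact (continuousOn_entrySum hA ht).mono (Icc_subset_Ici_self.trans (Ici_subset_Ici.2 hx))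
  have hc2 : ContinuousOn (fun y => ‖w y t‖) (uIcc x X) := by
    rw [uIcc_of_le hX]
    exact (hw.continuousOn_norm ht).mono (Icc_subset_Ici_self.trans (Ici_subset_Ici.2 hx))
  calc _ ≤ ∫ y in x..X, entrySum (A y t) * Real.exp (9 * ∫ y in Ioi 0, G y) :=
        intervalIntegral.integral_mono_on hX (hc1.mul hc2).intervalIntegrable
          (hc1.mul continuousOn_const).intervalIntegrable h3
    _ = (∫ y in x..X, entrySum (A y t)) * Real.exp (9 * ∫ y in Ioi 0, G y) :=
        intervalIntegral.integral_mul_const _ _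
    _ ≤ (9 * ∫ y in Ioi x, G y) * Real.exp (9 * ∫ y in Ioi 0, G y) :=
        mul_le_mul_of_nonneg_right (hG.integral_entrySum_le hT hA hx hX ht) (Real.exp_pos _).le
    _ = _ := by ring

theorem IsLaxSolution.tendsto_zero (hw : IsLaxSolution T a b A B c d w)
    (hA : ∀ i j, ContinuousOn (fun p : ℝ × ℝ => A p.1 p.2 i j) (closedDomain T))
    (hG : IsDominated T A G) (hb : IsBoundedColumn T w) {i : Fin 3} (hi : c.re < (a i).re) {t : ℝ}
    (ht : t ∈ Icc 0 T) : Tendsto (fun x => w x t i) atTop (𝓝 0) := by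
  obtain ⟨C, hC⟩ := hb
  have h1 : Tendsto (fun x => (3 * C) * ∫ y in Ioi x, G y) atTop (𝓝 0) := by
    simpa using (tendsto_integral_Ioi_zero hG.1).const_mul (3 * C)
  refine squeeze_zero_norm' ?_ h1
  filter_upwards [eventually_ge_atTop 0] with x hx
  have := hw.integral_Ioi hA hG ⟨C, hC⟩ hx ht hi.le (m := 0)
    (tendsto_exp_mul_zero (by simpa using hi) (C := C)
      ((eventually_ge_atTop 0).mono fun y hy => hC y t (closedDomain_mk hy ht) i))
  rw [zero_sub, ← neg_eq_iff_eq_neg] at this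
  rw [← this, norm_neg, ← integral_const_mul]
  refine norm_integral_le_of_norm_le ((hG.1.mono_set (Ioi_subset_Ioi hx)).const_mul _)
    ((ae_restrict_iff' measurableSet_Ioi).2 (Eventually.of_forall fun y hy => ?_))
  have hy0 : 0 < y := hx.trans_lt hy
  rw [norm_mul]
  calc _ ≤ 1 * (3 * G y * C) := mul_le_mul
        (norm_exp_mul_sub_le (by simpa using hi.le) (le_of_lt hy))
        (norm_mulVec_le (hG.2 y t hy0 ht) (hC y t (closedDomain_mk hy0.le ht)) i)
        (norm_nonneg _) zero_le_one
    _ = _ := by ring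

/-- Uniqueness of Jost solutions: entries with a strict gap tend to zero by `tendsto_zero`, the
remaining one by hypothesis, and `norm_le_of_le_re` bounds the value at the origin by these
vanishing far values. -/
theorem IsLaxSolution.eq_zero_of_tendsto (hT : 0 ≤ T) {j : Fin 3}
    (hw : IsLaxSolution T a b A B (a j) d w)
    (hA : ∀ i j, ContinuousOn (fun p : ℝ × ℝ => A p.1 p.2 i j) (closedDomain T))
    (hG : IsDominated T A G) (hb : IsBoundedColumn T w)
    (hre : ∀ i, i ≠ j → (a j).re < (a i).re)
    (hlim : Tendsto (fun x => w x 0 j) atTop (𝓝 0)) : w 0 0 = 0 := by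
  have h0 : (0 : ℝ) ∈ Icc 0 T := ⟨le_rfl, hT⟩
  have hl : Tendsto (fun x => w x 0) atTop (𝓝 0) := by
    refine tendsto_pi_nhds.2 fun i => ?_
    by_cases hij : i = j
    · subst hij; exact hlim
    · exact hw.tendsto_zero hA hG hb (hre i hij) h0
  have hre' : ∀ i, (a j).re ≤ (a i).re := fun i => by
    by_cases hij : i = j
    · subst hij; rfl
    · exact (hre i hij).le
  have h1 : Tendsto (fun x => ‖w x 0‖ * Real.exp (9 * ∫ y in Ioi 0, G y)) atTop (𝓝 0) := by
    simpa using hl.norm.mul_const (Real.exp (9 * ∫ y in Ioi 0, G y))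
  refine norm_le_zero_iff.1 (ge_of_tendsto h1 ?_)
  filter_upwards [eventually_ge_atTop 0] with X hX
  exact hw.norm_le_of_le_re hT hA hG hre' le_rfl hX h0

end FixedPair

end

section

/-! ### Behaviour at infinity uniformly in `t`, and holomorphic Jost solutions. -/

theorem norm_single_le_one (j : Fin 3) : ‖(Pi.single j 1 : Fin 3 → ℂ)‖ ≤ 1 := by
  refine (pi_norm_le_iff_of_nonneg zero_le_one).2 fun i => ?_
  by_cases hij : i = j
  · subst hij; simp
  · simp [hij]

/-- Gronwall in `t` at a fixed `x` where the entries of `B` are at most `ε`: closeness to `e_j`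
spreads from `t = 0` to all of `[0,T]`. Here `E` bounds the free exponentials, and the factor 3
comes from the three terms of a row. -/
theorem IsLaxSolution.norm_sub_single_le_of_norm_B_le {T : ℝ} {a b : Fin 3 → ℂ}
    {A B : ℝ → ℝ → Matrix (Fin 3) (Fin 3) ℂ} {c : ℂ} {w : ℝ → ℝ → Fin 3 → ℂ} {j : Fin 3}
    (hw : IsLaxSolution T a b A B c (b j) w)
    (hB : ∀ i j, ContinuousOn (fun p : ℝ × ℝ => B p.1 p.2 i j) (closedDomain T)) {x ε E : ℝ}
    (hx : 0 ≤ x) (hε : ∀ t ∈ Icc 0 T, ∀ i l, ‖B x t i l‖ ≤ ε)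
    (hE : ∀ r ∈ Icc 0 T, ∀ i, ‖Complex.exp ((b i - b j) * r)‖ ≤ E) {t : ℝ} (ht : t ∈ Icc 0 T) :
    ‖w x t - Pi.single j 1‖ ≤
      (E * ‖w x 0 - Pi.single j 1‖ + 3 * ε * E * T) * Real.exp (3 * ε * E * T) := by
  have hT : 0 ≤ T := ht.1.trans ht.2
  have hε0 : 0 ≤ ε := (norm_nonneg _).trans (hε t ht 0 0)
  have hE0 : 0 ≤ E := (norm_nonneg _).trans (hE t ht 0)
  have hcw : ContinuousOn (fun t => ‖w x t - Pi.single j 1‖) (Icc 0 T) :=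
    ((hw.continuousOn.comp (f := fun t : ℝ => (x, t)) (by fun_prop)
      fun _ ht => closedDomain_mk hx ht : ContinuousOn (fun t => w x t) (Icc 0 T)).sub
        continuousOn_const).norm
  have hcw' : ∀ s ∈ Icc 0 T, IntervalIntegrable (fun τ => ‖w x τ - Pi.single j 1‖) volume 0 s := by
    intro s hs
    refine ContinuousOn.intervalIntegrable ?_
    rw [uIcc_of_le hs.1]
    exact hcw.mono (Icc_subset_Icc_right hs.2)
  have h := le_mul_exp_of_continuousOn (u := fun t => ‖w x t - Pi.single j 1‖)
    (n := fun _ => 3 * ε * E) (c := E * ‖w x 0 - Pi.single j 1‖ + 3 * ε * E * T) (L := T)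
    hcw continuousOn_const (fun _ _ => by positivity) (fun s hs => ?_) t ht
  · refine h.trans (mul_le_mul_of_nonneg_left (Real.exp_le_exp.2 ?_) (by positivity))
    rw [intervalIntegral.integral_const, sub_zero, smul_eq_mul, mul_comm]
    exact mul_le_mul_of_nonneg_left ht.2 (by positivity)
  · have hnn : 0 ≤ ∫ τ in (0 : ℝ)..s, 3 * ε * E * ‖w x τ - Pi.single j 1‖ :=
      intervalIntegral.integral_nonneg hs.1 fun y _ => by positivity
    refine (pi_norm_le_iff_of_nonneg (by positivity)).2 fun i => ?_
    have h0 : (0 : ℝ) ∈ Icc 0 T := ⟨le_rfl, hT⟩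
    have h1 : (w x s - (Pi.single j 1 : Fin 3 → ℂ)) i = Complex.exp ((b i - b j) * s) *
        (w x 0 - (Pi.single j 1 : Fin 3 → ℂ)) i + ∫ τ in (0 : ℝ)..s,
          Complex.exp ((b i - b j) * (s - τ)) * (B x τ).mulVec (w x τ) i := by
      rw [Pi.sub_apply, Pi.sub_apply, hw.eq_t_integral hB hx h0 hs i]
      by_cases hij : i = j
      · subst hij; simp; ring
      · simp [hij]
    rw [h1]
    have h2 : ‖Complex.exp ((b i - b j) * s) * (w x 0 - (Pi.single j 1 : Fin 3 → ℂ)) i‖ ≤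
        E * ‖w x 0 - Pi.single j 1‖ := by
      rw [norm_mul]
      exact mul_le_mul (hE s hs i) (norm_le_pi_norm _ i) (norm_nonneg _) hE0
    have h3 : ‖∫ τ in (0 : ℝ)..s,
          Complex.exp ((b i - b j) * (s - τ)) * (B x τ).mulVec (w x τ) i‖ ≤
        ∫ τ in (0 : ℝ)..s, (3 * ε * E + 3 * ε * E * ‖w x τ - Pi.single j 1‖) := by
      refine intervalIntegral.norm_integral_le_of_norm_le hs.1
        (Eventually.of_forall fun τ hτ => ?_)
        ((intervalIntegrable_const).add ((hcw' s hs).const_mul _))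
      have hτ' : τ ∈ Icc 0 T := ⟨hτ.1.le, hτ.2.trans hs.2⟩
      have h4 := hE (s - τ) ⟨by linarith [hτ.2], by linarith [hτ.1, hs.2]⟩ i
      rw [Complex.ofReal_sub] at h4
      have h5 := norm_mulVec_le (v := w x τ) (hε τ hτ') (fun l => norm_le_pi_norm _ l) i
      have h6 : ‖w x τ‖ ≤ 1 + ‖w x τ - Pi.single j 1‖ := by
        have := norm_add_le (Pi.single j 1 : Fin 3 → ℂ) (w x τ - Pi.single j 1)
        rw [add_sub_cancel] at this
        exact this.trans (by gcongr; exact norm_single_le_one j)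
      rw [norm_mul]
      calc _ ≤ E * (3 * ε * (1 + ‖w x τ - Pi.single j 1‖)) := by
            refine mul_le_mul h4 (h5.trans ?_) (norm_nonneg _) hE0
            gcongr
        _ = _ := by ring
    rw [intervalIntegral.integral_add intervalIntegrable_const ((hcw' s hs).const_mul _),
      intervalIntegral.integral_const, sub_zero, smul_eq_mul] at h3
    have h7 : s * (3 * ε * E) ≤ 3 * ε * E * T := by
      rw [mul_comm]; exact mul_le_mul_of_nonneg_left hs.2 (by positivity)
    refine (norm_add_le _ _).trans ?_
    linarith

variable {T : ℝ} {a b : ℂ → Fin 3 → ℂ} {A : ℝ → ℝ → Matrix (Fin 3) (Fin 3) ℂ}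
  {B : ℂ → ℝ → ℝ → Matrix (Fin 3) (Fin 3) ℂ} {k : ℂ} {w : ℝ → ℝ → Fin 3 → ℂ} {j : Fin 3}

theorem LaxFamily.continuousOn_B' (h : LaxFamily T a b A B) (k : ℂ) (i j : Fin 3) :
    ContinuousOn (fun p : ℝ × ℝ => B k p.1 p.2 i j) (closedDomain T) :=
  (h.continuousOn_B i j).comp (f := fun p : ℝ × ℝ => (k, p)) (by fun_prop)
    fun _ hp => ⟨trivial, hp⟩

theorem LaxFamily.exists_forall_norm_sub_single_le (h : LaxFamily T a b A B)
    (hw : IsLaxSolution T (a k) (b k) A (B k) (a k j) (b k j) w)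
    (hlim : Tendsto (fun x => w x 0) atTop (𝓝 (Pi.single j 1))) {δ : ℝ} (hδ : 0 < δ) :
    ∃ X, 0 ≤ X ∧ ∀ x t, X ≤ x → t ∈ Icc 0 T → ‖w x t - Pi.single j 1‖ ≤ δ := by
  set E : ℝ := Real.exp ((∑ i, ‖b k i - b k j‖) * T) with hEdef
  have hE : ∀ r ∈ Icc 0 T, ∀ i, ‖Complex.exp ((b k i - b k j) * r)‖ ≤ E := by
    intro r hr i
    rw [Complex.norm_exp, hEdef, Real.exp_le_exp]
    have h1 : ‖b k i - b k j‖ ≤ ∑ i, ‖b k i - b k j‖ :=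
      Finset.single_le_sum (f := fun i => ‖b k i - b k j‖) (fun _ _ => norm_nonneg _)
        (Finset.mem_univ i)
    calc ((b k i - b k j) * r).re ≤ ‖(b k i - b k j) * r‖ := Complex.re_le_norm _
      _ = ‖b k i - b k j‖ * r := by rw [norm_mul, Complex.norm_real, Real.norm_of_nonneg hr.1]
      _ ≤ _ := mul_le_mul h1 hr.2 hr.1 ((norm_nonneg _).trans h1)
  have hF : Tendsto (fun ε : ℝ => (E * ε + 3 * ε * E * T) * Real.exp (3 * ε * E * T)) (𝓝[>] 0)
      (𝓝 0) := by
    have : Continuous fun ε : ℝ => (E * ε + 3 * ε * E * T) * Real.exp (3 * ε * E * T) := by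
      fun_prop
    have := this.tendsto 0
    simp only [mul_zero, zero_mul, add_zero] at this
    exact this.mono_left nhdsWithin_le_nhds
  -- A single `ε` bounds both the entries of `B` and the deviation at `t = 0`; the resulting
  -- estimate is continuous in `ε` and vanishes at `0`.
  obtain ⟨ε, hεδ, hε⟩ := ((hF.eventually (gt_mem_nhds hδ)).and self_mem_nhdsWithin).exists
  obtain ⟨X₁, hX₁⟩ := h.decay_B k ε hε
  have hu : ∀ᶠ x in atTop, ‖w x 0 - Pi.single j 1‖ < ε := by
    have := (hlim.sub_const (Pi.single j 1)).norm
    rw [sub_self, norm_zero] at this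
    exact this.eventually (gt_mem_nhds hε)
  obtain ⟨X₂, hX₂⟩ := eventually_atTop.1 hu
  refine ⟨max 0 (max X₁ X₂), le_max_left _ _, fun x t hx ht => ?_⟩
  have hx0 : 0 ≤ x := (le_max_left _ _).trans hx
  have hx1 : X₁ ≤ x := (le_max_left _ _).trans ((le_max_right _ _).trans hx)
  have hx2 : X₂ ≤ x := (le_max_right _ _).trans ((le_max_right _ _).trans hx)
  refine (hw.norm_sub_single_le_of_norm_B_le (h.continuousOn_B' k) hx0
    (fun t ht => hX₁ x t hx1 ht) hE ht).trans (le_trans ?_ hεδ.le)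
  have := (hX₂ x hx2).le
  gcongr

theorem LaxFamily.tendsto_single (h : LaxFamily T a b A B)
    (hw : IsLaxSolution T (a k) (b k) A (B k) (a k j) (b k j) w)
    (hlim : Tendsto (fun x => w x 0) atTop (𝓝 (Pi.single j 1))) {t : ℝ} (ht : t ∈ Icc 0 T) :
    Tendsto (fun x => w x t) atTop (𝓝 (Pi.single j 1)) := by
  rw [Metric.tendsto_atTop']
  intro δ hδ
  obtain ⟨X, _, hX⟩ := h.exists_forall_norm_sub_single_le hw hlim (half_pos hδ)
  refine ⟨X, fun x hx => ?_⟩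
  rw [dist_eq_norm]
  exact (hX x t hx.le ht).trans_lt (half_lt_self hδ)

theorem LaxFamily.isBoundedColumn_of_tendsto (h : LaxFamily T a b A B)
    (hw : IsLaxSolution T (a k) (b k) A (B k) (a k j) (b k j) w)
    (hlim : Tendsto (fun x => w x 0) atTop (𝓝 (Pi.single j 1))) : IsBoundedColumn T w := by
  obtain ⟨X, hX0, hX⟩ := h.exists_forall_norm_sub_single_le hw hlim one_pos
  obtain ⟨C, hC⟩ := ((isCompact_Icc (a := 0) (b := X)).prod
    (isCompact_Icc (a := 0) (b := T))).exists_bound_of_continuousOn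
      (hw.continuousOn.mono (prod_mono Icc_subset_Ici_self Subset.rfl))
  refine ⟨max C 2, fun x t hxt i => (norm_le_pi_norm _ i).trans ?_⟩
  rcases le_total x X with hx | hx
  · exact (hC (x, t) ⟨⟨hxt.1, hx⟩, hxt.2⟩).trans (le_max_left _ _)
  · have h1 := hX x t hx hxt.2
    have h2 := norm_add_le (w x t - Pi.single j 1) (Pi.single j 1 : Fin 3 → ℂ)
    rw [sub_add_cancel] at h2
    have h3 := norm_single_le_one j
    exact (by linarith : ‖w x t‖ ≤ 2).trans (le_max_right _ _)

/-- The Jost solution is the limit of the solutions `u n` equal to `e_j` at `(n,0)`. Their values `y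
n` at the origin are entire in `k` and converge uniformly in `k` wherever the real parts are ordered
as required, so the limit is holomorphic on open sets of such `k`. The convergence at infinity,
first obtained at `t = 0`, then spreads to all `t`. -/
theorem LaxFamily.exists_jost (hT : 0 < T) (h : LaxFamily T a b A B)
    {Φ Ψ : ℂ → ℝ → ℝ → Matrix (Fin 3) (Fin 3) ℂ} (hΦ : IsFundamentalPair T a b A B Φ Ψ)
    (j : Fin 3) : ∃ σ : ℂ → Fin 3 → ℂ,
      (∀ k, (∀ i, (a k j).re ≤ (a k i).re) →
        IsBoundedColumn T (fun x t =>
          Complex.exp (-(a k j * x + b k j * t)) • (Φ k x t).mulVec (σ k)) ∧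
        ∀ t ∈ Icc 0 T, Tendsto (fun x : ℝ =>
          Complex.exp (-(a k j * x + b k j * t)) • (Φ k x t).mulVec (σ k)) atTop
          (𝓝 (Pi.single j 1))) ∧
      ∀ U, IsOpen U → (∀ k ∈ U, ∀ i, (a k j).re ≤ (a k i).re) → DifferentiableOn ℂ σ U := by
  obtain ⟨G, hG⟩ := h.decay_A
  have hG : IsDominated T A G := hG
  have h0T : (0 : ℝ) ∈ Icc 0 T := ⟨le_rfl, hT.le⟩
  let y : ℕ → ℂ → Fin 3 → ℂ := fun n k =>
    Complex.exp (a k j * n) • (Ψ k n 0).transpose.mulVec (Pi.single j 1)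
  let u : ℕ → ℂ → ℝ → ℝ → Fin 3 → ℂ := fun n k x t =>
    Complex.exp (-(a k j * x + b k j * t)) • (Φ k x t).mulVec (y n k)
  have hu : ∀ n k, IsLaxSolution T (a k) (b k) A (B k) (a k j) (b k j) (u n k) :=
    fun n k => hΦ.isLaxSolution _ _ _
  have hun : ∀ n k, u n k n 0 = Pi.single j 1 := by
    intro n k
    have hm : ((n : ℝ), (0 : ℝ)) ∈ closedDomain T := closedDomain_mk n.cast_nonneg h0T
    simp only [u, y, Matrix.mulVec_smul, Matrix.mulVec_mulVec, hΦ.mul_transpose hm,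
      Matrix.one_mulVec, smul_smul, ← Complex.exp_add]
    simp
  have hu0 : ∀ n k, u n k 0 0 = y n k := fun n k => by
    simp [u, hΦ.primal.apply_zero]
  set K := Real.exp (9 * ∫ y in Ioi 0, G y) with hK
  have hK0 : 0 < K := Real.exp_pos _
  -- At `x = n` the solution `u n` is exactly `e_j` and `u m` differs from it by a tail of the
  -- majorant; the backward estimate carries this to the origin. The bound does not involve `k`.
  have hest : ∀ k, (∀ i, (a k j).re ≤ (a k i).re) → ∀ n m : ℕ, n ≤ m →
      ‖y n k - y m k‖ ≤ 9 * K * K * ∫ y in Ioi (n : ℝ), G y := by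
    intro k hk n m hnm
    have h1 := (hu m k).norm_sub_single_le hT.le h.continuousOn_A hG hk n.cast_nonneg
      (Nat.cast_le.2 hnm) h0T (hun m k)
    have h2 := ((hu n k).sub (hu m k)).norm_le_of_le_re hT.le h.continuousOn_A hG hk le_rfl
      (n.cast_nonneg (α := ℝ)) h0T
    rw [hu0, hu0, hun, norm_sub_rev (Pi.single j 1)] at h2
    calc _ ≤ _ := h2
      _ ≤ (9 * K * ∫ y in Ioi (n : ℝ), G y) * K := mul_le_mul_of_nonneg_right h1 hK0.le
      _ = _ := by ring
  have htail : Tendsto (fun n : ℕ => 9 * K * K * ∫ y in Ioi (n : ℝ), G y) atTop (𝓝 0) := by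
    simpa using ((tendsto_integral_Ioi_zero hG.1).comp tendsto_natCast_atTop_atTop).const_mul
      (9 * K * K)
  have hlim : ∀ k, ∃ v, (∀ i, (a k j).re ≤ (a k i).re) → Tendsto (fun n => y n k) atTop (𝓝 v) := by
    intro k
    by_cases hk : ∀ i, (a k j).re ≤ (a k i).re
    · have hc : CauchySeq fun n => y n k := by
        refine cauchySeq_of_le_tendsto_0 (fun n : ℕ => 2 * (9 * K * K * ∫ y in Ioi (n : ℝ), G y))
          (fun n m N hn hm => ?_) (by simpa using htail.const_mul 2)
        refine (dist_triangle_left _ _ (y N k)).trans ?_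
        rw [dist_eq_norm, dist_eq_norm]
        linarith [hest k hk N n hn, hest k hk N m hm]
      obtain ⟨v, hv⟩ := cauchySeq_tendsto_of_complete hc
      exact ⟨v, fun _ => hv⟩
    · exact ⟨0, fun h => absurd h hk⟩
  choose σ hσ using hlim
  refine ⟨σ, fun k hk => ?_, fun U hU hUk => ?_⟩
  · set w : ℝ → ℝ → Fin 3 → ℂ := fun x t =>
      Complex.exp (-(a k j * x + b k j * t)) • (Φ k x t).mulVec (σ k) with hwdef
    have hw : IsLaxSolution T (a k) (b k) A (B k) (a k j) (b k j) w := hΦ.isLaxSolution _ _ _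
    have hle : ∀ x, 0 ≤ x → ‖w x 0 - Pi.single j 1‖ ≤ 9 * K * ∫ y in Ioi x, G y := by
      intro x hx
      have hc : Continuous fun v : Fin 3 → ℂ => ‖(Complex.exp (-(a k j * x + b k j * (0 : ℝ))) •
          (Φ k x 0).mulVec v) - Pi.single j 1‖ := by
        have : Continuous fun v : Fin 3 → ℂ => (Φ k x 0).mulVec v :=
          continuous_const.matrix_mulVec continuous_id
        fun_prop
      refine le_of_tendsto ((hc.tendsto _).comp (hσ k hk)) ?_
      filter_upwards [eventually_ge_atTop ⌈x⌉₊] with n hn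
      exact (hu n k).norm_sub_single_le hT.le h.continuousOn_A hG hk hx (Nat.ceil_le.1 hn) h0T
        (hun n k)
    have hl : Tendsto (fun x => w x 0) atTop (𝓝 (Pi.single j 1)) := by
      rw [tendsto_iff_norm_sub_tendsto_zero]
      refine squeeze_zero' (Eventually.of_forall fun _ => norm_nonneg _)
        ((eventually_ge_atTop 0).mono fun x hx => hle x hx) ?_
      simpa using (tendsto_integral_Ioi_zero hG.1).const_mul (9 * K)
    exact ⟨h.isBoundedColumn_of_tendsto hw hl, fun t ht => h.tendsto_single hw hl ht⟩
  · have hd : ∀ n, Differentiable ℂ (y n) := by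
      intro n
      refine ((((h.differentiable_a j).mul_const _).cexp).smul ?_)
      refine differentiable_pi.2 fun i => ?_
      simp only [Matrix.mulVec_single_one]
      exact hΦ.dual.differentiable n 0 j i
    refine TendstoLocallyUniformlyOn.differentiableOn (F := y) (φ := atTop) ?_
      (Eventually.of_forall fun n => (hd n).differentiableOn) hU
    refine TendstoUniformlyOn.tendstoLocallyUniformlyOn ?_
    rw [Metric.tendstoUniformlyOn_iff]
    intro ε hε
    filter_upwards [htail.eventually (gt_mem_nhds hε)] with n hn k hk
    refine lt_of_le_of_lt ?_ hn
    rw [dist_comm, dist_eq_norm]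
    refine le_of_tendsto ((tendsto_const_nhds.sub (hσ k (hUk k hk))).norm) ?_
    filter_upwards [eventually_ge_atTop n] with m hm
    exact hest k (hUk k hk) n m hm

end

section

/-! ### The Lax pair of the system -/

theorem sqrt_three_sq : ((√3 : ℝ) : ℂ) ^ 2 = 3 := by
  rw [← Complex.ofReal_pow, Real.sq_sqrt (by norm_num)]; norm_num

theorem sqrt_three_ne_zero : ((√3 : ℝ) : ℂ) ≠ 0 := by
  rw [Complex.ofReal_ne_zero]; positivity

theorem omega_eq : omega = -1 / 2 + (√3 : ℝ) / 2 * Complex.I := by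
  have h1 : (2 * (Real.pi : ℂ) * Complex.I / 3) = ((2 * Real.pi / 3 : ℝ) : ℂ) * Complex.I := by
    push_cast; ring
  have h2 : 2 * Real.pi / 3 = Real.pi - Real.pi / 3 := by ring
  rw [omega, h1, Complex.exp_mul_I, ← Complex.ofReal_cos, ← Complex.ofReal_sin, h2,
    Real.cos_pi_sub, Real.sin_pi_sub, Real.cos_pi_div_three, Real.sin_pi_div_three]
  push_cast
  ring

theorem omega_sq : omega ^ 2 = -1 - omega := by
  rw [omega_eq]
  linear_combination (1 / 4 : ℂ) * Complex.I ^ 2 * sqrt_three_sq + (3 / 4 : ℂ) * Complex.I_sq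

/-- Writing `i/√3` through `ω` leaves `ω² = -1 - ω` as the only relation needed in the zero
curvature computation. -/
theorem I_div_sqrt_three : Complex.I / (√3 : ℝ) = (1 + 2 * omega) / 3 := by
  rw [omega_eq, div_eq_iff sqrt_three_ne_zero]
  linear_combination (-Complex.I / 3) * sqrt_three_sq

theorem norm_omega : ‖omega‖ = 1 := by
  have : omega = Complex.exp (((2 * Real.pi / 3 : ℝ) : ℂ) * Complex.I) := by
    rw [omega]; congr 1; push_cast; ring
  rw [this, Complex.norm_exp_ofReal_mul_I]

theorem norm_I_div_sqrt_three : ‖Complex.I / ((√3 : ℝ) : ℂ)‖ ≤ 1 := by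
  rw [norm_div, Complex.norm_I, Complex.norm_real, Real.norm_of_nonneg (by positivity)]
  refine div_le_one_of_le₀ ?_ (by positivity)
  exact Real.one_le_sqrt.2 (by norm_num)

theorem forall_entries {P : Fin 3 → Fin 3 → Prop} (h00 : P 0 0) (h01 : P 0 1) (h02 : P 0 2)
    (h10 : P 1 0) (h11 : P 1 1) (h12 : P 1 2) (h20 : P 2 0) (h21 : P 2 1) (h22 : P 2 2) :
    ∀ i j, P i j := by
  intro i j
  fin_cases i <;> fin_cases j <;> assumption

/-- Continuous partial derivatives of a `C²` function on the closed half-line domain. -/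
structure HasPartials (T : ℝ) (f : ℝ → ℝ → ℂ) (fx fxx ft : ℝ → ℝ → ℂ) : Prop where
  continuousOn : ContinuousOn (Function.uncurry f) (closedDomain T)
  continuousOn_x : ContinuousOn (Function.uncurry fx) (closedDomain T)
  continuousOn_xx : ContinuousOn (Function.uncurry fxx) (closedDomain T)
  continuousOn_t : ContinuousOn (Function.uncurry ft) (closedDomain T)
  deriv_x : ∀ x t, (x, t) ∈ closedDomain T →
    HasDerivWithinAt (fun y => f y t) (fx x t) (Ici 0) x
  deriv_xx : ∀ x t, (x, t) ∈ closedDomain T →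
    HasDerivWithinAt (fun y => fx y t) (fxx x t) (Ici 0) x
  deriv_t : ∀ x t, (x, t) ∈ closedDomain T →
    HasDerivWithinAt (fun τ => f x τ) (ft x t) (Icc 0 T) t

theorem exists_hasPartials {T : ℝ} (hT : 0 < T) {f : ℝ → ℝ → ℂ}
    (hf : ContDiffOn ℝ 2 (Function.uncurry f) (closedDomain T)) :
    ∃ fx fxx ft, HasPartials T f fx fxx ft := by
  have hu : UniqueDiffOn ℝ (closedDomain T) :=
    (uniqueDiffOn_Ici 0).prod (uniqueDiffOn_Icc hT)
  have hD : ContDiffOn ℝ 1 (fderivWithin ℝ (Function.uncurry f) (closedDomain T))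
      (closedDomain T) := hf.fderivWithin hu (by norm_num)
  have hDx : ∀ v : ℝ × ℝ, ContDiffOn ℝ 1
      (fun p => fderivWithin ℝ (Function.uncurry f) (closedDomain T) p v) (closedDomain T) :=
    fun v => hD.clm_apply contDiffOn_const
  have hsec : ∀ {g : ℝ × ℝ → ℂ}, DifferentiableOn ℝ g (closedDomain T) → ∀ x t,
      (x, t) ∈ closedDomain T → HasDerivWithinAt (fun y => g (y, t))
        (fderivWithin ℝ g (closedDomain T) (x, t) (1, 0)) (Ici 0) x := by
    intro g hg x t hxt
    have h1 : HasDerivWithinAt (fun y : ℝ => (y, t)) ((1 : ℝ), (0 : ℝ)) (Ici 0) x :=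
      (hasDerivWithinAt_id x _).prodMk (hasDerivWithinAt_const x _ t)
    exact (hg (x, t) hxt).hasFDerivWithinAt.comp_hasDerivWithinAt x h1
      fun y hy => closedDomain_mk hy hxt.2
  have hD2 : ContDiffOn ℝ 0 (fderivWithin ℝ (fun p => fderivWithin ℝ (Function.uncurry f)
      (closedDomain T) p (1, 0)) (closedDomain T)) (closedDomain T) :=
    (hDx (1, 0)).fderivWithin hu (by norm_num)
  refine ⟨fun x t => fderivWithin ℝ (Function.uncurry f) (closedDomain T) (x, t) (1, 0),
    fun x t => fderivWithin ℝ (fun p => fderivWithin ℝ (Function.uncurry f)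
      (closedDomain T) p (1, 0)) (closedDomain T) (x, t) (1, 0),
    fun x t => fderivWithin ℝ (Function.uncurry f) (closedDomain T) (x, t) (0, 1),
    hf.continuousOn, (hDx _).continuousOn, ?_, (hDx _).continuousOn,
    hsec (hf.differentiableOn (by norm_num)), hsec ((hDx _).differentiableOn (by norm_num)), ?_⟩
  · exact (hD2.clm_apply contDiffOn_const).continuousOn
  · intro x t hxt
    have h1 : HasDerivWithinAt (fun τ : ℝ => (x, τ)) ((0 : ℝ), (1 : ℝ)) (Icc 0 T) t :=
      (hasDerivWithinAt_const t _ x).prodMk (hasDerivWithinAt_id t _)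
    exact ((hf.differentiableOn (by norm_num)) (x, t) hxt).hasFDerivWithinAt.comp_hasDerivWithinAt
      t h1 fun y hy => ⟨hxt.1, hy⟩

namespace HasPartials

variable {T : ℝ} {f fx fxx ft : ℝ → ℝ → ℂ} {x t : ℝ}

theorem dx_eq (h : HasPartials T f fx fxx ft) (hxt : (x, t) ∈ closedDomain T) :
    dx f x t = fx x t :=
  (h.deriv_x x t hxt).derivWithin (uniqueDiffOn_Ici 0 x hxt.1)

theorem hasDerivAt_x (h : HasPartials T f fx fxx ft) (hx : 0 < x) (ht : t ∈ Icc 0 T) :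
    HasDerivAt (fun y => f y t) (fx x t) x :=
  (h.deriv_x x t ⟨hx.le, ht⟩).hasDerivAt (Ici_mem_nhds hx)

theorem hasDerivAt_xx (h : HasPartials T f fx fxx ft) (hx : 0 < x) (ht : t ∈ Icc 0 T) :
    HasDerivAt (fun y => fx y t) (fxx x t) x :=
  (h.deriv_xx x t ⟨hx.le, ht⟩).hasDerivAt (Ici_mem_nhds hx)

theorem hasDerivAt_dx (h : HasPartials T f fx fxx ft) (hx : 0 < x) (ht : t ∈ Icc 0 T) :
    HasDerivAt (fun y => dx f y t) (fxx x t) x := by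
  refine (h.hasDerivAt_xx hx ht).congr_of_eventuallyEq ?_
  filter_upwards [Ioi_mem_nhds hx] with y hy
  exact h.dx_eq (closedDomain_mk (le_of_lt hy) ht)

theorem hasDerivAt_t (h : HasPartials T f fx fxx ft) (hx : 0 ≤ x) (ht : 0 < t) (htT : t < T) :
    HasDerivAt (fun τ => f x τ) (ft x t) t :=
  (h.deriv_t x t ⟨hx, ht.le, htT.le⟩).hasDerivAt (Icc_mem_nhds ht htT)

theorem iteratedDeriv_one (h : HasPartials T f fx fxx ft) (hx : 0 < x) (ht : t ∈ Icc 0 T) :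
    iteratedDeriv 1 (fun y => f y t) x = fx x t := by
  rw [_root_.iteratedDeriv_one, (h.hasDerivAt_x hx ht).deriv]

theorem iteratedDeriv_two (h : HasPartials T f fx fxx ft) (hx : 0 < x) (ht : t ∈ Icc 0 T) :
    iteratedDeriv 2 (fun y => f y t) x = fxx x t := by
  rw [iteratedDeriv_succ, ← (h.hasDerivAt_xx hx ht).deriv]
  refine EventuallyEq.deriv_eq ?_
  filter_upwards [Ioi_mem_nhds hx] with y hy
  exact h.iteratedDeriv_one hy ht

end HasPartials

theorem norm_le_of_forall_Ioo {T : ℝ} (hT : 0 < T) {F : ℝ → ℝ → ℂ}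
    (hF : ContinuousOn (Function.uncurry F) (closedDomain T)) {x c : ℝ} (hx : 0 ≤ x)
    (h : ∀ t, 0 < t → t < T → ‖F x t‖ ≤ c) : ∀ t ∈ Icc 0 T, ‖F x t‖ ≤ c := by
  intro t ht
  rw [← closure_Ioo hT.ne] at ht
  refine le_on_closure (f := fun t => ‖F x t‖) (g := fun _ => c) (fun s hs => h s hs.1 hs.2) ?_
    continuousOn_const ht
  rw [closure_Ioo hT.ne]
  exact (continuousOn_section_t hF hx).norm

/-- If `f` and `f'` have a common integrable majorant, `f` tends to zero and is the integral of
`-f'` over the tail. Applied to `q`, `q_x`, `r`, `r_x`, this turns the integrable majorant into the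
pointwise decay of `V₂`; the bounds on the second derivatives enter here. -/
theorem norm_le_integral_Ioi {f f' : ℝ → ℂ} {g : ℝ → ℝ} (hg : IntegrableOn g (Ioi 0))
    (hd : ∀ x, 0 < x → HasDerivAt f (f' x) x) (hf' : ContinuousOn f' (Ioi 0))
    (h : ∀ x, 0 < x → ‖f x‖ ≤ g x) (h' : ∀ x, 0 < x → ‖f' x‖ ≤ g x) {x : ℝ} (hx : 0 < x) :
    ‖f x‖ ≤ ∫ y in Ioi x, g y := by
  have hsub : Ioi x ⊆ Ioi 0 := Ioi_subset_Ioi hx.le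
  have hgx := hg.mono_set hsub
  have hint : ∀ {F : ℝ → ℂ}, ContinuousOn F (Ioi 0) → (∀ x, 0 < x → ‖F x‖ ≤ g x) →
      IntegrableOn F (Ioi x) := fun hF hFg =>
    Integrable.mono' hgx ((hF.mono hsub).aestronglyMeasurable measurableSet_Ioi)
      ((ae_restrict_iff' measurableSet_Ioi).2 (Eventually.of_forall fun y hy => hFg y (hsub hy)))
  have hfc : ContinuousOn f (Ioi 0) := fun y hy => (hd y hy).continuousAt.continuousWithinAt
  have hz := tendsto_zero_of_hasDerivAt_of_integrableOn_Ioi (a := x)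
    (fun y hy => hd y (hsub hy)) (hint hf' h') (hint hfc h)
  have := integral_Ioi_of_hasDerivAt_of_tendsto (hd x hx).continuousAt.continuousWithinAt
    (fun y hy => hd y (hsub hy)) (hint hf' h') hz
  rw [zero_sub, ← neg_eq_iff_eq_neg] at this
  rw [← this, norm_neg]
  exact norm_integral_le_of_norm_le hgx
    ((ae_restrict_iff' measurableSet_Ioi).2 (Eventually.of_forall fun y hy => h' y (hsub hy)))

/-! ### Explicit form and zero curvature of the Lax matrices. -/

section Matrices

variable {q r : ℝ → ℝ → ℂ} {k : ℂ} {x t m : ℝ}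

theorem norm_V1_le (hm : 0 ≤ m) (hq : ‖q x t‖ ≤ m) (hr : ‖r x t‖ ≤ m) :
    ∀ i j, ‖V1 q r x t i j‖ ≤ m := by
  refine forall_entries ?_ ?_ ?_ ?_ ?_ ?_ ?_ ?_ ?_ <;> simpa [V1]

theorem norm_V2_entry_le {α u v w : ℂ} (hα : ‖α‖ = 1) (hu : ‖u‖ ≤ m) (hv : ‖v‖ ≤ m)
    (hw : ‖w‖ ≤ m) :
    ‖k * (α * u) + (Complex.I / ((√3 : ℝ) : ℂ) * v - w ^ 2)‖ ≤ ‖k‖ * m + (m + m ^ 2) := by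
  have h1 : ‖k * (α * u)‖ ≤ ‖k‖ * m := by
    rw [norm_mul, norm_mul, hα, one_mul]
    gcongr
  have h2 : ‖Complex.I / ((√3 : ℝ) : ℂ) * v‖ ≤ m := by
    rw [norm_mul]
    exact (mul_le_of_le_one_left (norm_nonneg _) norm_I_div_sqrt_three).trans hv
  have h3 : ‖w ^ 2‖ ≤ m ^ 2 := by
    rw [norm_pow]; gcongr
  exact (norm_add_le _ _).trans (add_le_add h1 ((norm_sub_le _ _).trans (add_le_add h2 h3)))

theorem V2_apply : V2 q r k x t = !![0,
      k * (omega * q x t) + (Complex.I / ((√3 : ℝ) : ℂ) * dx q x t - r x t ^ 2),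
      k * (omega ^ 2 * r x t) + (Complex.I / ((√3 : ℝ) : ℂ) * -dx r x t - q x t ^ 2);
      k * (omega * r x t) + (Complex.I / ((√3 : ℝ) : ℂ) * -dx r x t - q x t ^ 2), 0,
      k * (1 * q x t) + (Complex.I / ((√3 : ℝ) : ℂ) * dx q x t - r x t ^ 2);
      k * (omega ^ 2 * q x t) + (Complex.I / ((√3 : ℝ) : ℂ) * dx q x t - r x t ^ 2),
      k * (1 * r x t) + (Complex.I / ((√3 : ℝ) : ℂ) * -dx r x t - q x t ^ 2), 0] := by
  ext i j
  fin_cases i <;> fin_cases j <;> simp [V2, V21, V20]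

theorem norm_V2_le (hm : 0 ≤ m) (hq : ‖q x t‖ ≤ m) (hr : ‖r x t‖ ≤ m) (hqx : ‖dx q x t‖ ≤ m)
    (hrx : ‖dx r x t‖ ≤ m) : ∀ i j, ‖V2 q r k x t i j‖ ≤ ‖k‖ * m + (m + m ^ 2) := by
  have h2 : ‖omega ^ 2‖ = 1 := by rw [norm_pow, norm_omega, one_pow]
  have hrx' : ‖-dx r x t‖ ≤ m := by rwa [norm_neg]
  rw [V2_apply]
  refine forall_entries ?_ (norm_V2_entry_le norm_omega hq hqx hr)
    (norm_V2_entry_le h2 hr hrx' hq) (norm_V2_entry_le norm_omega hr hrx' hq) ?_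
    (norm_V2_entry_le norm_one hq hqx hr) (norm_V2_entry_le h2 hq hqx hr)
    (norm_V2_entry_le norm_one hr hrx' hq) ?_ <;>
  · simp; positivity

end Matrices

/-- Here `u` and `v` stand for `q_t` and `r_t`. By the evolution equations they are also the entries
of the `k`-free part of `∂_x V₂`, so these terms cancel, and the commutator must equal the
`k`-linear part of `∂_x V₂`. This is an algebraic identity modulo the relation for `ω`. -/
theorem zero_curvature_identity {ω k q r qx rx u v : ℂ} (hω : ω ^ 2 = -1 - ω) :
    !![0, k * (ω * qx) + u, k * (ω ^ 2 * rx) + v;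
       k * (ω * rx) + v, 0, k * (1 * qx) + u;
       k * (ω ^ 2 * qx) + u, k * (1 * rx) + v, 0] =
    !![0, u, v; v, 0, u; u, v, 0] +
      ((!![k * 1, 0, 0; 0, k * ω ^ 2, 0; 0, 0, k * ω] +
          !![0, q, r; r, 0, q; q, r, 0]) *
        (!![-(k ^ 2 * 1 ^ 2), 0, 0; 0, -(k ^ 2 * (ω ^ 2) ^ 2), 0;
          0, 0, -(k ^ 2 * ω ^ 2)] +
        !![0, k * (ω * q) + ((1 + 2 * ω) / 3 * qx - r ^ 2),
            k * (ω ^ 2 * r) + ((1 + 2 * ω) / 3 * -rx - q ^ 2);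
          k * (ω * r) + ((1 + 2 * ω) / 3 * -rx - q ^ 2), 0,
            k * (1 * q) + ((1 + 2 * ω) / 3 * qx - r ^ 2);
          k * (ω ^ 2 * q) + ((1 + 2 * ω) / 3 * qx - r ^ 2),
            k * (1 * r) + ((1 + 2 * ω) / 3 * -rx - q ^ 2), 0]) -
      (!![-(k ^ 2 * 1 ^ 2), 0, 0; 0, -(k ^ 2 * (ω ^ 2) ^ 2), 0;
          0, 0, -(k ^ 2 * ω ^ 2)] +
        !![0, k * (ω * q) + ((1 + 2 * ω) / 3 * qx - r ^ 2),
            k * (ω ^ 2 * r) + ((1 + 2 * ω) / 3 * -rx - q ^ 2);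
          k * (ω * r) + ((1 + 2 * ω) / 3 * -rx - q ^ 2), 0,
            k * (1 * q) + ((1 + 2 * ω) / 3 * qx - r ^ 2);
          k * (ω ^ 2 * q) + ((1 + 2 * ω) / 3 * qx - r ^ 2),
            k * (1 * r) + ((1 + 2 * ω) / 3 * -rx - q ^ 2), 0]) *
        (!![k * 1, 0, 0; 0, k * ω ^ 2, 0; 0, 0, k * ω] +
          !![0, q, r; r, 0, q; q, r, 0])) := by
  ext i j
  fin_cases i <;> fin_cases j <;>
    simp only [Matrix.add_apply, Matrix.sub_apply, Matrix.mul_apply, Fin.sum_univ_three,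
      Matrix.of_apply, Matrix.cons_val', Matrix.cons_val, Fin.zero_eta, Fin.mk_one,
      Fin.reduceFinMk] <;> grind

theorem IsSolution.laxFamily {T : ℝ} (hT : 0 < T) {q r : ℝ → ℝ → ℂ} (h : IsSolution T q r) :
    LaxFamily T l z (V1 q r) (V2 q r) := by
  obtain ⟨qx, qxx, qt, hq⟩ := exists_hasPartials hT h.smooth_q
  obtain ⟨rx, rxx, rt, hr⟩ := exists_hasPartials hT h.smooth_r
  obtain ⟨g, hg, hgle⟩ := h.decay
  have hJ1 : ∑ i, J i = 0 := by
    simp only [Fin.sum_univ_three, J, Matrix.cons_val, omega_sq]; ring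
  have hJ2 : ∑ i, J i ^ 2 = 0 := by
    simp only [Fin.sum_univ_three, J, Matrix.cons_val]
    linear_combination (omega ^ 2 - omega + 1) * omega_sq
  have hle : ∀ x t, 0 < x → t ∈ Icc 0 T → ‖q x t‖ ≤ g x ∧ ‖qx x t‖ ≤ g x ∧ ‖qxx x t‖ ≤ g x ∧
      ‖r x t‖ ≤ g x ∧ ‖rx x t‖ ≤ g x ∧ ‖rxx x t‖ ≤ g x := by
    intro x t hx ht
    refine ⟨norm_le_of_forall_Ioo hT hq.continuousOn hx.le (fun s h0 hs => ?_) t ht,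
      norm_le_of_forall_Ioo hT hq.continuousOn_x hx.le (fun s h0 hs => ?_) t ht,
      norm_le_of_forall_Ioo hT hq.continuousOn_xx hx.le (fun s h0 hs => ?_) t ht,
      norm_le_of_forall_Ioo hT hr.continuousOn hx.le (fun s h0 hs => ?_) t ht,
      norm_le_of_forall_Ioo hT hr.continuousOn_x hx.le (fun s h0 hs => ?_) t ht,
      norm_le_of_forall_Ioo hT hr.continuousOn_xx hx.le (fun s h0 hs => ?_) t ht⟩
    · simpa using (hgle x s hx h0 hs 0 (by norm_num)).1
    · simpa only [hq.iteratedDeriv_one hx ⟨h0.le, hs.le⟩] using (hgle x s hx h0 hs 1 (by norm_num)).1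
    · simpa only [hq.iteratedDeriv_two hx ⟨h0.le, hs.le⟩] using (hgle x s hx h0 hs 2 le_rfl).1
    · simpa using (hgle x s hx h0 hs 0 (by norm_num)).2
    · simpa only [hr.iteratedDeriv_one hx ⟨h0.le, hs.le⟩] using (hgle x s hx h0 hs 1 (by norm_num)).2
    · simpa only [hr.iteratedDeriv_two hx ⟨h0.le, hs.le⟩] using (hgle x s hx h0 hs 2 le_rfl).2
  have hcdx : ∀ {f fx fxx ft : ℝ → ℝ → ℂ}, HasPartials T f fx fxx ft →
      ContinuousOn (fun p : ℂ × ℝ × ℝ => dx f p.2.1 p.2.2) (univ ×ˢ closedDomain T) := by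
    intro f fx fxx ft hf
    have : ContinuousOn (fun p : ℝ × ℝ => dx f p.1 p.2) (closedDomain T) :=
      hf.continuousOn_x.congr fun p hp => hf.dx_eq hp
    exact this.comp (by fun_prop) fun p hp => hp.2
  have hcf : ∀ {f : ℝ → ℝ → ℂ}, ContinuousOn (Function.uncurry f) (closedDomain T) →
      ContinuousOn (fun p : ℂ × ℝ × ℝ => f p.2.1 p.2.2) (univ ×ˢ closedDomain T) :=
    fun hf => hf.comp (f := fun p : ℂ × ℝ × ℝ => p.2) (by fun_prop) fun p hp => hp.2
  have hcentry : ∀ (α : ℂ) {u v w : ℂ × ℝ × ℝ → ℂ}, ContinuousOn u (univ ×ˢ closedDomain T) →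
      ContinuousOn v (univ ×ˢ closedDomain T) → ContinuousOn w (univ ×ˢ closedDomain T) →
      ContinuousOn (fun p : ℂ × ℝ × ℝ => p.1 * (α * u p) +
        (Complex.I / ((√3 : ℝ) : ℂ) * v p - w p ^ 2)) (univ ×ˢ closedDomain T) := by
    intro α u v w hu hv hw
    fun_prop
  refine
    { differentiable_a := fun i => by unfold l; fun_prop
      differentiable_b := fun i => by unfold z; fun_prop
      sum_a := fun k => by simp only [l, ← Finset.mul_sum, hJ1, mul_zero]
      sum_b := fun k => by
        simp only [z, Finset.sum_neg_distrib, ← Finset.mul_sum, hJ2, mul_zero, neg_zero]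
      trace_A := fun x t => by simp [V1, Matrix.trace_fin_three]
      trace_B := fun k x t => by simp [V2_apply, Matrix.trace_fin_three]
      continuousOn_A := ?_
      continuousOn_B := ?_
      differentiable_B := fun x t i j => by
        simp only [V2, Matrix.add_apply, Matrix.smul_apply, smul_eq_mul]
        fun_prop
      zero_curvature := ?_
      decay_A := ⟨g, hg, fun x t hx ht => ?_⟩
      decay_B := ?_ }
  · have hq' : ContinuousOn (fun p : ℝ × ℝ => q p.1 p.2) (closedDomain T) := hq.continuousOn
    have hr' : ContinuousOn (fun p : ℝ × ℝ => r p.1 p.2) (closedDomain T) := hr.continuousOn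
    exact forall_entries continuousOn_const hq' hr' hr' continuousOn_const hq' hq' hr'
      continuousOn_const
  · simp only [V2_apply]
    have hq' := hcf hq.continuousOn
    have hr' := hcf hr.continuousOn
    exact forall_entries continuousOn_const (hcentry _ hq' (hcdx hq) hr')
      (hcentry _ hr' (hcdx hr).neg hq') (hcentry _ hr' (hcdx hr).neg hq') continuousOn_const
      (hcentry _ hq' (hcdx hq) hr') (hcentry _ hq' (hcdx hq) hr')
      (hcentry _ hr' (hcdx hr).neg hq') continuousOn_const
  · intro k
    refine ⟨V1 qt rt, fun x t => !![0,
      k * (omega * qx x t) + (Complex.I / ((√3 : ℝ) : ℂ) * qxx x t - 2 * r x t * rx x t),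
      k * (omega ^ 2 * rx x t) + (Complex.I / ((√3 : ℝ) : ℂ) * -rxx x t - 2 * q x t * qx x t);
      k * (omega * rx x t) + (Complex.I / ((√3 : ℝ) : ℂ) * -rxx x t - 2 * q x t * qx x t), 0,
      k * (1 * qx x t) + (Complex.I / ((√3 : ℝ) : ℂ) * qxx x t - 2 * r x t * rx x t);
      k * (omega ^ 2 * qx x t) + (Complex.I / ((√3 : ℝ) : ℂ) * qxx x t - 2 * r x t * rx x t),
      k * (1 * rx x t) + (Complex.I / ((√3 : ℝ) : ℂ) * -rxx x t - 2 * q x t * qx x t), 0],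
      ?_, ?_, fun x t hx ht htT => ⟨?_, ?_, ?_⟩⟩
    · have hq' : ContinuousOn (fun p : ℝ × ℝ => qt p.1 p.2) (closedDomain T) := hq.continuousOn_t
      have hr' : ContinuousOn (fun p : ℝ × ℝ => rt p.1 p.2) (closedDomain T) := hr.continuousOn_t
      exact forall_entries continuousOn_const hq' hr' hr' continuousOn_const hq' hq' hr'
        continuousOn_const
    · have c1 : ContinuousOn (fun p : ℝ × ℝ => q p.1 p.2) (closedDomain T) := hq.continuousOn
      have c2 : ContinuousOn (fun p : ℝ × ℝ => r p.1 p.2) (closedDomain T) := hr.continuousOn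
      have c3 : ContinuousOn (fun p : ℝ × ℝ => qx p.1 p.2) (closedDomain T) := hq.continuousOn_x
      have c4 : ContinuousOn (fun p : ℝ × ℝ => rx p.1 p.2) (closedDomain T) := hr.continuousOn_x
      have c5 : ContinuousOn (fun p : ℝ × ℝ => qxx p.1 p.2) (closedDomain T) := hq.continuousOn_xx
      have c6 : ContinuousOn (fun p : ℝ × ℝ => rxx p.1 p.2) (closedDomain T) := hr.continuousOn_xx
      have hQ : ∀ α : ℂ, ContinuousOn (fun p : ℝ × ℝ => k * (α * qx p.1 p.2) +
          (Complex.I / ((√3 : ℝ) : ℂ) * qxx p.1 p.2 - 2 * r p.1 p.2 * rx p.1 p.2))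
          (closedDomain T) := fun α => by fun_prop
      have hR : ∀ α : ℂ, ContinuousOn (fun p : ℝ × ℝ => k * (α * rx p.1 p.2) +
          (Complex.I / ((√3 : ℝ) : ℂ) * -rxx p.1 p.2 - 2 * q p.1 p.2 * qx p.1 p.2))
          (closedDomain T) := fun α => by fun_prop
      exact forall_entries continuousOn_const (hQ _) (hR _) (hR _) continuousOn_const (hQ _)
        (hQ _) (hR _) continuousOn_const
    · have hq' := hq.hasDerivAt_t hx.le ht htT
      have hr' := hr.hasDerivAt_t hx.le ht htT
      exact forall_entries (hasDerivAt_const _ _) hq' hr' hr' (hasDerivAt_const _ _) hq' hq' hr'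
        (hasDerivAt_const _ _)
    · have ht' : t ∈ Icc 0 T := ⟨ht.le, htT.le⟩
      have hQ : ∀ α : ℂ, HasDerivAt (fun y => k * (α * q y t) +
          (Complex.I / ((√3 : ℝ) : ℂ) * dx q y t - r y t ^ 2)) (k * (α * qx x t) +
          (Complex.I / ((√3 : ℝ) : ℂ) * qxx x t - 2 * r x t * rx x t)) x := fun α => by
        refine (((hq.hasDerivAt_x hx ht').const_mul α).const_mul k).add
          (((hq.hasDerivAt_dx hx ht').const_mul _).sub ?_)
        exact ((hr.hasDerivAt_x hx ht').pow 2).congr_deriv (by push_cast; ring)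
      have hR : ∀ α : ℂ, HasDerivAt (fun y => k * (α * r y t) +
          (Complex.I / ((√3 : ℝ) : ℂ) * -dx r y t - q y t ^ 2)) (k * (α * rx x t) +
          (Complex.I / ((√3 : ℝ) : ℂ) * -rxx x t - 2 * q x t * qx x t)) x := fun α => by
        refine (((hr.hasDerivAt_x hx ht').const_mul α).const_mul k).add
          (((hr.hasDerivAt_dx hx ht').neg.const_mul _).sub ?_)
        exact ((hq.hasDerivAt_x hx ht').pow 2).congr_deriv (by push_cast; ring)
      simp only [V2_apply]
      exact forall_entries (hasDerivAt_const _ _) (hQ _) (hR _) (hR _) (hasDerivAt_const _ _)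
        (hQ _) (hQ _) (hR _) (hasDerivAt_const _ _)
    · have ht' : t ∈ Icc 0 T := ⟨ht.le, htT.le⟩
      have hxt : (x, t) ∈ closedDomain T := ⟨hx.le, ht'⟩
      have e1 := h.eq_q x t hx ht htT
      have e2 := h.eq_r x t hx ht htT
      rw [(hq.hasDerivAt_t hx.le ht htT).deriv, hq.iteratedDeriv_two hx ht',
        (hr.hasDerivAt_x hx ht').deriv] at e1
      rw [(hr.hasDerivAt_t hx.le ht htT).deriv, hr.iteratedDeriv_two hx ht',
        (hq.hasDerivAt_x hx ht').deriv] at e2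
      have e1' : qt x t = Complex.I / ((√3 : ℝ) : ℂ) * qxx x t - 2 * r x t * rx x t := by
        linear_combination (-Complex.I) * e1 + (qt x t + 2 * r x t * rx x t) * Complex.I_sq
      have e2' : rt x t = -(Complex.I / ((√3 : ℝ) : ℂ) * rxx x t) - 2 * q x t * qx x t := by
        linear_combination (-Complex.I) * e2 + (rt x t + 2 * q x t * qx x t) * Complex.I_sq
      have hl : Matrix.diagonal (l k) =
          !![k * 1, 0, 0; 0, k * omega ^ 2, 0; 0, 0, k * omega] := by
        ext i j
        fin_cases i <;> fin_cases j <;> simp [l, J]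
      have hz : Matrix.diagonal (z k) = !![-(k ^ 2 * 1 ^ 2), 0, 0;
          0, -(k ^ 2 * (omega ^ 2) ^ 2), 0; 0, 0, -(k ^ 2 * omega ^ 2)] := by
        ext i j
        fin_cases i <;> fin_cases j <;> simp [z, J]
      rw [V2_apply, hq.dx_eq hxt, hr.dx_eq hxt, V1, V1, e1', e2', ← mul_neg, hl, hz,
        I_div_sqrt_three]
      exact zero_curvature_identity omega_sq
  · obtain ⟨h1, _, _, h2, _, _⟩ := hle x t hx ht
    exact norm_V1_le ((norm_nonneg _).trans h1) h1 h2
  · intro k ε hε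
    have hlim : Tendsto (fun x => ‖k‖ * (∫ y in Ioi x, g y) + ((∫ y in Ioi x, g y) +
        (∫ y in Ioi x, g y) ^ 2)) atTop (𝓝 0) := by
      have := tendsto_integral_Ioi_zero hg
      simpa using (this.const_mul ‖k‖).add (this.add (this.pow 2))
    obtain ⟨X, hX⟩ := eventually_atTop.1 (hlim.eventually (gt_mem_nhds hε))
    refine ⟨max X 1, fun x t hx ht i j => ?_⟩
    have hx0 : 0 < x := zero_lt_one.trans_le ((le_max_right _ _).trans hx)
    refine le_trans ?_ (hX x ((le_max_left _ _).trans hx)).le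
    have hxt : (x, t) ∈ closedDomain T := ⟨hx0.le, ht⟩
    have cx : ∀ {F : ℝ → ℝ → ℂ}, ContinuousOn (Function.uncurry F) (closedDomain T) →
        ContinuousOn (fun x => F x t) (Ioi 0) := fun hF =>
      (continuousOn_section_x hF ht).mono Ioi_subset_Ici_self
    have b1 := norm_le_integral_Ioi hg (fun x hx => hq.hasDerivAt_x hx ht) (cx hq.continuousOn_x)
      (fun x hx => (hle x t hx ht).1) (fun x hx => (hle x t hx ht).2.1) hx0
    have b2 := norm_le_integral_Ioi hg (fun x hx => hq.hasDerivAt_xx hx ht) (cx hq.continuousOn_xx)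
      (fun x hx => (hle x t hx ht).2.1) (fun x hx => (hle x t hx ht).2.2.1) hx0
    have b3 := norm_le_integral_Ioi hg (fun x hx => hr.hasDerivAt_x hx ht) (cx hr.continuousOn_x)
      (fun x hx => (hle x t hx ht).2.2.2.1) (fun x hx => (hle x t hx ht).2.2.2.2.1) hx0
    have b4 := norm_le_integral_Ioi hg (fun x hx => hr.hasDerivAt_xx hx ht) (cx hr.continuousOn_xx)
      (fun x hx => (hle x t hx ht).2.2.2.2.1) (fun x hx => (hle x t hx ht).2.2.2.2.2) hx0
    refine norm_V2_le ((norm_nonneg _).trans b1) b1 b3 ?_ ?_ i j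
    · rwa [hq.dx_eq hxt]
    · rwa [hr.dx_eq hxt]

end

section

/-! ### Columns of the eigenfunctions in terms of the fundamental matrix -/

/-- The solution, normalized as a `j`-th column, with value `v` at the origin. -/
def columnSolution (a b : ℂ → Fin 3 → ℂ) (Φ : ℂ → ℝ → ℝ → Matrix (Fin 3) (Fin 3) ℂ) (k : ℂ)
    (j : Fin 3) (v : Fin 3 → ℂ) (x t : ℝ) : Fin 3 → ℂ :=
  Complex.exp (-(a k j * x + b k j * t)) • (Φ k x t).mulVec v

/-- `σ(k)` is the value at the origin of the bounded solution, normalized as a `j`-th column, that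
tends to the `j`-th basis vector as `x → ∞`. -/
structure IsJost (T : ℝ) (a b : ℂ → Fin 3 → ℂ) (Φ : ℂ → ℝ → ℝ → Matrix (Fin 3) (Fin 3) ℂ)
    (j : Fin 3) (σ : ℂ → Fin 3 → ℂ) : Prop where
  bounded : ∀ k, (∀ i, (a k j).re ≤ (a k i).re) →
    IsBoundedColumn T (columnSolution a b Φ k j (σ k))
  tendsto : ∀ k, (∀ i, (a k j).re ≤ (a k i).re) → ∀ t ∈ Icc 0 T,
    Tendsto (fun x => columnSolution a b Φ k j (σ k) x t) atTop (𝓝 (Pi.single j 1))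
  differentiableOn : ∀ U, IsOpen U → (∀ k ∈ U, ∀ i, (a k j).re ≤ (a k i).re) →
    DifferentiableOn ℂ σ U

variable {T : ℝ} {a b : ℂ → Fin 3 → ℂ} {A : ℝ → ℝ → Matrix (Fin 3) (Fin 3) ℂ}
  {B : ℂ → ℝ → ℝ → Matrix (Fin 3) (Fin 3) ℂ} {Φ Ψ : ℂ → ℝ → ℝ → Matrix (Fin 3) (Fin 3) ℂ}
  {k : ℂ} {j : Fin 3} {σ : ℂ → Fin 3 → ℂ} {w : ℝ → ℝ → Fin 3 → ℂ} {v : Fin 3 → ℂ}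

theorem LaxFamily.exists_isJost (hT : 0 < T) (h : LaxFamily T a b A B)
    (hΦ : IsFundamentalPair T a b A B Φ Ψ) (j : Fin 3) : ∃ σ, IsJost T a b Φ j σ := by
  obtain ⟨σ, h1, h2⟩ := h.exists_jost hT hΦ j
  exact ⟨σ, fun k hk => (h1 k hk).1, fun k hk => (h1 k hk).2, h2⟩

theorem IsFundamentalPair.isLaxSolution_columnSolution (hΦ : IsFundamentalPair T a b A B Φ Ψ)
    (v : Fin 3 → ℂ) :
    IsLaxSolution T (a k) (b k) A (B k) (a k j) (b k j) (columnSolution a b Φ k j v) :=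
  hΦ.isLaxSolution _ _ _

theorem IsFundamentalPair.columnSolution_zero (hΦ : IsFundamentalPair T a b A B Φ Ψ) :
    columnSolution a b Φ k j v 0 0 = v := by
  simp [columnSolution, hΦ.primal.apply_zero]

theorem IsFundamentalPair.eq_columnSolution (hΦ : IsFundamentalPair T a b A B Φ Ψ)
    (hw : IsLaxSolution T (a k) (b k) A (B k) (a k j) (b k j) w) {x t : ℝ}
    (hxt : (x, t) ∈ closedDomain T) : w x t = columnSolution a b Φ k j (w 0 0) x t :=
  hΦ.eq_mulVec hw hxt

theorem columnSolution_smul (c : ℂ) (x t : ℝ) :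
    columnSolution a b Φ k j (c • v) x t = c • columnSolution a b Φ k j v x t := by
  rw [columnSolution, columnSolution, Matrix.mulVec_smul, smul_comm]

theorem columnSolution_add (v v' : Fin 3 → ℂ) (x t : ℝ) :
    columnSolution a b Φ k j (v + v') x t =
      columnSolution a b Φ k j v x t + columnSolution a b Φ k j v' x t := by
  rw [columnSolution, columnSolution, columnSolution, Matrix.mulVec_add, smul_add]

/-- The same vector at the origin, normalized as two different columns, yields solutions differing
by a scalar exponential. This is the source of the factors `exp(θ_ij)` in the residues. -/
theorem columnSolution_eq_exp_smul (i j : Fin 3) (x t : ℝ) :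
    columnSolution a b Φ k j v x t = Complex.exp ((a k i - a k j) * x + (b k i - b k j) * t) •
      columnSolution a b Φ k i v x t := by
  rw [columnSolution, columnSolution, smul_smul, ← Complex.exp_add]
  congr 2
  ring

theorem differentiable_columnSolution (h : LaxFamily T a b A B)
    (hΦ : IsFundamentalPair T a b A B Φ Ψ) {V : ℂ → Fin 3 → ℂ} {U : Set ℂ}
    (hV : DifferentiableOn ℂ V U) (x t : ℝ) :
    DifferentiableOn ℂ (fun k => columnSolution a b Φ k j (V k) x t) U := by
  have ha := h.differentiable_a j
  have hb := h.differentiable_b j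
  refine DifferentiableOn.fun_smul
    (((ha.mul_const _).add (hb.mul_const _)).neg.cexp).differentiableOn ?_
  refine differentiableOn_pi.2 fun i => ?_
  simp only [Matrix.mulVec, dotProduct, Fin.sum_univ_three]
  have hV' : ∀ i, DifferentiableOn ℂ (fun k => V k i) U := differentiableOn_pi.1 hV
  exact ((((hΦ.primal.differentiable x t i 0).differentiableOn).mul (hV' 0)).add
    (((hΦ.primal.differentiable x t i 1).differentiableOn).mul (hV' 1))).add
    (((hΦ.primal.differentiable x t i 2).differentiableOn).mul (hV' 2))

theorem le_of_ne_imp_lt {f : Fin 3 → ℝ} {j : Fin 3} (h : ∀ i, i ≠ j → f j < f i) (i : Fin 3) :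
    f j ≤ f i := by
  by_cases hij : i = j
  · subst hij; rfl
  · exact (h i hij).le

/-- The difference of two candidates is a bounded solution whose `j`-th entry tends to zero. The
strict gap forces its other entries to zero as well, so it vanishes at the origin. -/
theorem IsJost.apply_zero_eq (hT : 0 < T) (h : LaxFamily T a b A B)
    (hΦ : IsFundamentalPair T a b A B Φ Ψ) (hσ : IsJost T a b Φ j σ)
    (hre : ∀ i, i ≠ j → (a k j).re < (a k i).re)
    (hw : IsLaxSolution T (a k) (b k) A (B k) (a k j) (b k j) w) (hb : IsBoundedColumn T w)
    (hlim : Tendsto (fun x => w x 0 j) atTop (𝓝 1)) : w 0 0 = σ k := by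
  obtain ⟨G, hG⟩ := h.decay_A
  have hre' := le_of_ne_imp_lt (f := fun i => (a k i).re) hre
  obtain ⟨C, hC⟩ := hb
  obtain ⟨C', hC'⟩ := hσ.bounded k hre'
  have hd := hw.sub (hΦ.isLaxSolution_columnSolution (σ k))
  have h0 := hd.eq_zero_of_tendsto hT.le h.continuousOn_A hG
    ⟨C + C', fun x t hxt i => (norm_sub_le _ _).trans (add_le_add (hC x t hxt i) (hC' x t hxt i))⟩
    hre (by
      have h1 := tendsto_pi_nhds.1 (hσ.tendsto k hre' 0 ⟨le_rfl, hT.le⟩) j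
      rw [Pi.single_eq_same] at h1
      simpa using hlim.sub h1)
  rwa [hΦ.columnSolution_zero, sub_eq_zero] at h0

theorem IsJost.isEigencolumn (hT : 0 < T) (h : LaxFamily T a b A B)
    (hΦ : IsFundamentalPair T a b A B Φ Ψ) (hσ : IsJost T a b Φ j σ)
    (hre : ∀ i, i ≠ j → (a k j).re < (a k i).re) :
    IsEigencolumn T (a k) (b k) A (B k) (fun _ => .γ₃) j (columnSolution a b Φ k j (σ k)) := by
  obtain ⟨G, hG⟩ := h.decay_A
  have hre' := le_of_ne_imp_lt (f := fun i => (a k i).re) hre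
  refine (isEigencolumn_iff hT.le h.continuousOn_A (h.continuousOn_B' k) hG
    fun i _ => ⟨hσ.bounded k hre', hre i⟩).2 ⟨hΦ.isLaxSolution_columnSolution _, by simp, by simp,
    fun _ t ht => ?_⟩
  have h1 := tendsto_pi_nhds.1 (hσ.tendsto k hre' t ht) j
  rwa [Pi.single_eq_same] at h1

/-- Existence makes the choice operator select a genuine solution, and uniqueness fixes the value of
any such solution at the origin; this identifies `s` and `s^A` with the holomorphic Jost vectors. -/
theorem IsJost.epsilon_apply_zero (hT : 0 < T) (h : LaxFamily T a b A B)
    (hΦ : IsFundamentalPair T a b A B Φ Ψ) (hσ : IsJost T a b Φ j σ)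
    (hre : ∀ i, i ≠ j → (a k j).re < (a k i).re) :
    Classical.epsilon (fun w : ℝ → ℝ → Fin 3 → ℂ =>
      IsEigencolumn T (a k) (b k) A (B k) (fun _ => .γ₃) j w ∧ IsBoundedColumn T w) 0 0 = σ k := by
  obtain ⟨G, hG⟩ := h.decay_A
  have hre' := le_of_ne_imp_lt (f := fun i => (a k i).re) hre
  obtain ⟨h1, h2⟩ := Classical.epsilon_spec (p := fun w : ℝ → ℝ → Fin 3 → ℂ =>
    IsEigencolumn T (a k) (b k) A (B k) (fun _ => .γ₃) j w ∧ IsBoundedColumn T w)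
    ⟨_, hσ.isEigencolumn hT h hΦ hre, hσ.bounded k hre'⟩
  obtain ⟨h3, _, _, h4⟩ := (isEigencolumn_iff hT.le h.continuousOn_A (h.continuousOn_B' k) hG
    fun i _ => ⟨h2, hre i⟩).1 h1
  exact hσ.apply_zero_eq hT h hΦ hre h3 h2 (h4 rfl 0 ⟨le_rfl, hT.le⟩)

/-- The value at the origin of the `j`-th column normalized at `(0,T)`. -/
def endValue (T : ℝ) (b : ℂ → Fin 3 → ℂ) (Ψ : ℂ → ℝ → ℝ → Matrix (Fin 3) (Fin 3) ℂ) (k : ℂ)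
    (j : Fin 3) : Fin 3 → ℂ :=
  Complex.exp (b k j * T) • (Ψ k 0 T).transpose.mulVec (Pi.single j 1)

theorem columnSolution_endValue (hT : 0 < T) (hΦ : IsFundamentalPair T a b A B Φ Ψ) (i : Fin 3) :
    columnSolution a b Φ k j (endValue T b Ψ k i) 0 T =
      Complex.exp ((b k i - b k j) * T) • Pi.single i 1 := by
  have hm : ((0 : ℝ), T) ∈ closedDomain T := closedDomain_mk le_rfl ⟨hT.le, le_rfl⟩
  rw [columnSolution, endValue, Matrix.mulVec_smul, Matrix.mulVec_mulVec, hΦ.mul_transpose hm,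
    Matrix.one_mulVec, smul_smul, ← Complex.exp_add]
  congr 2
  push_cast
  ring

/-- Expand `w(0,T)` in the standard basis and carry each basis vector back to the origin. The
exponentials adjust for the different column normalizations. -/
theorem IsFundamentalPair.apply_zero_eq_sum (hT : 0 < T) (hΦ : IsFundamentalPair T a b A B Φ Ψ)
    (hw : IsLaxSolution T (a k) (b k) A (B k) (a k j) (b k j) w) :
    w 0 0 = ∑ i, (Complex.exp ((b k j - b k i) * T) * w 0 T i) • endValue T b Ψ k i := by
  have hm : ((0 : ℝ), T) ∈ closedDomain T := closedDomain_mk le_rfl ⟨hT.le, le_rfl⟩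
  rw [hΦ.apply_zero_eq hw hm]
  have : w 0 T = ∑ i, w 0 T i • Pi.single i (1 : ℂ) := by
    simpa using (pi_eq_sum_univ' (w 0 T))
  conv_lhs => rw [this, Matrix.mulVec_sum, Finset.smul_sum]
  refine Finset.sum_congr rfl fun i _ => ?_
  rw [endValue, Matrix.mulVec_smul, smul_smul, smul_smul]
  congr 1
  rw [mul_right_comm, ← Complex.exp_add]
  congr 2
  push_cast
  ring

theorem epsilon_γ₁_apply_zero (hT : 0 < T) (h : LaxFamily T a b A B)
    (hΦ : IsFundamentalPair T a b A B Φ Ψ) (k : ℂ) (j : Fin 3) :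
    Classical.epsilon (IsEigencolumn T (a k) (b k) A (B k) (fun _ => .γ₁) j) 0 0 =
      endValue T b Ψ k j := by
  obtain ⟨G, hG⟩ := h.decay_A
  have hm : ((0 : ℝ), T) ∈ closedDomain T := closedDomain_mk le_rfl ⟨hT.le, le_rfl⟩
  have hiff := fun w : ℝ → ℝ → Fin 3 → ℂ => isEigencolumn_iff (w := w) (j := j)
    (a := a k) (b := b k) (γ := fun _ => .γ₁) hT.le h.continuousOn_A (h.continuousOn_B' k) hG (by simp)
  have hex : ∃ w, IsEigencolumn T (a k) (b k) A (B k) (fun _ => .γ₁) j w := by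
    refine ⟨columnSolution a b Φ k j (endValue T b Ψ k j), (hiff _).2
      ⟨hΦ.isLaxSolution_columnSolution _, fun i _ => ?_, by simp, by simp⟩⟩
    rw [columnSolution_endValue hT hΦ]
    simp [Pi.single_apply]
  obtain ⟨h1, h2, _, _⟩ := (hiff _).1 (Classical.epsilon_spec hex)
  have h3 : Classical.epsilon (IsEigencolumn T (a k) (b k) A (B k) (fun _ => .γ₁) j) 0 T =
      Pi.single j 1 := by
    funext i
    rw [h2 i rfl, Pi.single_apply]
  rw [hΦ.apply_zero_eq h1 hm, h3, endValue]
  simp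

theorem differentiable_endValue (h : LaxFamily T a b A B)
    (hΦ : IsFundamentalPair T a b A B Φ Ψ) (j : Fin 3) :
    Differentiable ℂ fun k => endValue T b Ψ k j := by
  refine (((h.differentiable_b j).mul_const _).cexp).smul ?_
  refine differentiable_pi.2 fun i => ?_
  simp only [Matrix.mulVec_single_one]
  exact hΦ.dual.differentiable 0 T j i

/-! ### Limits of pairings -/

/-- Boundedness of `w` lets `y` be replaced by its limit `e_j` in the constant pairing, which
isolates the `j`-th entry. -/
theorem tendsto_apply_of_dotProduct_eq {y w : ℝ → Fin 3 → ℂ} {j : Fin 3} {C : ℝ} {K : ℂ}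
    (hy : Tendsto y atTop (𝓝 (Pi.single j 1))) (hw : ∀ᶠ x in atTop, ∀ i, ‖w x i‖ ≤ C)
    (hK : ∀ᶠ x in atTop, y x ⬝ᵥ w x = K) : Tendsto (fun x => w x j) atTop (𝓝 K) := by
  have h1 : Tendsto (fun x => (y x - Pi.single j 1) ⬝ᵥ w x) atTop (𝓝 0) := by
    have h2 : ∀ i, Tendsto (fun x => (y x - (Pi.single j 1 : Fin 3 → ℂ)) i * w x i) atTop (𝓝 0) := by
      intro i
      have h3 : Tendsto (fun x => (y x - (Pi.single j 1 : Fin 3 → ℂ)) i) atTop (𝓝 0) := by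
        have := tendsto_pi_nhds.1 (hy.sub_const (Pi.single j 1)) i
        simpa using this
      have h4 : Tendsto (fun x => ‖(y x - (Pi.single j 1 : Fin 3 → ℂ)) i‖ * C) atTop (𝓝 0) := by
        simpa using h3.norm.mul_const C
      refine squeeze_zero_norm' ?_ h4
      filter_upwards [hw] with x hx
      rw [norm_mul]
      exact mul_le_mul_of_nonneg_left (hx i) (norm_nonneg _)
    simpa [dotProduct] using tendsto_finsetSum Finset.univ fun i _ => h2 i
  have h5 := h1.const_sub K
  rw [sub_zero] at h5
  refine h5.congr' ?_
  filter_upwards [hK] with x hx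
  rw [sub_dotProduct, hx, single_one_dotProduct, sub_sub_cancel]

theorem norm_dotProduct_le {y w : Fin 3 → ℂ} {C D : ℝ} (hy : ∀ i, ‖y i‖ ≤ C)
    (hw : ∀ i, ‖w i‖ ≤ D) : ‖y ⬝ᵥ w‖ ≤ 3 * (C * D) := by
  have h0 : 0 ≤ C := (norm_nonneg _).trans (hy 0)
  calc ‖∑ i, y i * w i‖ ≤ ∑ i, ‖y i * w i‖ := norm_sum_le _ _
    _ ≤ ∑ _i : Fin 3, C * D := Finset.sum_le_sum fun i _ => by
        rw [norm_mul]; exact mul_le_mul (hy i) (hw i) (norm_nonneg _) h0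
    _ = 3 * (C * D) := by simp

/-- The pairing of bounded solutions is bounded, yet it equals its value at the origin times an
exponential growing in `x`; that value must be zero. -/
theorem IsLaxSolution.dotProduct_eq_zero (hT : 0 < T) {a b : Fin 3 → ℂ}
    {B : ℝ → ℝ → Matrix (Fin 3) (Fin 3) ℂ} {c d c' d' : ℂ} {y : ℝ → ℝ → Fin 3 → ℂ}
    (hw : IsLaxSolution T a b A B c d w)
    (hy : IsLaxSolution T (fun i => -a i) (fun i => -b i) (fun x t => -(A x t).transpose)
      (fun x t => -(B x t).transpose) c' d' y) (hbw : IsBoundedColumn T w)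
    (hby : IsBoundedColumn T y) (hc : (c + c').re < 0) : y 0 0 ⬝ᵥ w 0 0 = 0 := by
  obtain ⟨C, hC⟩ := hbw
  obtain ⟨D, hD⟩ := hby
  have h1 : Tendsto (fun x : ℝ => Complex.exp (-(c + c') * ((0 : ℝ) - x)) * (y x 0 ⬝ᵥ w x 0)) atTop
      (𝓝 0) := by
    refine tendsto_exp_mul_zero (C := 3 * (D * C)) (by rw [Complex.neg_re]; linarith) ?_
    filter_upwards [eventually_ge_atTop 0] with x hx
    have hm := closedDomain_mk hx ⟨le_rfl, hT.le⟩
    exact norm_dotProduct_le (hD x 0 hm) (hC x 0 hm)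
  refine tendsto_nhds_unique (tendsto_const_nhds.congr' ?_) h1
  filter_upwards [eventually_ge_atTop 0] with x hx
  have hm : (x, (0 : ℝ)) ∈ closedDomain T := closedDomain_mk hx ⟨le_rfl, hT.le⟩
  rw [hw.pairing hy hm, ← mul_assoc, ← Complex.exp_add]
  have : (-(c + c') * ((0 : ℝ) - x) + -((c + c') * x + (d + d') * (0 : ℝ)) : ℂ) = 0 := by
    push_cast
    ring
  rw [this, Complex.exp_zero, one_mul]

end

section

/-! ### The columns of the sectionally analytic eigenfunction -/

/-- A Lax family with fundamental matrices, the Jost vector `σ` of its last column and the Jost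
vector `τ` of the `p`-th column of the adjoint family; `m` is the remaining index. -/
structure IsSpectralData (T : ℝ) (a b : ℂ → Fin 3 → ℂ) (A : ℝ → ℝ → Matrix (Fin 3) (Fin 3) ℂ)
    (B : ℂ → ℝ → ℝ → Matrix (Fin 3) (Fin 3) ℂ) (Φ Ψ : ℂ → ℝ → ℝ → Matrix (Fin 3) (Fin 3) ℂ)
    (p m : Fin 3) (σ τ : ℂ → Fin 3 → ℂ) : Prop where
  pos : 0 < T
  lax : LaxFamily T a b A B
  fund : IsFundamentalPair T a b A B Φ Ψ
  jost : IsJost T a b Φ 2 σ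
  jost_adjoint : IsJost T (fun k i => -a k i) (fun k i => -b k i) Ψ p τ
  indices : p = 0 ∧ m = 1 ∨ p = 1 ∧ m = 0

/-- Up to sign, the cross product of the last basis vector and `y`. -/
def midVector (p : Fin 3) (y : Fin 3 → ℂ) : Fin 3 → ℂ :=
  ![(-1) ^ (1 + (p : ℕ)) * y 1, (-1) ^ (p : ℕ) * y 0, 0]

theorem midVector_eq (p : Fin 3) (y : Fin 3 → ℂ) :
    midVector p y = (-1 : ℂ) ^ (p : ℕ) • crossProduct (Pi.single 2 1) y := by
  funext i
  fin_cases i <;> simp [midVector, crossProduct, pow_add]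

/-- The combination of the columns `p` and `2` of `S` with vanishing last entry. -/
def minorVector (S : Fin 3 → Fin 3 → ℂ) (p : Fin 3) : Fin 3 → ℂ :=
  S 2 2 • S p - S p 2 • S 2

namespace IsSpectralData

variable {T : ℝ} {a b : ℂ → Fin 3 → ℂ} {A : ℝ → ℝ → Matrix (Fin 3) (Fin 3) ℂ}
  {B : ℂ → ℝ → ℝ → Matrix (Fin 3) (Fin 3) ℂ} {Φ Ψ : ℂ → ℝ → ℝ → Matrix (Fin 3) (Fin 3) ℂ}
  {p m : Fin 3} {σ τ : ℂ → Fin 3 → ℂ} {k : ℂ} {w : ℝ → ℝ → Fin 3 → ℂ}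

theorem sum_indices {f : Fin 3 → ℂ} (hD : IsSpectralData T a b A B Φ Ψ p m σ τ)
    (hf : ∑ i, f i = 0) : -f 2 + -f p = f m := by
  rw [Fin.sum_univ_three] at hf
  rcases hD.indices with ⟨rfl, rfl⟩ | ⟨rfl, rfl⟩ <;> linear_combination -hf

theorem forall_index (hD : IsSpectralData T a b A B Φ Ψ p m σ τ) {P : Fin 3 → Prop}
    (h2 : P 2) (hm : P m) (hp : P p) (i : Fin 3) : P i := by
  rcases hD.indices with ⟨rfl, rfl⟩ | ⟨rfl, rfl⟩ <;> fin_cases i <;> assumption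

theorem le_last (hD : IsSpectralData T a b A B Φ Ψ p m σ τ) (h2m : (a k 2).re < (a k m).re)
    (hmp : (a k m).re < (a k p).re) (i : Fin 3) : (a k 2).re ≤ (a k i).re :=
  hD.forall_index (P := fun i => (a k 2).re ≤ (a k i).re) le_rfl h2m.le (h2m.trans hmp).le i

theorem le_first (hD : IsSpectralData T a b A B Φ Ψ p m σ τ) (h2m : (a k 2).re < (a k m).re)
    (hmp : (a k m).re < (a k p).re) (i : Fin 3) : (a k i).re ≤ (a k p).re :=
  hD.forall_index (P := fun i => (a k i).re ≤ (a k p).re) (h2m.trans hmp).le hmp.le le_rfl i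

theorem neg_le_neg_first (hD : IsSpectralData T a b A B Φ Ψ p m σ τ)
    (h2m : (a k 2).re < (a k m).re) (hmp : (a k m).re < (a k p).re) (i : Fin 3) :
    (-a k p).re ≤ (-a k i).re := by
  rw [Complex.neg_re, Complex.neg_re, neg_le_neg_iff]
  exact hD.le_first h2m hmp i

/-- The pairing would grow like `exp((Re a_p - Re a_2) x)`. This orthogonality is used in all the
residue computations. -/
theorem dotProduct_eq_zero (hD : IsSpectralData T a b A B Φ Ψ p m σ τ)
    (h2m : (a k 2).re < (a k m).re) (hmp : (a k m).re < (a k p).re) : τ k ⬝ᵥ σ k = 0 := by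
  have h := (hD.fund.isLaxSolution_columnSolution (k := k) (j := 2) (σ k)).dotProduct_eq_zero
    hD.pos (hD.fund.symm.isLaxSolution_columnSolution (k := k) (j := p) (τ k))
    (hD.jost.bounded k (hD.le_last h2m hmp))
    (hD.jost_adjoint.bounded k (hD.neg_le_neg_first h2m hmp)) (by
      rw [Complex.add_re, Complex.neg_re]; linarith)
  rwa [hD.fund.columnSolution_zero, hD.fund.symm.columnSolution_zero] at h

theorem adjoint_ne_zero (hD : IsSpectralData T a b A B Φ Ψ p m σ τ)
    (h2m : (a k 2).re < (a k m).re) (hmp : (a k m).re < (a k p).re) : τ k ≠ 0 := by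
  intro h0
  have h := tendsto_pi_nhds.1 (hD.jost_adjoint.tendsto k (hD.neg_le_neg_first h2m hmp) 0
    ⟨le_rfl, hD.pos.le⟩) p
  simp [columnSolution, h0] at h

/-- The product of the bounded columns of the adjoint family with indices `2` and `p`. -/
theorem columnSolution_midVector (hD : IsSpectralData T a b A B Φ Ψ p m σ τ) {x t : ℝ}
    (hxt : (x, t) ∈ closedDomain T) :
    columnSolution a b Φ k m (midVector p (τ k)) x t = (-1 : ℂ) ^ (p : ℕ) • crossProduct
      (columnSolution (fun k i => -a k i) (fun k i => -b k i) Ψ k 2 (Pi.single 2 1) x t)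
      (columnSolution (fun k i => -a k i) (fun k i => -b k i) Ψ k p (τ k) x t) := by
  have h1 := IsLaxSolution.cross (hD.lax.sum_a k) (hD.lax.sum_b k) hD.lax.trace_A
    (hD.lax.trace_B k)
    (hD.fund.symm.isLaxSolution_columnSolution (k := k) (j := 2) (Pi.single 2 1))
    (hD.fund.symm.isLaxSolution_columnSolution (k := k) (j := p) (τ k))
  rw [hD.sum_indices (hD.lax.sum_a k), hD.sum_indices (hD.lax.sum_b k)] at h1
  have h2 := hD.fund.eq_columnSolution h1 hxt
  rw [hD.fund.symm.columnSolution_zero, hD.fund.symm.columnSolution_zero] at h2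
  rw [midVector_eq, columnSolution_smul, h2]

theorem isBoundedColumn_last_adjoint (hD : IsSpectralData T a b A B Φ Ψ p m σ τ)
    (h2m : (a k 2).re < (a k m).re) (hmp : (a k m).re < (a k p).re) (v : Fin 3 → ℂ) :
    IsBoundedColumn T (columnSolution (fun k i => -a k i) (fun k i => -b k i) Ψ k 2 v) := by
  obtain ⟨G, hG⟩ := hD.lax.adjoint.decay_A
  refine (hD.fund.symm.isLaxSolution_columnSolution (k := k) (j := 2) v).isBoundedColumn_of_re_le
    hD.pos.le hD.lax.adjoint.continuousOn_A hG fun i => ?_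
  rw [Complex.neg_re, Complex.neg_re, neg_le_neg_iff]
  exact hD.le_last h2m hmp i

/-- By `columnSolution_midVector` it is a cross product of two bounded adjoint solutions: the Jost
one, and the one with index 2, for which every initial value is bounded because `-a_2` has the
largest real part. -/
theorem isBoundedColumn_mid (hD : IsSpectralData T a b A B Φ Ψ p m σ τ)
    (h2m : (a k 2).re < (a k m).re) (hmp : (a k m).re < (a k p).re) :
    IsBoundedColumn T (columnSolution a b Φ k m (midVector p (τ k))) := by
  obtain ⟨C, hC⟩ := hD.isBoundedColumn_last_adjoint h2m hmp (Pi.single 2 1)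
  obtain ⟨D, hD'⟩ := hD.jost_adjoint.bounded k (hD.neg_le_neg_first h2m hmp)
  refine ⟨C * D + C * D, fun x t hxt i => ?_⟩
  rw [hD.columnSolution_midVector hxt, Pi.smul_apply, norm_smul, norm_pow, norm_neg, norm_one,
    one_pow, one_mul]
  have hC0 : 0 ≤ C := (norm_nonneg _).trans (hC x t hxt 0)
  have key : ∀ i j, ‖columnSolution (fun k i => -a k i) (fun k i => -b k i) Ψ k 2 (Pi.single 2 1)
      x t i * columnSolution (fun k i => -a k i) (fun k i => -b k i) Ψ k p (τ k) x t j‖ ≤ C * D :=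
    fun i j => by
      rw [norm_mul]
      exact mul_le_mul (hC x t hxt i) (hD' x t hxt j) (norm_nonneg _) hC0
  rw [cross_apply]
  fin_cases i <;> exact (norm_sub_le _ _).trans (add_le_add (key _ _) (key _ _))

/-- In the cross product, the adjoint Jost factor tends to `e_p`, so the `m`-th entry tends to the
limit of the last entry of the other factor. That limit is `σ₂`, read off from the constant pairing
with the last column, which tends to `e_2`. -/
theorem tendsto_mid (hD : IsSpectralData T a b A B Φ Ψ p m σ τ)
    (h2m : (a k 2).re < (a k m).re) (hmp : (a k m).re < (a k p).re) {t : ℝ} (ht : t ∈ Icc 0 T) :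
    Tendsto (fun x => columnSolution a b Φ k m (midVector p (τ k)) x t m) atTop (𝓝 (σ k 2)) := by
  set ν := columnSolution (fun k i => -a k i) (fun k i => -b k i) Ψ k 2 (Pi.single 2 1) with hν
  set y := columnSolution (fun k i => -a k i) (fun k i => -b k i) Ψ k p (τ k) with hy
  obtain ⟨C, hC⟩ := hD.isBoundedColumn_last_adjoint h2m hmp (Pi.single 2 1)
  have hν2 : Tendsto (fun x => ν x t 2) atTop (𝓝 (σ k 2)) := by
    refine tendsto_apply_of_dotProduct_eq (hD.jost.tendsto k (hD.le_last h2m hmp) t ht)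
      (C := C) ?_ ?_
    · filter_upwards [eventually_ge_atTop 0] with x hx using hC x t (closedDomain_mk hx ht)
    · filter_upwards [eventually_ge_atTop 0] with x hx
      have h1 := (hD.fund.isLaxSolution_columnSolution (k := k) (j := 2) (σ k)).pairing
        (hD.fund.symm.isLaxSolution_columnSolution (k := k) (j := 2) (Pi.single 2 1))
        (closedDomain_mk hx ht)
      rw [hD.fund.columnSolution_zero, hD.fund.symm.columnSolution_zero] at h1
      rw [dotProduct_comm, h1]
      simp
  have hyl := tendsto_pi_nhds.1
    (hD.jost_adjoint.tendsto k (hD.neg_le_neg_first h2m hmp) t ht)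
  have hν' : ∀ i, ∀ᶠ x in atTop, ‖ν x t i‖ ≤ C := fun i => by
    filter_upwards [eventually_ge_atTop 0] with x hx using hC x t (closedDomain_mk hx ht) i
  have hsmall : ∀ i, Tendsto (fun x => ν x t i * y x t 2) atTop (𝓝 0) := by
    intro i
    have h2 := hyl 2
    have hp2 : (Pi.single p 1 : Fin 3 → ℂ) 2 = 0 := by
      rcases hD.indices with ⟨rfl, rfl⟩ | ⟨rfl, rfl⟩ <;> simp
    rw [hp2] at h2
    refine squeeze_zero_norm' (a := fun x => C * ‖y x t 2‖) ?_ (by simpa using h2.norm.const_mul C)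
    filter_upwards [hν' i] with x hx
    rw [norm_mul]
    exact mul_le_mul_of_nonneg_right hx (norm_nonneg _)
  have hyp := hyl p
  rw [Pi.single_eq_same] at hyp
  have hlim := (hν2.mul hyp)
  rw [mul_one] at hlim
  have hev : ∀ᶠ x : ℝ in atTop, (x, t) ∈ closedDomain T := by
    filter_upwards [eventually_ge_atTop 0] with x hx using closedDomain_mk hx ht
  rcases hD.indices with ⟨rfl, rfl⟩ | ⟨rfl, rfl⟩
  · have h3 := hlim.sub (hsmall 0)
    rw [sub_zero] at h3
    refine h3.congr' ?_
    filter_upwards [hev] with x hx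
    rw [hD.columnSolution_midVector hx, cross_apply]
    simp [hν, hy]
  · have h3 := hlim.sub (hsmall 1)
    rw [sub_zero] at h3
    refine h3.congr' ?_
    filter_upwards [hev] with x hx
    rw [hD.columnSolution_midVector hx, cross_apply]
    simp [hν, hy]

/-- A bounded `m`-th column whose last entry vanishes at the origin is determined up to a factor. -/
theorem eq_smul_midVector (hD : IsSpectralData T a b A B Φ Ψ p m σ τ)
    (h2m : (a k 2).re < (a k m).re) (hmp : (a k m).re < (a k p).re) (hσ : σ k 2 ≠ 0)
    (hw : IsLaxSolution T (a k) (b k) A (B k) (a k m) (b k m) w) (hb : IsBoundedColumn T w)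
    (h2 : w 0 0 2 = 0) : ∃ c : ℂ, w 0 0 = c • midVector p (τ k) := by
  have h1 := hw.dotProduct_eq_zero hD.pos
    (hD.fund.symm.isLaxSolution_columnSolution (k := k) (j := p) (τ k)) hb
    (hD.jost_adjoint.bounded k (hD.neg_le_neg_first h2m hmp)) (by
      rw [Complex.add_re, Complex.neg_re]; linarith)
  rw [hD.fund.symm.columnSolution_zero] at h1
  have h3 := hD.dotProduct_eq_zero h2m hmp
  have h4 := hD.adjoint_ne_zero h2m hmp
  simp only [dotProduct, Fin.sum_univ_three] at h1 h3
  rw [h2, mul_zero, add_zero] at h1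
  have hε : (-1 : ℂ) ^ (p : ℕ) * (-1 : ℂ) ^ (p : ℕ) = 1 := by rw [← mul_pow]; simp
  -- Both `w 0 0` and `e_2 × τ` are orthogonal to `e_2` and `τ`. These two are independent: if both
  -- leading entries of `τ` vanished, `τ·σ = 0` with `σ₂ ≠ 0` would give `τ = 0`. The factor is
  -- found by dividing by whichever leading entry is nonzero.
  by_cases h0 : τ k 0 = 0
  · have h5 : τ k 1 ≠ 0 := by
      intro h5
      refine h4 (funext fun i => ?_)
      have h6 : τ k 2 = 0 := by simpa [h0, h5, hσ] using h3
      fin_cases i <;> assumption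
    have h7 : w 0 0 1 = 0 := by simpa [h0, h5] using h1
    refine ⟨-(-1 : ℂ) ^ (p : ℕ) * (w 0 0 0 / τ k 1), funext fun i => ?_⟩
    fin_cases i
    · simp only [midVector, Fin.zero_eta, Pi.smul_apply, Matrix.cons_val_zero, smul_eq_mul]
      field_simp
      rw [pow_add]
      linear_combination (-(w 0 0 0)) * hε
    · simp [midVector, h7, h0]
    · simp [midVector, h2]
  · refine ⟨(-1 : ℂ) ^ (p : ℕ) * (w 0 0 1 / τ k 0), funext fun i => ?_⟩
    fin_cases i
    · simp only [midVector, Fin.zero_eta, Pi.smul_apply, Matrix.cons_val_zero, smul_eq_mul]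
      field_simp
      rw [pow_add]
      linear_combination h1 + w 0 0 1 * τ k 1 * hε
    · simp only [midVector, Fin.mk_one, Pi.smul_apply, Matrix.cons_val_one, Matrix.cons_val_zero,
        smul_eq_mul]
      field_simp
      linear_combination (-(w 0 0 1)) * hε
    · simp [midVector, h2]

/-- The conditions fix the direction of the initial value by `eq_smul_midVector`; the limit 1 of the
diagonal entry fixes the factor as `1/σ₂`, by `tendsto_mid`. -/
theorem mid_iff (hD : IsSpectralData T a b A B Φ Ψ p m σ τ)
    (h2m : (a k 2).re < (a k m).re) (hmp : (a k m).re < (a k p).re) (hσ : σ k 2 ≠ 0)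
    (hw : IsLaxSolution T (a k) (b k) A (B k) (a k m) (b k m) w) :
    (IsBoundedColumn T w ∧ w 0 0 2 = 0 ∧
      ∀ t ∈ Icc 0 T, Tendsto (fun x => w x t m) atTop (𝓝 1)) ↔
    w 0 0 = (σ k 2)⁻¹ • midVector p (τ k) := by
  have heq : ∀ (c : ℂ), w 0 0 = c • midVector p (τ k) → ∀ {x t : ℝ}, (x, t) ∈ closedDomain T →
      w x t = c • columnSolution a b Φ k m (midVector p (τ k)) x t := by
    intro c hc x t hxt
    rw [hD.fund.eq_columnSolution hw hxt, hc, columnSolution_smul]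
  have hlim : ∀ (c : ℂ), w 0 0 = c • midVector p (τ k) → ∀ t ∈ Icc 0 T,
      Tendsto (fun x => w x t m) atTop (𝓝 (c * σ k 2)) := by
    intro c hc t ht
    refine ((hD.tendsto_mid h2m hmp ht).const_mul c).congr' ?_
    filter_upwards [eventually_ge_atTop 0] with x hx
    rw [heq c hc (closedDomain_mk hx ht), Pi.smul_apply, smul_eq_mul]
  constructor
  · rintro ⟨hb, h2, h1⟩
    obtain ⟨c, hc⟩ := hD.eq_smul_midVector h2m hmp hσ hw hb h2
    have h0 : (0 : ℝ) ∈ Icc 0 T := ⟨le_rfl, hD.pos.le⟩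
    have := tendsto_nhds_unique (hlim c hc 0 h0) (h1 0 h0)
    rw [hc, eq_inv_of_mul_eq_one_left this]
  · intro hc
    refine ⟨?_, by simp [hc, midVector], fun t ht => ?_⟩
    · obtain ⟨C, hC⟩ := hD.isBoundedColumn_mid h2m hmp
      refine ⟨‖(σ k 2)⁻¹‖ * C, fun x t hxt i => ?_⟩
      rw [heq _ hc hxt, Pi.smul_apply, norm_smul]
      exact mul_le_mul_of_nonneg_left (hC x t hxt i) (norm_nonneg _)
    · simpa [hσ] using hlim _ hc t ht

theorem last_iff (hD : IsSpectralData T a b A B Φ Ψ p m σ τ)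
    (h2m : (a k 2).re < (a k m).re) (hmp : (a k m).re < (a k p).re)
    (hw : IsLaxSolution T (a k) (b k) A (B k) (a k 2) (b k 2) w) :
    (IsBoundedColumn T w ∧ ∀ t ∈ Icc 0 T, Tendsto (fun x => w x t 2) atTop (𝓝 1)) ↔
    w 0 0 = σ k := by
  have hle := hD.le_last h2m hmp
  constructor
  · rintro ⟨hb, h1⟩
    refine hD.jost.apply_zero_eq hD.pos hD.lax hD.fund (hD.forall_index ?_ ?_ ?_) hw hb
      (h1 0 ⟨le_rfl, hD.pos.le⟩)
    · exact fun h => absurd rfl h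
    · exact fun _ => h2m
    · exact fun _ => h2m.trans hmp
  · intro hc
    have heq : ∀ {x t : ℝ}, (x, t) ∈ closedDomain T →
      w x t = columnSolution a b Φ k 2 (σ k) x t := by
      intro x t hxt
      rw [hD.fund.eq_columnSolution hw hxt, hc]
    refine ⟨?_, fun t ht => ?_⟩
    · obtain ⟨C, hC⟩ := hD.jost.bounded k hle
      exact ⟨C, fun x t hxt i => by rw [heq hxt]; exact hC x t hxt i⟩
    · have h1 := tendsto_pi_nhds.1 (hD.jost.tendsto k hle t ht) 2
      rw [Pi.single_eq_same] at h1
      refine h1.congr' ?_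
      filter_upwards [eventually_ge_atTop 0] with x hx
      rw [heq (closedDomain_mk hx ht)]

theorem isBoundedColumn_first (hD : IsSpectralData T a b A B Φ Ψ p m σ τ)
    (h2m : (a k 2).re < (a k m).re) (hmp : (a k m).re < (a k p).re)
    (hw : IsLaxSolution T (a k) (b k) A (B k) (a k p) (b k p) w) : IsBoundedColumn T w := by
  obtain ⟨G, hG⟩ := hD.lax.decay_A
  exact hw.isBoundedColumn_of_re_le hD.pos.le hD.lax.continuousOn_A hG (hD.le_first h2m hmp)

/-- Column `p` and the adjoint Jost solution have opposite exponents, so their pairing is constant,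
and `tendsto_apply_of_dotProduct_eq` yields the limit. The normalization at infinity becomes one
linear equation on the initial value. -/
theorem tendsto_first (hD : IsSpectralData T a b A B Φ Ψ p m σ τ)
    (h2m : (a k 2).re < (a k m).re) (hmp : (a k m).re < (a k p).re)
    (hw : IsLaxSolution T (a k) (b k) A (B k) (a k p) (b k p) w) {t : ℝ} (ht : t ∈ Icc 0 T) :
    Tendsto (fun x => w x t p) atTop (𝓝 (τ k ⬝ᵥ w 0 0)) := by
  obtain ⟨C, hC⟩ := hD.isBoundedColumn_first h2m hmp hw
  refine tendsto_apply_of_dotProduct_eq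
    (hD.jost_adjoint.tendsto k (hD.neg_le_neg_first h2m hmp) t ht) (C := C) ?_ ?_
  · filter_upwards [eventually_ge_atTop 0] with x hx using hC x t (closedDomain_mk hx ht)
  · filter_upwards [eventually_ge_atTop 0] with x hx
    have h1 := hw.pairing (hD.fund.symm.isLaxSolution_columnSolution (k := k) (j := p) (τ k))
        (closedDomain_mk hx ht)
    rw [hD.fund.symm.columnSolution_zero] at h1
    rw [h1]
    simp

theorem tendsto_first_iff (hD : IsSpectralData T a b A B Φ Ψ p m σ τ)
    (h2m : (a k 2).re < (a k m).re) (hmp : (a k m).re < (a k p).re)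
    (hw : IsLaxSolution T (a k) (b k) A (B k) (a k p) (b k p) w) :
    (∀ t ∈ Icc 0 T, Tendsto (fun x => w x t p) atTop (𝓝 1)) ↔ τ k ⬝ᵥ w 0 0 = 1 := by
  constructor
  · intro h1
    have h0 : (0 : ℝ) ∈ Icc 0 T := ⟨le_rfl, hD.pos.le⟩
    exact tendsto_nhds_unique (hD.tendsto_first h2m hmp hw h0) (h1 0 h0)
  · intro h t ht
    rw [← h]
    exact hD.tendsto_first h2m hmp hw ht

theorem apply_zero_eq_add (hD : IsSpectralData T a b A B Φ Ψ p m σ τ)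
    (hw : IsLaxSolution T (a k) (b k) A (B k) (a k p) (b k p) w) (hm : w 0 T m = 0) :
    ∃ c : ℂ, w 0 0 = w 0 T p • endValue T b Ψ k p + (c * w 0 T 2) • endValue T b Ψ k 2 := by
  refine ⟨Complex.exp ((b k p - b k 2) * T), ?_⟩
  rw [hD.fund.apply_zero_eq_sum hD.pos hw, Fin.sum_univ_three]
  rcases hD.indices with ⟨rfl, rfl⟩ | ⟨rfl, rfl⟩ <;> simp [hm]

theorem apply_end (hD : IsSpectralData T a b A B Φ Ψ p m σ τ)
    (hw : IsLaxSolution T (a k) (b k) A (B k) (a k p) (b k p) w) {α β : ℂ}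
    (h0 : w 0 0 = α • endValue T b Ψ k p + β • endValue T b Ψ k 2) :
    w 0 T m = 0 ∧ (β = 0 → w 0 T 2 = 0) := by
  have hm : ((0 : ℝ), T) ∈ closedDomain T := closedDomain_mk le_rfl ⟨hD.pos.le, le_rfl⟩
  rw [hD.fund.eq_columnSolution hw hm, h0, columnSolution_add, columnSolution_smul,
    columnSolution_smul, columnSolution_endValue hD.pos hD.fund,
    columnSolution_endValue hD.pos hD.fund]
  rcases hD.indices with ⟨rfl, rfl⟩ | ⟨rfl, rfl⟩ <;> simp +contextual

/-- Two vanishing entries leave `w(0,T)` a multiple of `e_p`, hence `w(0,0)` a multiple of `S_p`;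
the equation `τ·w(0,0) = 1` fixes the factor. -/
theorem first_iff_of_end (hD : IsSpectralData T a b A B Φ Ψ p m σ τ)
    (h2m : (a k 2).re < (a k m).re) (hmp : (a k m).re < (a k p).re)
    (hW : τ k ⬝ᵥ endValue T b Ψ k p ≠ 0)
    (hw : IsLaxSolution T (a k) (b k) A (B k) (a k p) (b k p) w) :
    (w 0 T m = 0 ∧ w 0 T 2 = 0 ∧ ∀ t ∈ Icc 0 T, Tendsto (fun x => w x t p) atTop (𝓝 1)) ↔
    w 0 0 = (τ k ⬝ᵥ endValue T b Ψ k p)⁻¹ • endValue T b Ψ k p := by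
  rw [hD.tendsto_first_iff h2m hmp hw]
  constructor
  · rintro ⟨h1, h2, h3⟩
    obtain ⟨c, hc⟩ := hD.apply_zero_eq_add hw h1
    rw [h2, mul_zero, zero_smul, add_zero] at hc
    rw [hc, dotProduct_smul, smul_eq_mul] at h3
    rw [hc, eq_inv_of_mul_eq_one_left h3]
  · intro hc
    obtain ⟨h1, h2⟩ := hD.apply_end hw (α := (τ k ⬝ᵥ endValue T b Ψ k p)⁻¹) (β := 0)
      (by rw [hc, zero_smul, add_zero])
    refine ⟨h1, h2 rfl, ?_⟩
    rw [hc, dotProduct_smul, smul_eq_mul, inv_mul_cancel₀ hW]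

/-- The condition at `(0,T)` leaves the span of `S_p` and `S_2`; the vanishing last entry at the
origin singles out the line through `minorVector`, and `τ·w(0,0) = 1` fixes the factor. -/
theorem first_iff_of_minor (hD : IsSpectralData T a b A B Φ Ψ p m σ τ)
    (h2m : (a k 2).re < (a k m).re) (hmp : (a k m).re < (a k p).re)
    (hW : τ k ⬝ᵥ minorVector (endValue T b Ψ k) p ≠ 0)
    (hw : IsLaxSolution T (a k) (b k) A (B k) (a k p) (b k p) w) :
    (w 0 T m = 0 ∧ w 0 0 2 = 0 ∧ ∀ t ∈ Icc 0 T, Tendsto (fun x => w x t p) atTop (𝓝 1)) ↔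
    w 0 0 = (τ k ⬝ᵥ minorVector (endValue T b Ψ k) p)⁻¹ • minorVector (endValue T b Ψ k) p := by
  rw [hD.tendsto_first_iff h2m hmp hw]
  set S := endValue T b Ψ k with hS
  constructor
  · rintro ⟨h1, h2, h3⟩
    obtain ⟨c, hc⟩ := hD.apply_zero_eq_add hw h1
    set α := w 0 T p
    set β := c * w 0 T 2
    have h4 : α * S p 2 + β * S 2 2 = 0 := by
      have := congrFun hc 2
      rw [h2] at this
      simpa using this.symm
    have h5 : ∃ e : ℂ, w 0 0 = e • minorVector S p := by
      -- If `S 2 2 = 0`, the nonvanishing denominator forces `S p 2 ≠ 0`, so `α = 0` and the line is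
      -- spanned by `S 2` alone.
      by_cases h6 : S 2 2 = 0
      · have h7 : S p 2 ≠ 0 := by
          intro h7
          simp [minorVector, h6, h7] at hW
        have h8 : α = 0 := by simpa [h6, h7] using h4
        refine ⟨-β / S p 2, ?_⟩
        rw [hc, minorVector, h8, h6, zero_smul, zero_add, zero_sub, smul_neg, smul_smul,
          ← neg_smul]
        congr 1
        field_simp
      · refine ⟨α / S 2 2, ?_⟩
        have h8 : β = -(α / S 2 2 * S p 2) := by
          field_simp
          linear_combination h4
        rw [hc, minorVector, h8, smul_sub, smul_smul, smul_smul, div_mul_cancel₀ _ h6, neg_smul,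
          ← sub_eq_add_neg]
    obtain ⟨e, he⟩ := h5
    rw [he, dotProduct_smul, smul_eq_mul] at h3
    rw [he, eq_inv_of_mul_eq_one_left h3]
  · intro hc
    set W := τ k ⬝ᵥ minorVector S p
    obtain ⟨h1, -⟩ := hD.apply_end hw (α := W⁻¹ * S 2 2) (β := -(W⁻¹ * S p 2)) (by
      rw [hc, minorVector, smul_sub, smul_smul, smul_smul, neg_smul, ← sub_eq_add_neg])
    refine ⟨h1, ?_, ?_⟩
    · rw [hc]
      simp [minorVector, mul_comm]
    · rw [hc, dotProduct_smul, smul_eq_mul, inv_mul_cancel₀ hW]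

end IsSpectralData

end

section

/-! ### Residues -/

/-- Near `c`, `f(k) = (k - c) h(k)` with `h = dslope f c` analytic and `h(c) = f'(c) ≠ 0`. The
regular part of `N/f` is then the divided difference of `N/h` at `c`. The residue is allowed to
vanish. -/
theorem hasSimplePoleResidue_of_eventuallyEq {f : ℂ → ℂ} {N F : ℂ → Fin 3 → ℂ} {c : ℂ}
    {U : Set ℂ} (hU : U ∈ 𝓝 c) (hf : DifferentiableOn ℂ f U) (hN : DifferentiableOn ℂ N U)
    (h0 : f c = 0) (h1 : deriv f c ≠ 0) (hF : ∀ᶠ k in 𝓝[≠] c, F k = (f k)⁻¹ • N k) :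
    HasSimplePoleResidue F c ((deriv f c)⁻¹ • N c) := by
  have hfa : AnalyticAt ℂ f c := hf.analyticAt hU
  have hNa : AnalyticAt ℂ N c := hN.analyticAt hU
  obtain ⟨P, hP⟩ := hfa
  have hd : AnalyticAt ℂ (dslope f c) c := hP.has_fpower_series_dslope_fslope.analyticAt
  have hd0 : dslope f c c ≠ 0 := by rwa [dslope_same]
  have hg : AnalyticAt ℂ (fun k => (dslope f c k)⁻¹ • N k) c := (hd.inv hd0).smul hNa
  obtain ⟨Q, hQ⟩ := hg
  refine ⟨dslope (fun k => (dslope f c k)⁻¹ • N k) c,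
    hQ.has_fpower_series_dslope_fslope.analyticAt, ?_⟩
  filter_upwards [hF, self_mem_nhdsWithin] with k hk hne
  have hkc : k - c ≠ 0 := sub_ne_zero.2 hne
  rw [hk, dslope_of_ne _ hne, slope_def_module, dslope_same, dslope_of_ne _ hne, slope_def_field,
    h0, sub_zero, smul_sub, add_sub_cancel, smul_smul]
  congr 1
  field_simp

variable {T : ℝ} {q r : ℝ → ℝ → ℂ} {Φ Ψ : ℂ → ℝ → ℝ → Matrix (Fin 3) (Fin 3) ℂ}
  {p m : Fin 3} {σ τ : ℂ → Fin 3 → ℂ} {k κ : ℂ} {j : Fin 3} {w : ℝ → ℝ → Fin 3 → ℂ}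

theorem contour_eq_γ₁_iff {i : Fin 3} :
    contour k i j = .γ₁ ↔ (l k i).re < (l k j).re ∧ (z k j).re ≤ (z k i).re := by
  unfold contour
  split_ifs with h1 h2 <;> simp [*]

theorem contour_eq_γ₂_iff {i : Fin 3} :
    contour k i j = .γ₂ ↔ (l k i).re < (l k j).re ∧ (z k i).re < (z k j).re := by
  unfold contour
  split_ifs with h1 h2 <;> simp [*]
  exact not_le.1 h2

theorem contour_eq_γ₃_iff {i : Fin 3} : contour k i j = .γ₃ ↔ (l k j).re ≤ (l k i).re := by
  unfold contour
  split_ifs with h1 h2 <;> simp [*]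
  exact not_lt.1 h1

/-- The real parts of the `l_i` must differ from that of `l_j`, so that the off-diagonal γ₃ entries
impose nothing beyond boundedness. -/
theorem isMColumn_iff (hT : 0 < T) (hL : LaxFamily T l z (V1 q r) (V2 q r))
    (hne : ∀ i, i ≠ j → (l k i).re ≠ (l k j).re) :
    IsMColumn T q r k j w ↔
      IsLaxSolution T (l k) (z k) (V1 q r) (V2 q r k) (l k j) (z k j) w ∧ IsBoundedColumn T w ∧
      (∀ i, contour k i j = .γ₁ → w 0 T i = 0) ∧ (∀ i, contour k i j = .γ₂ → w 0 0 i = 0) ∧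
      ∀ t ∈ Icc 0 T, Tendsto (fun x => w x t j) atTop (𝓝 1) := by
  obtain ⟨G, hG⟩ := hL.decay_A
  have hjj : contour k j j = .γ₃ := contour_eq_γ₃_iff.2 le_rfl
  have hiff := fun hb : IsBoundedColumn T w =>
    isEigencolumn_iff (w := w) (j := j) (a := l k) (b := z k) (γ := fun i => contour k i j)
      hT.le hL.continuousOn_A (hL.continuousOn_B' k) hG fun i hi =>
        ⟨hb, fun hij => lt_of_le_of_ne (contour_eq_γ₃_iff.1 hi) (hne i hij).symm⟩
  constructor
  · rintro ⟨h, hb⟩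
    obtain ⟨h1, h2, h3, h4⟩ := (hiff hb).1 h
    refine ⟨h1, hb, fun i hi => ?_, fun i hi => ?_, h4 hjj⟩
    · have hij : i ≠ j := by rintro rfl; simp [hjj] at hi
      rw [h2 i hi, if_neg hij]
    · have hij : i ≠ j := by rintro rfl; simp [hjj] at hi
      rw [h3 i hi, if_neg hij]
  · rintro ⟨h1, hb, h2, h3, h4⟩
    refine ⟨(hiff hb).2 ⟨h1, fun i hi => ?_, fun i hi => ?_, fun _ => h4⟩, hb⟩
    · have hij : i ≠ j := by rintro rfl; simp [hjj] at hi
      rw [h2 i hi, if_neg hij]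
    · have hij : i ≠ j := by rintro rfl; simp [hjj] at hi
      rw [h3 i hi, if_neg hij]

/-- The `j`-th columns of `M(·,·,k)` are the solutions with value `v` at the origin. -/
def IsColumnValue (T : ℝ) (q r : ℝ → ℝ → ℂ) (k : ℂ) (j : Fin 3) (v : Fin 3 → ℂ) : Prop :=
  ∀ w, IsMColumn T q r k j w ↔
    IsLaxSolution T (l k) (z k) (V1 q r) (V2 q r k) (l k j) (z k j) w ∧ w 0 0 = v

section ColumnValue

variable {v : Fin 3 → ℂ}

theorem IsColumnValue.isMColumn (hΦ : IsFundamentalPair T l z (V1 q r) (V2 q r) Φ Ψ)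
    (hv : IsColumnValue T q r k j v) : IsMColumn T q r k j (columnSolution l z Φ k j v) :=
  (hv _).2 ⟨hΦ.isLaxSolution_columnSolution v, hΦ.columnSolution_zero⟩

theorem IsColumnValue.wellDefined (hΦ : IsFundamentalPair T l z (V1 q r) (V2 q r) Φ Ψ)
    (hv : IsColumnValue T q r k j v) : MColumnWellDefined T q r k j := by
  refine ⟨⟨_, hv.isMColumn hΦ⟩, fun w w' hw hw' => ?_⟩
  rintro ⟨x, t⟩ hxt
  change w x t = w' x t
  obtain ⟨h1, h2⟩ := (hv w).1 hw
  obtain ⟨h3, h4⟩ := (hv w').1 hw'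
  rw [hΦ.eq_columnSolution h1 hxt, hΦ.eq_columnSolution h3 hxt, h2, h4]

theorem IsColumnValue.col_M (hΦ : IsFundamentalPair T l z (V1 q r) (V2 q r) Φ Ψ)
    (hv : IsColumnValue T q r k j v) {x t : ℝ} (hxt : (x, t) ∈ closedDomain T) :
    col (M T q r x t k) j = columnSolution l z Φ k j v x t := by
  obtain ⟨h1, h2⟩ := (hv _).1 (Classical.epsilon_spec ⟨_, hv.isMColumn hΦ⟩)
  have := hΦ.eq_columnSolution h1 hxt
  rw [h2] at this
  exact this

end ColumnValue

/-- A simple zero is isolated, so the formula for the initial value holds in a punctured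
neighbourhood; holomorphy of `Φ` then carries the pole statement from the origin to every `(x,t)`.
-/
theorem residue_of_isColumnValue (hL : LaxFamily T l z (V1 q r) (V2 q r))
    (hΦ : IsFundamentalPair T l z (V1 q r) (V2 q r) Φ Ψ) {f : ℂ → ℂ} {N : ℂ → Fin 3 → ℂ}
    {U : Set ℂ} (hU : U ∈ 𝓝 κ) (hf : DifferentiableOn ℂ f U) (hN : DifferentiableOn ℂ N U)
    (h0 : f κ = 0) (h1 : deriv f κ ≠ 0)
    (hv : ∀ k ∈ U, f k ≠ 0 → IsColumnValue T q r k j ((f k)⁻¹ • N k)) :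
    (∀ᶠ k in 𝓝[≠] κ, MColumnWellDefined T q r k j) ∧ ∀ x t, (x, t) ∈ closedDomain T →
      HasSimplePoleResidue (fun k => col (M T q r x t k) j) κ
        ((deriv f κ)⁻¹ • columnSolution l z Φ κ j (N κ) x t) := by
  have hev : ∀ᶠ k in 𝓝[≠] κ, IsColumnValue T q r k j ((f k)⁻¹ • N k) := by
    filter_upwards [(hf.differentiableAt hU).hasDerivAt.eventually_ne h1 (c := 0),
      mem_nhdsWithin_of_mem_nhds hU] with k h2 h3 using hv k h3 h2
  refine ⟨hev.mono fun k hk => hk.wellDefined hΦ, fun x t hxt => ?_⟩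
  refine hasSimplePoleResidue_of_eventuallyEq (F := fun k => col (M T q r x t k) j)
    (N := fun k => columnSolution l z Φ k j (N k) x t) hU hf
    (differentiable_columnSolution hL hΦ hN x t) h0 h1 ?_
  filter_upwards [hev] with k hk
  rw [hk.col_M hΦ hxt, columnSolution_smul]

/-- The points at which the three numbers `Re l_2`, `Re l_m`, `Re l_p` are increasing. -/
def orderedSector (p m : Fin 3) : Set ℂ :=
  {k | (l k 2).re < (l k m).re ∧ (l k m).re < (l k p).re}

theorem continuous_re_l (i : Fin 3) : Continuous fun k => (l k i).re := by
  unfold l; fun_prop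

theorem continuous_re_z (i : Fin 3) : Continuous fun k => (z k i).re := by
  unfold z; fun_prop

theorem isOpen_orderedSector : IsOpen (orderedSector p m) :=
  (isOpen_lt (continuous_re_l 2) (continuous_re_l m)).inter
    (isOpen_lt (continuous_re_l m) (continuous_re_l p))

theorem isOpen_re_z_lt (i j : Fin 3) : IsOpen {k | (z k i).re < (z k j).re} :=
  isOpen_lt (continuous_re_z i) (continuous_re_z j)

namespace IsSpectralData

theorem isMColumn_iff (hD : IsSpectralData T l z (V1 q r) (V2 q r) Φ Ψ p m σ τ)
    (hk : k ∈ orderedSector p m) (j : Fin 3) : IsMColumn T q r k j w ↔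
      IsLaxSolution T (l k) (z k) (V1 q r) (V2 q r k) (l k j) (z k j) w ∧ IsBoundedColumn T w ∧
      (∀ i, contour k i j = .γ₁ → w 0 T i = 0) ∧ (∀ i, contour k i j = .γ₂ → w 0 0 i = 0) ∧
      ∀ t ∈ Icc 0 T, Tendsto (fun x => w x t j) atTop (𝓝 1) := by
  refine HalfLine.isMColumn_iff hD.pos hD.lax ?_
  obtain ⟨h1, h2⟩ := hk
  have h3 := h1.trans h2
  intro i
  refine hD.forall_index (P := fun i => i ≠ j → (l k i).re ≠ (l k j).re) ?_ ?_ ?_ i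
  · refine hD.forall_index (P := fun j => 2 ≠ j → (l k 2).re ≠ (l k j).re) ?_ ?_ ?_ j
    · exact fun h => absurd rfl h
    · exact fun _ => h1.ne
    · exact fun _ => h3.ne
  · refine hD.forall_index (P := fun j => m ≠ j → (l k m).re ≠ (l k j).re) ?_ ?_ ?_ j
    · exact fun _ => h1.ne'
    · exact fun h => absurd rfl h
    · exact fun _ => h2.ne
  · refine hD.forall_index (P := fun j => p ≠ j → (l k p).re ≠ (l k j).re) ?_ ?_ ?_ j
    · exact fun _ => h3.ne'
    · exact fun _ => h2.ne'
    · exact fun h => absurd rfl h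

theorem isColumnValue_last (hD : IsSpectralData T l z (V1 q r) (V2 q r) Φ Ψ p m σ τ)
    (hk : k ∈ orderedSector p m) : IsColumnValue T q r k 2 (σ k) := by
  intro w
  rw [hD.isMColumn_iff hk]
  refine and_congr_right fun hw => ?_
  rw [← hD.last_iff hk.1 hk.2 hw]
  have h : ∀ i, ¬ (l k i).re < (l k 2).re := fun i => not_lt.2 (hD.le_last hk.1 hk.2 i)
  simp [contour_eq_γ₁_iff, contour_eq_γ₂_iff, h]

/-- In column `m` only the last entry avoids γ₃, and the ordering of the `z_i` puts it on γ₂; this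
is the setting of `mid_iff`. -/
theorem isColumnValue_mid (hD : IsSpectralData T l z (V1 q r) (V2 q r) Φ Ψ p m σ τ)
    (hk : k ∈ orderedSector p m) (hz : (z k 2).re < (z k m).re) (hσ : σ k 2 ≠ 0) :
    IsColumnValue T q r k m ((σ k 2)⁻¹ • midVector p (τ k)) := by
  intro w
  rw [hD.isMColumn_iff hk]
  refine and_congr_right fun hw => ?_
  rw [← hD.mid_iff hk.1 hk.2 hσ hw]
  refine and_congr_right fun _ => ?_
  simp only [contour_eq_γ₁_iff, contour_eq_γ₂_iff]
  constructor
  · rintro ⟨-, h2, h3⟩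
    exact ⟨h2 2 ⟨hk.1, hz⟩, h3⟩
  · rintro ⟨h2, h3⟩
    refine ⟨hD.forall_index ?_ ?_ ?_, hD.forall_index ?_ ?_ ?_, h3⟩
    · exact fun h => absurd hz (not_lt.2 h.2)
    · exact fun h => absurd h.1 (lt_irrefl _)
    · exact fun h => absurd h.1 hk.2.not_gt
    · exact fun _ => h2
    · exact fun h => absurd h.1 (lt_irrefl _)
    · exact fun h => absurd h.1 hk.2.not_gt

/-- Since `Re z_p` is the smallest of the three, both off-diagonal entries of column `p` lie on γ₁.
-/
theorem isColumnValue_first_of_end (hD : IsSpectralData T l z (V1 q r) (V2 q r) Φ Ψ p m σ τ)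
    (hk : k ∈ orderedSector p m) (hm : (z k p).re < (z k m).re) (h2 : (z k p).re < (z k 2).re)
    (hW : τ k ⬝ᵥ endValue T z Ψ k p ≠ 0) :
    IsColumnValue T q r k p ((τ k ⬝ᵥ endValue T z Ψ k p)⁻¹ • endValue T z Ψ k p) := by
  intro w
  rw [hD.isMColumn_iff hk]
  refine and_congr_right fun hw => ?_
  rw [← hD.first_iff_of_end hk.1 hk.2 hW hw]
  have hb := hD.isBoundedColumn_first hk.1 hk.2 hw
  simp only [contour_eq_γ₁_iff, contour_eq_γ₂_iff]
  constructor
  · rintro ⟨-, h3, -, h4⟩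
    exact ⟨h3 m ⟨hk.2, hm.le⟩, h3 2 ⟨hk.1.trans hk.2, h2.le⟩, h4⟩
  · rintro ⟨h3, h4, h5⟩
    refine ⟨hb, hD.forall_index ?_ ?_ ?_, hD.forall_index ?_ ?_ ?_, h5⟩
    · exact fun _ => h4
    · exact fun _ => h3
    · exact fun h => absurd h.1 (lt_irrefl _)
    · exact fun h => absurd h.2 h2.not_gt
    · exact fun h => absurd h.2 hm.not_gt
    · exact fun h => absurd h.1 (lt_irrefl _)

/-- Here `Re z_2 < Re z_p < Re z_m`, so entry `m` of column `p` lies on γ₁ and the last entry on γ₂.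
-/
theorem isColumnValue_first_of_minor (hD : IsSpectralData T l z (V1 q r) (V2 q r) Φ Ψ p m σ τ)
    (hk : k ∈ orderedSector p m) (hm : (z k p).re < (z k m).re) (h2 : (z k 2).re < (z k p).re)
    (hW : τ k ⬝ᵥ minorVector (endValue T z Ψ k) p ≠ 0) :
    IsColumnValue T q r k p
      ((τ k ⬝ᵥ minorVector (endValue T z Ψ k) p)⁻¹ • minorVector (endValue T z Ψ k) p) := by
  intro w
  rw [hD.isMColumn_iff hk]
  refine and_congr_right fun hw => ?_
  rw [← hD.first_iff_of_minor hk.1 hk.2 hW hw]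
  have hb := hD.isBoundedColumn_first hk.1 hk.2 hw
  simp only [contour_eq_γ₁_iff, contour_eq_γ₂_iff]
  constructor
  · rintro ⟨-, h3, h4, h5⟩
    exact ⟨h3 m ⟨hk.2, hm.le⟩, h4 2 ⟨hk.1.trans hk.2, h2⟩, h5⟩
  · rintro ⟨h3, h4, h5⟩
    refine ⟨hb, hD.forall_index ?_ ?_ ?_, hD.forall_index ?_ ?_ ?_, h5⟩
    · exact fun h => absurd h2 (not_lt.2 h.2)
    · exact fun _ => h3
    · exact fun h => absurd h.1 (lt_irrefl _)
    · exact fun _ => h4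
    · exact fun h => absurd h.2 hm.not_gt
    · exact fun h => absurd h.1 (lt_irrefl _)

/-! ### Spectral functions -/

theorem s_eq (hD : IsSpectralData T l z (V1 q r) (V2 q r) Φ Ψ p m σ τ)
    (hk : k ∈ orderedSector p m) (i : Fin 3) : s T q r k i 2 = σ k i := by
  refine congrFun (hD.jost.epsilon_apply_zero hD.pos hD.lax hD.fund ?_) i
  refine hD.forall_index ?_ ?_ ?_
  · exact fun h => absurd rfl h
  · exact fun _ => hk.1
  · exact fun _ => hk.1.trans hk.2

theorem sA_eq (hD : IsSpectralData T l z (V1 q r) (V2 q r) Φ Ψ p m σ τ)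
    (hk : k ∈ orderedSector p m) (i : Fin 3) : sA T q r k i p = τ k i := by
  refine congrFun (hD.jost_adjoint.epsilon_apply_zero hD.pos hD.lax.adjoint hD.fund.symm ?_) i
  simp only [Complex.neg_re, neg_lt_neg_iff]
  refine hD.forall_index ?_ ?_ ?_
  · exact fun _ => hk.1.trans hk.2
  · exact fun _ => hk.2
  · exact fun h => absurd rfl h

theorem S_eq (hD : IsSpectralData T l z (V1 q r) (V2 q r) Φ Ψ p m σ τ) (i j : Fin 3) :
    S T q r k i j = endValue T z Ψ k j i :=
  congrFun (epsilon_γ₁_apply_zero hD.pos hD.lax hD.fund k j) i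

theorem ms_one_eq (hD : IsSpectralData T l z (V1 q r) (V2 q r) Φ Ψ p m σ τ)
    (hk : k ∈ orderedSector p m) : ms T q r k 1 p = midVector p (τ k) 0 := by
  simp [ms, midVector, hD.sA_eq hk]

theorem mS_one_eq (hD : IsSpectralData T l z (V1 q r) (V2 q r) Φ Ψ p m σ τ) :
    mS T q r k 1 m = minorVector (endValue T z Ψ k) p 0 := by
  rcases hD.indices with ⟨rfl, rfl⟩ | ⟨rfl, rfl⟩ <;>
    simp [mS, Matrix.det_fin_two, hD.S_eq, minorVector, Fin.succAbove] <;> ring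

theorem mS_zero_eq (hD : IsSpectralData T l z (V1 q r) (V2 q r) Φ Ψ p m σ τ) :
    mS T q r k 0 m = minorVector (endValue T z Ψ k) p 1 := by
  rcases hD.indices with ⟨rfl, rfl⟩ | ⟨rfl, rfl⟩ <;>
    simp [mS, Matrix.det_fin_two, hD.S_eq, minorVector, Fin.succAbove] <;> ring

theorem differentiableOn_jost (hD : IsSpectralData T l z (V1 q r) (V2 q r) Φ Ψ p m σ τ)
    (i : Fin 3) : DifferentiableOn ℂ (fun k => σ k i) (orderedSector p m) :=
  differentiableOn_pi.1 (hD.jost.differentiableOn _ isOpen_orderedSector fun _ hk =>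
    hD.le_last hk.1 hk.2) i

theorem differentiableOn_adjoint (hD : IsSpectralData T l z (V1 q r) (V2 q r) Φ Ψ p m σ τ)
    (i : Fin 3) : DifferentiableOn ℂ (fun k => τ k i) (orderedSector p m) :=
  differentiableOn_pi.1 (hD.jost_adjoint.differentiableOn _ isOpen_orderedSector fun _ hk =>
    hD.neg_le_neg_first hk.1 hk.2) i

theorem differentiableOn_midVector (hD : IsSpectralData T l z (V1 q r) (V2 q r) Φ Ψ p m σ τ) :
    DifferentiableOn ℂ (fun k => midVector p (τ k)) (orderedSector p m) := by
  refine differentiableOn_pi.2 fun i => ?_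
  fin_cases i
  · exact (hD.differentiableOn_adjoint 1).const_mul _
  · exact (hD.differentiableOn_adjoint 0).const_mul _
  · exact differentiableOn_const 0

theorem differentiable_minorVector (hD : IsSpectralData T l z (V1 q r) (V2 q r) Φ Ψ p m σ τ) :
    Differentiable ℂ fun k => minorVector (endValue T z Ψ k) p := by
  have h := fun j => differentiable_endValue hD.lax hD.fund j
  have h' := fun j => differentiable_pi.1 (h j)
  exact ((h' 2 2).smul (h p)).sub ((h' p 2).smul (h 2))

theorem differentiableOn_dotProduct (hD : IsSpectralData T l z (V1 q r) (V2 q r) Φ Ψ p m σ τ)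
    {v : ℂ → Fin 3 → ℂ} (hv : Differentiable ℂ v) :
    DifferentiableOn ℂ (fun k => τ k ⬝ᵥ v k) (orderedSector p m) := by
  simp only [dotProduct]
  exact DifferentiableOn.fun_sum fun i _ =>
    (hD.differentiableOn_adjoint i).mul (differentiable_pi.1 hv i).differentiableOn

/-! ### The three residue formulas, for either choice of `p` and `m`. -/

theorem columnSolution_eq_theta (i j : Fin 3) (v : Fin 3 → ℂ) (x t : ℝ) :
    columnSolution l z Φ k j v x t =
      Complex.exp (theta i j x t k) • columnSolution l z Φ k i v x t :=
  columnSolution_eq_exp_smul i j x t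

/-- At a zero of `s₃₃` the relation `τ·σ = 0` involves only the first two entries, so `midVector` is
a multiple of `σ`. Comparing first entries gives the coefficient, which is why `s₁₃` must not
vanish. -/
theorem residue_mid (hD : IsSpectralData T l z (V1 q r) (V2 q r) Φ Ψ p m σ τ)
    (hκ : κ ∈ orderedSector p m) (hz : (z κ 2).re < (z κ m).re) (h0 : s33 T q r κ = 0)
    (h1 : deriv (s33 T q r) κ ≠ 0) :
    (∀ᶠ k in 𝓝[≠] κ, MColumnWellDefined T q r k m) ∧ MColumnWellDefined T q r κ 2 ∧
    ∀ x t, (x, t) ∈ closedDomain T → ∃ R,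
      HasSimplePoleResidue (fun k => col (M T q r x t k) m) κ R ∧ (s T q r κ 0 2 ≠ 0 →
        R = (ms T q r κ 1 p / (s T q r κ 0 2 * deriv (s33 T q r) κ) *
          Complex.exp (theta 2 m x t κ)) • col (M T q r x t κ) 2) := by
  have hs : ∀ k ∈ orderedSector p m, s33 T q r k = σ k 2 := fun k hk => hD.s_eq hk 2
  have hU : orderedSector p m ∩ {k | (z k 2).re < (z k m).re} ∈ 𝓝 κ :=
    (isOpen_orderedSector.inter (isOpen_re_z_lt 2 m)).mem_nhds ⟨hκ, hz⟩
  obtain ⟨h2, h3⟩ := residue_of_isColumnValue (j := m) hD.lax hD.fund hU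
    (((hD.differentiableOn_jost 2).congr hs).mono inter_subset_left)
    (hD.differentiableOn_midVector.mono inter_subset_left) h0 h1 fun k hk hne => by
      rw [hs k hk.1] at hne ⊢
      exact hD.isColumnValue_mid hk.1 hk.2 hne
  have h4 := hD.isColumnValue_last hκ
  refine ⟨h2, h4.wellDefined hD.fund, fun x t hxt => ⟨_, h3 x t hxt, fun hne => ?_⟩⟩
  have h5 := hD.dotProduct_eq_zero hκ.1 hκ.2
  rw [hs κ hκ] at h0
  rw [hD.s_eq hκ] at hne
  simp only [dotProduct, Fin.sum_univ_three, h0] at h5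
  have h6 : midVector p (τ κ) = (midVector p (τ κ) 0 / σ κ 0) • σ κ := by
    funext i
    fin_cases i
    · simp [hne]
    · simp only [midVector, Fin.mk_one, Pi.smul_apply, Matrix.cons_val_one, Matrix.cons_val_zero,
        smul_eq_mul]
      field_simp
      rw [pow_add]
      linear_combination (-1 : ℂ) ^ (p : ℕ) * h5
    · simp [midVector, h0]
  rw [h4.col_M hD.fund hxt, hD.s_eq hκ, hD.ms_one_eq hκ, h6, columnSolution_smul, ← h6,
    columnSolution_eq_theta 2 m, smul_smul, smul_smul]
  congr 1
  field_simp

/-- With `v = S_p`, the vector `v - (v₂/σ₂) σ` has vanishing last entry and is orthogonal to `τ`, as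
both `τ·v` and `τ·σ` vanish at `κ`. It is therefore a multiple of `midVector`, the numerator of
column `m`. In terms of `s^A` the alternating signs of the minors disappear, hence the form of `W`.
-/
theorem residue_first_of_end (hD : IsSpectralData T l z (V1 q r) (V2 q r) Φ Ψ p m σ τ)
    (hκ : κ ∈ orderedSector p m) (h2m : (z κ 2).re < (z κ m).re) (hp2 : (z κ p).re < (z κ 2).re)
    {W : ℂ → ℂ} (hW : ∀ k, W k = ∑ i, sA T q r k i p * S T q r k i p)
    (hs0 : s33 T q r κ ≠ 0) (h0 : W κ = 0) (h1 : deriv W κ ≠ 0) :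
    (∀ᶠ k in 𝓝[≠] κ, MColumnWellDefined T q r k p) ∧ MColumnWellDefined T q r κ 2 ∧
    MColumnWellDefined T q r κ m ∧
    ∀ x t, (x, t) ∈ closedDomain T → ∃ R,
      HasSimplePoleResidue (fun k => col (M T q r x t k) p) κ R ∧ (ms T q r κ 2 p ≠ 0 →
        R = (1 / deriv W κ) •
          (((S T q r κ 0 p * s T q r κ 1 2 - S T q r κ 1 p * s T q r κ 0 2) / ms T q r κ 2 p
              * Complex.exp (theta m p x t κ)) • col (M T q r x t κ) m
            + (S T q r κ 2 p / s T q r κ 2 2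
              * Complex.exp (theta 2 p x t κ)) • col (M T q r x t κ) 2)) := by
  have hW' : ∀ k ∈ orderedSector p m, W k = τ k ⬝ᵥ endValue T z Ψ k p := fun k hk => by
    simp only [hW, hD.sA_eq hk, hD.S_eq, dotProduct]
  have hs : s33 T q r κ = σ κ 2 := hD.s_eq hκ 2
  rw [hs] at hs0
  have hU : orderedSector p m ∩ ({k | (z k 2).re < (z k m).re} ∩ {k | (z k p).re < (z k 2).re}) ∈
      𝓝 κ := (isOpen_orderedSector.inter ((isOpen_re_z_lt 2 m).inter
        (isOpen_re_z_lt p 2))).mem_nhds ⟨hκ, h2m, hp2⟩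
  obtain ⟨h2, h3⟩ := residue_of_isColumnValue (j := p) hD.lax hD.fund hU
    (((hD.differentiableOn_dotProduct (differentiable_endValue hD.lax hD.fund p)).congr hW').mono
      inter_subset_left)
    (differentiable_endValue hD.lax hD.fund p).differentiableOn h0 h1 fun k hk hne => by
      rw [hW' k hk.1] at hne ⊢
      exact hD.isColumnValue_first_of_end hk.1 (hk.2.2.trans hk.2.1) hk.2.2 hne
  have h4 := hD.isColumnValue_last hκ
  have h5 := hD.isColumnValue_mid hκ h2m hs0
  refine ⟨h2, h4.wellDefined hD.fund, h5.wellDefined hD.fund,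
    fun x t hxt => ⟨_, h3 x t hxt, fun hne => ?_⟩⟩
  rw [h4.col_M hD.fund hxt, h5.col_M hD.fund hxt]
  simp only [hD.s_eq hκ, hD.S_eq]
  have h6 := hD.dotProduct_eq_zero hκ.1 hκ.2
  rw [hW' κ hκ] at h0
  set v := endValue T z Ψ κ p
  rw [mul_smul, mul_smul, ← columnSolution_eq_theta, ← columnSolution_eq_theta, one_div]
  congr 1
  rw [← columnSolution_smul, ← columnSolution_smul, ← columnSolution_add]
  congr 1
  simp only [dotProduct, Fin.sum_univ_three] at h0 h6
  have hms : ms T q r κ 2 p = (-1 : ℂ) ^ (p : ℕ) * τ κ 2 := by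
    simp [ms, hD.sA_eq hκ, pow_add]
  rw [hms] at hne ⊢
  have h7 : (-1 : ℂ) ^ (p : ℕ) ≠ 0 := left_ne_zero_of_mul hne
  have h8 : τ κ 2 ≠ 0 := right_ne_zero_of_mul hne
  funext i
  fin_cases i
  · simp only [midVector, Fin.zero_eta, Pi.add_apply, Pi.smul_apply, Matrix.cons_val_zero,
      smul_eq_mul, pow_add]
    field_simp
    linear_combination (v 0) * h6 - (σ κ 0) * h0
  · simp only [midVector, Fin.mk_one, Pi.add_apply, Pi.smul_apply, Matrix.cons_val_one,
      Matrix.cons_val_zero, smul_eq_mul, pow_add]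
    field_simp
    linear_combination (v 1) * h6 - (σ κ 1) * h0
  · simp [midVector, hs0]

/-- The numerator has vanishing last entry by construction and is orthogonal to `τ` at `κ`, so it is
proportional to `midVector`; the last column does not contribute. The factor `s₃₃` compensates the
denominator of column `m`. -/
theorem residue_first_of_minor (hD : IsSpectralData T l z (V1 q r) (V2 q r) Φ Ψ p m σ τ)
    (hκ : κ ∈ orderedSector p m) (h2p : (z κ 2).re < (z κ p).re) (hpm : (z κ p).re < (z κ m).re)
    {W : ℂ → ℂ}
    (hW : ∀ k, W k = sA T q r k 0 p * mS T q r k 1 m + sA T q r k 1 p * mS T q r k 0 m)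
    (hs0 : s33 T q r κ ≠ 0) (h0 : W κ = 0) (h1 : deriv W κ ≠ 0) :
    (∀ᶠ k in 𝓝[≠] κ, MColumnWellDefined T q r k p) ∧ MColumnWellDefined T q r κ 2 ∧
    MColumnWellDefined T q r κ m ∧
    ∀ x t, (x, t) ∈ closedDomain T → ∃ R,
      HasSimplePoleResidue (fun k => col (M T q r x t k) p) κ R ∧ (ms T q r κ 1 p ≠ 0 →
        R = (mS T q r κ 1 m * s T q r κ 2 2 / (deriv W κ * ms T q r κ 1 p)
              * Complex.exp (theta m p x t κ)) • col (M T q r x t κ) m) := by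
  have hv2 : ∀ k, minorVector (endValue T z Ψ k) p 2 = 0 := fun k => by
    simp [minorVector, mul_comm]
  have hW' : ∀ k ∈ orderedSector p m, W k = τ k ⬝ᵥ minorVector (endValue T z Ψ k) p :=
    fun k hk => by
      simp only [hW, hD.sA_eq hk, hD.mS_one_eq, hD.mS_zero_eq, dotProduct, Fin.sum_univ_three,
        hv2, mul_zero, add_zero]
  have hs : s33 T q r κ = σ κ 2 := hD.s_eq hκ 2
  rw [hs] at hs0
  have hU : orderedSector p m ∩ ({k | (z k 2).re < (z k p).re} ∩ {k | (z k p).re < (z k m).re}) ∈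
      𝓝 κ := (isOpen_orderedSector.inter ((isOpen_re_z_lt 2 p).inter
        (isOpen_re_z_lt p m))).mem_nhds ⟨hκ, h2p, hpm⟩
  obtain ⟨h2, h3⟩ := residue_of_isColumnValue (j := p) hD.lax hD.fund hU
    (((hD.differentiableOn_dotProduct hD.differentiable_minorVector).congr hW').mono
      inter_subset_left)
    hD.differentiable_minorVector.differentiableOn h0 h1 fun k hk hne => by
      rw [hW' k hk.1] at hne ⊢
      exact hD.isColumnValue_first_of_minor hk.1 hk.2.2 hk.2.1 hne
  have h4 := hD.isColumnValue_last hκ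
  have h5 := hD.isColumnValue_mid hκ (h2p.trans hpm) hs0
  refine ⟨h2, h4.wellDefined hD.fund, h5.wellDefined hD.fund,
    fun x t hxt => ⟨_, h3 x t hxt, fun hne => ?_⟩⟩
  rw [h5.col_M hD.fund hxt, mul_smul, ← columnSolution_eq_theta, ← columnSolution_smul,
    ← columnSolution_smul, hD.s_eq hκ, hD.mS_one_eq]
  congr 1
  rw [hW' κ hκ] at h0
  rw [hD.ms_one_eq hκ] at hne ⊢
  set v := minorVector (endValue T z Ψ κ) p
  simp only [dotProduct, Fin.sum_univ_three, hv2, mul_zero, add_zero, v] at h0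
  have hne' := hne
  simp only [midVector, Matrix.cons_val_zero, pow_add] at hne'
  have h7 : (-1 : ℂ) ^ (p : ℕ) ≠ 0 := pow_ne_zero _ (by norm_num)
  have h8 : τ κ 1 ≠ 0 := right_ne_zero_of_mul hne'
  funext i
  fin_cases i
  · simp only [Fin.zero_eta, Pi.smul_apply, smul_eq_mul]
    field_simp
  · simp only [midVector, Fin.mk_one, Pi.smul_apply, Matrix.cons_val_one,
      Matrix.cons_val_zero, smul_eq_mul, pow_add]
    field_simp
    linear_combination h0
  · simp [midVector, v, hv2]

end IsSpectralData

end

/-! ### Zeros of the spectral functions and assembly of the six cases. -/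

theorem SimpleZeros.mem {f : ℂ → ℂ} {D : Set ℂ} {κ : ℕ → ℂ} {n m j : ℕ}
    (h : SimpleZeros f D κ n m) (hj : j ∈ Ioc n m) :
    κ j ∈ D ∧ f (κ j) = 0 ∧ deriv f (κ j) ≠ 0 := by
  have h1 : κ j ∈ {k | k ∈ D ∧ f k = 0} := h.1 ▸ mem_image_of_mem κ hj
  exact ⟨h1.1, h1.2, h.2 j hj⟩

/-- Distinctness of the points shows that `s₃₃` does not vanish at the zeros of the `W_n`, so column
`m` is defined there. -/
theorem SimpleZeros.ne_zero {f : ℂ → ℂ} {D : Set ℂ} {κ : ℕ → ℂ} {n m j N : ℕ}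
    (h : SimpleZeros f D κ n m) (hκ : InjOn κ (Ioc 0 N)) (hm : m ≤ N) (hjN : j ∈ Ioc 0 N)
    (hj : j ∉ Ioc n m) (hD : κ j ∈ D) : f (κ j) ≠ 0 := by
  intro h0
  have h1 : κ j ∈ κ '' Ioc n m := h.1 ▸ (⟨hD, h0⟩ : κ j ∈ {k | k ∈ D ∧ f k = 0})
  obtain ⟨i, hi, hij⟩ := h1
  exact hj (hκ ⟨(Nat.zero_le n).trans_lt hi.1, hi.2.trans hm⟩ hjN hij ▸ hi)

theorem exists_isSpectralData {T : ℝ} {q r : ℝ → ℝ → ℂ} (hT : 0 < T)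
    (hL : LaxFamily T l z (V1 q r) (V2 q r)) {p m : Fin 3}
    (hpm : p = 0 ∧ m = 1 ∨ p = 1 ∧ m = 0) :
    ∃ Φ Ψ σ τ, IsSpectralData T l z (V1 q r) (V2 q r) Φ Ψ p m σ τ := by
  obtain ⟨Φ, Ψ, hΦ⟩ := hL.exists_fundamentalPair hT
  obtain ⟨σ, hσ⟩ := hL.exists_isJost hT hΦ 2
  obtain ⟨τ, hτ⟩ := hL.adjoint.exists_isJost hT hΦ.symm p
  exact ⟨Φ, Ψ, σ, τ, hT, hL, hΦ, hσ, hτ, hpm⟩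

end HalfLine

end

theorem proposition2p6 (T : ℝ) (hT : 0 < T) (q r : ℝ → ℝ → ℂ) (hqr : HalfLine.IsSolution T q r)
    (n₁ n₂ n₃ n₄ n₅ N : ℕ) (κ : ℕ → ℂ)
    (hκ : HalfLine.ZeroAssumption T q r n₁ n₂ n₃ n₄ n₅ N κ) :
    let M := HalfLine.M T q r
    let s := HalfLine.s T q r
    let S := HalfLine.S T q r
    let ms := HalfLine.ms T q r
    let mS := HalfLine.mS T q r
    let θ := HalfLine.theta
    let Ω := HalfLine.closedDomain T
    -- the columns in question are well-defined near, respectively at, the zeros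
    ((∀ j ∈ Set.Ioc 0 n₁ ∪ Set.Ioc n₄ N,
        ∀ᶠ k in nhdsWithin (κ j) {κ j}ᶜ, HalfLine.MColumnWellDefined T q r k 1) ∧
      (∀ j ∈ Set.Ioc n₁ n₄,
        ∀ᶠ k in nhdsWithin (κ j) {κ j}ᶜ, HalfLine.MColumnWellDefined T q r k 0) ∧
      (∀ j ∈ Set.Ioc 0 N, HalfLine.MColumnWellDefined T q r (κ j) 2) ∧
      (∀ j ∈ Set.Ioc n₁ n₃, HalfLine.MColumnWellDefined T q r (κ j) 1) ∧
      (∀ j ∈ Set.Ioc n₄ N, HalfLine.MColumnWellDefined T q r (κ j) 0)) ∧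
    -- zeros of s₃₃ in D₁ ∪ D₂
    (∀ j ∈ Set.Ioc 0 n₁, ∀ x t : ℝ, (x, t) ∈ Ω → ∃ R : Fin 3 → ℂ,
      HalfLine.HasSimplePoleResidue (fun k => HalfLine.col (M x t k) 1) (κ j) R ∧
      (s (κ j) 0 2 ≠ 0 →
        R = (ms (κ j) 1 0 / (s (κ j) 0 2 * deriv (HalfLine.s33 T q r) (κ j))
              * Complex.exp (θ 2 1 x t (κ j))) • HalfLine.col (M x t (κ j)) 2)) ∧
    -- zeros of W₁ in D₁
    (∀ j ∈ Set.Ioc n₁ n₂, ∀ x t : ℝ, (x, t) ∈ Ω → ∃ R : Fin 3 → ℂ,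
      HalfLine.HasSimplePoleResidue (fun k => HalfLine.col (M x t k) 0) (κ j) R ∧
      (ms (κ j) 2 0 ≠ 0 →
        R = (1 / deriv (HalfLine.W1 T q r) (κ j)) •
          (((S (κ j) 0 0 * s (κ j) 1 2 - S (κ j) 1 0 * s (κ j) 0 2) / ms (κ j) 2 0
              * Complex.exp (θ 1 0 x t (κ j))) • HalfLine.col (M x t (κ j)) 1
            + (S (κ j) 2 0 / s (κ j) 2 2
              * Complex.exp (θ 2 0 x t (κ j))) • HalfLine.col (M x t (κ j)) 2))) ∧
    -- zeros of W₂ in D₂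
    (∀ j ∈ Set.Ioc n₂ n₃, ∀ x t : ℝ, (x, t) ∈ Ω → ∃ R : Fin 3 → ℂ,
      HalfLine.HasSimplePoleResidue (fun k => HalfLine.col (M x t k) 0) (κ j) R ∧
      (ms (κ j) 1 0 ≠ 0 →
        R = (mS (κ j) 1 1 * s (κ j) 2 2 / (deriv (HalfLine.W2 T q r) (κ j) * ms (κ j) 1 0)
              * Complex.exp (θ 1 0 x t (κ j))) • HalfLine.col (M x t (κ j)) 1)) ∧
    -- zeros of s₃₃ in D₃ ∪ D₄
    (∀ j ∈ Set.Ioc n₃ n₄, ∀ x t : ℝ, (x, t) ∈ Ω → ∃ R : Fin 3 → ℂ,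
      HalfLine.HasSimplePoleResidue (fun k => HalfLine.col (M x t k) 0) (κ j) R ∧
      (s (κ j) 0 2 ≠ 0 →
        R = (ms (κ j) 1 1 / (s (κ j) 0 2 * deriv (HalfLine.s33 T q r) (κ j))
              * Complex.exp (θ 2 0 x t (κ j))) • HalfLine.col (M x t (κ j)) 2)) ∧
    -- zeros of W₃ in D₃
    (∀ j ∈ Set.Ioc n₄ n₅, ∀ x t : ℝ, (x, t) ∈ Ω → ∃ R : Fin 3 → ℂ,
      HalfLine.HasSimplePoleResidue (fun k => HalfLine.col (M x t k) 1) (κ j) R ∧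
      (ms (κ j) 1 1 ≠ 0 →
        R = (mS (κ j) 1 0 * s (κ j) 2 2 / (deriv (HalfLine.W3 T q r) (κ j) * ms (κ j) 1 1)
              * Complex.exp (θ 0 1 x t (κ j))) • HalfLine.col (M x t (κ j)) 0)) ∧
    -- zeros of W₄ in D₄
    (∀ j ∈ Set.Ioc n₅ N, ∀ x t : ℝ, (x, t) ∈ Ω → ∃ R : Fin 3 → ℂ,
      HalfLine.HasSimplePoleResidue (fun k => HalfLine.col (M x t k) 1) (κ j) R ∧
      (ms (κ j) 2 1 ≠ 0 →
        R = (1 / deriv (HalfLine.W4 T q r) (κ j)) •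
          (((S (κ j) 0 1 * s (κ j) 1 2 - S (κ j) 1 1 * s (κ j) 0 2) / ms (κ j) 2 1
              * Complex.exp (θ 0 1 x t (κ j))) • HalfLine.col (M x t (κ j)) 0
            + (S (κ j) 2 1 / s (κ j) 2 2
              * Complex.exp (θ 2 1 x t (κ j))) • HalfLine.col (M x t (κ j)) 2))) := by
  intro M s S ms mS θ Ω
  -- The data `hA` serve `D₁` and `D₂`, the data `hB` serve `D₃` and `D₄`; the two halves differ by
  -- exchanging the roles of the first two indices.
  obtain ⟨Φ, Ψ, σ, τ, hA⟩ := HalfLine.exists_isSpectralData hT (hqr.laxFamily hT)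
    (p := 0) (m := 1) (Or.inl ⟨rfl, rfl⟩)
  obtain ⟨Φ', Ψ', σ', τ', hB⟩ := HalfLine.exists_isSpectralData hT (hqr.laxFamily hT)
    (p := 1) (m := 0) (Or.inr ⟨rfl, rfl⟩)
  have l₁₂ := hκ.le₁₂
  have l₂₃ := hκ.le₂₃
  have l₃₄ := hκ.le₃₄
  have l₄₅ := hκ.le₄₅
  have l₅ := hκ.le₅
  have c1 := fun j (hj : j ∈ Set.Ioc 0 n₁) => by
    obtain ⟨hD, h0, h1⟩ := hκ.zeros_s33.mem hj
    have hk : κ j ∈ HalfLine.orderedSector 0 1 :=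
      hD.elim (fun h => ⟨h.1, h.2.1⟩) fun h => ⟨h.1, h.2.1⟩
    exact hA.residue_mid hk
      (hD.elim (fun h => h.2.2.2) fun h => h.2.2.1.trans h.2.2.2) h0 h1
  have c2 := fun j (hj : j ∈ Set.Ioc n₁ n₂) => by
    obtain ⟨hD, h0, h1⟩ := hκ.zeros_W1.mem hj
    refine hA.residue_first_of_end ⟨hD.1, hD.2.1⟩ hD.2.2.2 hD.2.2.1 (W := HalfLine.W1 T q r)
      (fun k => ?_) (hκ.zeros_s33.ne_zero hκ.distinct ?_ ?_ ?_ (Or.inl hD)) h0 h1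
    · simp only [HalfLine.W1, HalfLine.ms, Fin.sum_univ_three, Fin.isValue, Fin.coe_ofNat_eq_mod]
      norm_num
      ring
    all_goals simp only [Set.mem_Ioc] at hj ⊢; omega
  have c3 := fun j (hj : j ∈ Set.Ioc n₂ n₃) => by
    obtain ⟨hD, h0, h1⟩ := hκ.zeros_W2.mem hj
    refine hA.residue_first_of_minor ⟨hD.1, hD.2.1⟩ hD.2.2.1 hD.2.2.2 (W := HalfLine.W2 T q r)
      (fun k => ?_) (hκ.zeros_s33.ne_zero hκ.distinct ?_ ?_ ?_ (Or.inr hD)) h0 h1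
    · simp only [HalfLine.W2, HalfLine.ms, Fin.isValue, Fin.coe_ofNat_eq_mod]
      norm_num
    all_goals simp only [Set.mem_Ioc] at hj ⊢; omega
  have c4 := fun j (hj : j ∈ Set.Ioc n₃ n₄) => by
    obtain ⟨hD, h0, h1⟩ := hκ.zeros_s33'.mem hj
    have hk : κ j ∈ HalfLine.orderedSector 1 0 :=
      hD.elim (fun h => ⟨h.1, h.2.1⟩) fun h => ⟨h.1, h.2.1⟩
    exact hB.residue_mid hk
      (hD.elim (fun h => h.2.2.1.trans h.2.2.2) fun h => h.2.2.2) h0 h1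
  have c5 := fun j (hj : j ∈ Set.Ioc n₄ n₅) => by
    obtain ⟨hD, h0, h1⟩ := hκ.zeros_W3.mem hj
    refine hB.residue_first_of_minor ⟨hD.1, hD.2.1⟩ hD.2.2.1 hD.2.2.2 (W := HalfLine.W3 T q r)
      (fun k => ?_) (hκ.zeros_s33'.ne_zero hκ.distinct ?_ ?_ ?_ (Or.inl hD)) h0 h1
    · simp only [HalfLine.W3, HalfLine.ms, Fin.isValue, Fin.coe_ofNat_eq_mod]
      norm_num
      ring
    all_goals simp only [Set.mem_Ioc] at hj ⊢; omega
  have c6 := fun j (hj : j ∈ Set.Ioc n₅ N) => by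
    obtain ⟨hD, h0, h1⟩ := hκ.zeros_W4.mem hj
    refine hB.residue_first_of_end ⟨hD.1, hD.2.1⟩ hD.2.2.2 hD.2.2.1 (W := HalfLine.W4 T q r)
      (fun k => ?_) (hκ.zeros_s33'.ne_zero hκ.distinct ?_ ?_ ?_ (Or.inr hD)) h0 h1
    · simp only [HalfLine.W4, HalfLine.ms, Fin.sum_univ_three, Fin.isValue, Fin.coe_ofNat_eq_mod]
      norm_num
      ring
    all_goals simp only [Set.mem_Ioc] at hj ⊢; omega
  refine ⟨⟨fun j hj => ?_, fun j hj => ?_, fun j hj => ?_, fun j hj => ?_, fun j hj => ?_⟩,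
    fun j hj => (c1 j hj).2.2, fun j hj => (c2 j hj).2.2.2, fun j hj => (c3 j hj).2.2.2,
    fun j hj => (c4 j hj).2.2, fun j hj => (c5 j hj).2.2.2, fun j hj => (c6 j hj).2.2.2⟩
  · rcases hj with hj | hj
    · exact (c1 j hj).1
    · rcases le_or_gt j n₅ with h | h
      · exact (c5 j ⟨hj.1, h⟩).1
      · exact (c6 j ⟨h, hj.2⟩).1
  · rcases le_or_gt j n₂ with h | h
    · exact (c2 j ⟨hj.1, h⟩).1
    rcases le_or_gt j n₃ with h' | h'
    · exact (c3 j ⟨h, h'⟩).1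
    · exact (c4 j ⟨h', hj.2⟩).1
  · rcases le_or_gt j n₁ with h1 | h1
    · exact (c1 j ⟨hj.1, h1⟩).2.1
    rcases le_or_gt j n₂ with h2 | h2
    · exact (c2 j ⟨h1, h2⟩).2.1
    rcases le_or_gt j n₃ with h3 | h3
    · exact (c3 j ⟨h2, h3⟩).2.1
    rcases le_or_gt j n₄ with h4 | h4
    · exact (c4 j ⟨h3, h4⟩).2.1
    rcases le_or_gt j n₅ with h5 | h5
    · exact (c5 j ⟨h4, h5⟩).2.1
    · exact (c6 j ⟨h5, hj.2⟩).2.1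
  · rcases le_or_gt j n₂ with h | h
    · exact (c2 j ⟨hj.1, h⟩).2.2.1
    · exact (c3 j ⟨h, hj.2⟩).2.2.1
  · rcases le_or_gt j n₅ with h | h
    · exact (c5 j ⟨hj.1, h⟩).2.2.1
    · exact (c6 j ⟨h, hj.2⟩).2.2.1
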